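/- **Setting.** A *pre-broad poset* is a set $P$ with a relation $e_1\cdots e_n\le e$ between elements of the free commutative monoid $P^+$ and elements of $P$ ("edges") that is reflexive ($e\le e$) and broadly transitive (if $f_1\cdots f_n\le e$ and $\underline g_i\le f_i$ for all $i$, then $\underline g_1\cdots\underline g_n\le e$). It is a *broad poset* if $e\le f$ and $f\le e$ imply $e=f$, and *simple* if $e_1\cdots e_n\le e$ forces the $e_i$ to be distinct. Write $\underline f\le\underline e$ for tuples if $\underline f=\underline f_1\cdots\underline f_k$ and $\underline e=e_1\cdots e_k$ with $\underline f_i\le e_i$, and $f\le_d e$ if $f$ occurs in some $\underline f\le e$. An edge $e$ is a *leaf* if there is no $\underline f<e$ (i.e. $\underline f\le e$, $\underline f\ne e$); it is a *node* (resp. a *stump*) if there is a maximum $\underline f<e$ and it is non-empty (resp. empty). A *tree* (resp. *forest*) is a finite simple broad poset in which each edge is a leaf, node or stump, and which has a $\le_d$-maximum $r$, its *root* (resp. in which each edge lies below a unique $\le_d$-maximal edge; the tuple of maximal edges is the *root tuple*). An edge is *inner* if it is neither a leaf nor $\le_d$-maximal. $[n]=\{0\le 1\le\dots\le n\}$ is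 the linear tree, with root $n$, and $\eta=[0]$. Let $\Omega$ be the category of trees and $\mathsf{dSet}=\mathsf{Set}^{\Omega^{op}}$. For a tree $T$, $\Omega[T]$ is the representable presheaf; for a forest $F=\amalg_i T_i$, $\Omega[F]=\amalg_i\Omega[T_i]$. A *face* of $T$ is an injective map of trees into $T$. $\partial\Omega[T]\subset\Omega[T]$ is the union of the non-invertible faces. For a set $E$ of inner edges of a forest $F=\amalg_iT_i$, $\Lambda^E[F]\subset\Omega[F]$ is the union of all faces of the $T_i$ other than the $T_i-E'$ with $E'\subset E$, where $T_i-E'$ is obtained by removing the edges in $E'$ and keeping all broad relations between the remaining ones. The tensor product $S\otimes T$ of pre-broad posets has underlying set $S\times T$ and relations generated by $\underline s\times t\le(s,t)$ and $s\times\underline t\le(s,t)$ for $\underline s\le s$, $\underline t\le t$; the tensor product of dendroidal sets is determined by $\Omega[S]\otimes\Omega[T]=\mathrm{Hom}(-,S\otimes T)$ together with preservation of colimits in each variable. The join $S\star[n]$ of a tree $S$ with root $r$ and $[n]$ is the tree with edges $S\amalg[n]$ and relations those of $S$, those of $[n]$, and $\underline s\le i$ for $i\in[n]$ whenever $\underline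 s\le r$ in $S$. In particular $S\star\eta$ is $S$ with a new root edge $\eta$ attached below $r$ by a unary vertex. The outer horn $\Lambda^\eta[S\star\eta]\subset\Omega[S\star\eta]$ is the union of all faces of $S\star\eta$ other than $S\star\eta$ itself and $(S\star\eta)-\eta\simeq S$. Let $G$ be a finite group, and let $\mathsf{dSet}^G$ be the category of dendroidal sets with a $G$-action (tensor products carry the diagonal action, and $\eta$ and $[n]$ the trivial one). A *$G$-tree* is a forest with a $G$-action whose root tuple is a single $G$-orbit. The *$G$-inner anodyne extensions* are the closure, under pushouts, transfinite compositions and retracts, of the maps $\Lambda^{Ge}[T]\to\Omega[T]$ in $\mathsf{dSet}^G$, where $T$ is a $G$-tree and $Ge$ is the $G$-orbit of an inner edge $e$ of $T$. **Theorem.** Let $S\not\simeq\eta$ be a tree with a $G$-action, with root $r\colon\eta\to S$. Let $\{1\}\to\Omega[1]$ be the inclusion of the root of $[1]$, and let $$A=\partial\Omega[S]\otimes\Omega[1]\amalg_{\partial\Omega[S]\otimes\{1\}}\Omega[S]\otimes\{1\}\longrightarrow\Omega[S]\otimes\Omega[1]$$ be the pushout-product map. Then there is a factorization $A\to B\to\Omega[S]\otimes\Omega[1]$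 of this map in $\mathsf{dSet}^G$ such that (a) $A\to B$ is a $G$-inner anodyne extension; (b) there is a pushout square in $\mathsf{dSet}^G$ $$\begin{array}{ccc}\Lambda^\eta[S\star\eta]&\longrightarrow&B\\ \downarrow&&\downarrow\\ \Omega[S\star\eta]&\longrightarrow&\Omega[S]\otimes\Omega[1]\end{array}$$ in which the left map is the inclusion and the right map is the one of the factorization; (c) the composite $\Omega[1]\simeq\Omega[\eta\star\eta]\xrightarrow{\,r\star id\,}\Omega[S\star\eta]\to\Omega[S]\otimes\Omega[1]$, whose last map is the bottom map of (b), equals the composite $\Omega[1]\simeq\eta\otimes\Omega[1]\xrightarrow{\,r\otimes id\,}\Omega[S]\otimes\Omega[1]$. -/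

import Mathlib

open CategoryTheory CategoryTheory.Limits Opposite

namespace Dendro

/-! ### Broad posets -/

/-- A (commutative) pre-broad poset structure on `T`: a reflexive and broadly transitive relation
between the free commutative monoid `Multiset T` and `T`.  In `trans`, the multiset `s` collects
the pairs `(gᵢ, fᵢ)`: from `gᵢ ≤ fᵢ` and `f₁ ⋯ fₙ ≤ e` one gets `g₁ ⋯ gₙ ≤ e`. -/
structure BroadStr (T : Type) where
  rel : Multiset T → T → Prop
  refl : ∀ e, rel {e} e
  trans : ∀ (s : Multiset (Multiset T × T)) (e : T), (∀ p ∈ s, rel p.1 p.2) →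
    rel (s.map Prod.snd) e → rel (s.map Prod.fst).sum e

/-- A pre-broad poset; its elements are called edges. -/
structure PreBroad where
  carrier : Type
  str : BroadStr carrier

namespace PreBroad

instance : CoeSort PreBroad Type := ⟨PreBroad.carrier⟩

/-- The broad relation `s ≤ e`. -/
abbrev rel (P : PreBroad) (s : Multiset P) (e : P) : Prop := P.str.rel s e

/-- Monotone maps of pre-broad posets. -/
@[ext]
structure Hom (P Q : PreBroad) where
  toFun : P → Q
  map_rel : ∀ s e, P.rel s e → Q.rel (s.map toFun) (toFun e)

instance : Category PreBroad where
  Hom P Q := Hom P Q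
  id P := ⟨fun x => x, fun s e h => by simpa using h⟩
  comp f g := ⟨fun x => g.toFun (f.toFun x), fun s e h => by
    have := g.map_rel _ _ (f.map_rel _ _ h)
    rwa [Multiset.map_map] at this⟩

@[ext]
theorem hom_ext {P Q : PreBroad} {f g : P ⟶ Q} (h : ∀ x, f.toFun x = g.toFun x) : f = g :=
  Hom.ext (funext h)

@[simp] theorem id_toFun (P : PreBroad) (x : P) : Hom.toFun (𝟙 P) x = x := rfl

@[simp] theorem comp_toFun {P Q R : PreBroad} (f : P ⟶ Q) (g : Q ⟶ R) (x : P) :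
    Hom.toFun (f ≫ g) x = g.toFun (f.toFun x) := rfl

variable (P : PreBroad)

/-- The induced relation on tuples: `a = a₁ ⋯ aₖ`, `b = b₁ ⋯ bₖ` with `aᵢ ≤ bᵢ`. -/
def LeTuple (a b : Multiset P) : Prop :=
  ∃ s : Multiset (Multiset P × P), (∀ p ∈ s, P.rel p.1 p.2) ∧
    (s.map Prod.fst).sum = a ∧ s.map Prod.snd = b

/-- `f` is a descendant of `e`: `f ≤_d e`. -/
def Desc (f e : P) : Prop := ∃ s, f ∈ s ∧ P.rel s e

/-- `r` is `≤_d`-maximal. -/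
def IsRoot (r : P) : Prop := ∀ e, P.Desc r e → e = r

/-- The root tuple: every `≤_d`-maximal edge, exactly once. -/
def IsRootTuple (r : Multiset P) : Prop := r.Nodup ∧ ∀ x, x ∈ r ↔ P.IsRoot x

def IsLeaf (e : P) : Prop := ∀ s, P.rel s e → s = {e}

/-- `f` is the maximum of the tuples `g < e`. -/
def IsMaxBelow (f : Multiset P) (e : P) : Prop :=
  P.rel f e ∧ f ≠ {e} ∧ ∀ g, P.rel g e → g ≠ {e} → P.LeTuple g f

def IsNode (e : P) : Prop := ∃ f, f ≠ 0 ∧ P.IsMaxBelow f e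

def IsStump (e : P) : Prop := P.IsMaxBelow 0 e

/-- An internal edge. -/
def IsInner (e : P) : Prop := ¬ P.IsLeaf e ∧ ¬ P.IsRoot e

/-- Finite simple nodal broad posets. -/
structure IsNodalPoset : Prop where
  finite : Finite P
  antisymm : ∀ e f : P, P.rel {e} f → P.rel {f} e → e = f
  simple : ∀ s (e : P), P.rel s e → s.Nodup
  nodal : ∀ e : P, P.IsLeaf e ∨ P.IsNode e ∨ P.IsStump e

/-- Trees (dendroidally ordered sets). -/
structure IsTree : Prop extends P.IsNodalPoset where
  root : ∃ r : P, ∀ e, P.Desc e r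

/-- Forests (forestially ordered sets). -/
structure IsForest : Prop extends P.IsNodalPoset where
  root_tuple : ∀ e : P, ∃! r : P, P.IsRoot r ∧ P.Desc e r

variable {P}

theorem desc_refl (e : P) : P.Desc e e := ⟨{e}, by simp, P.str.refl e⟩

theorem rel_subst {a : P} {t u : Multiset P} {e : P} (h : P.rel (a ::ₘ t) e) (hu : P.rel u a) :
    P.rel (u + t) e := by
  have := P.str.trans ((u, a) ::ₘ t.map (fun x => ({x}, x))) e
    (by
      intro p hp
      rcases Multiset.mem_cons.1 hp with rfl | hp
      · exact hu
      · obtain ⟨x, -, rfl⟩ := Multiset.mem_map.1 hp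
        exact P.str.refl x)
    (by simpa [Multiset.map_map, Function.comp_def] using h)
  simpa [Multiset.map_map, Function.comp_def] using this

theorem IsNodalPoset.eq_zero (hP : P.IsNodalPoset) {e : P} {t : Multiset P}
    (h : P.rel (e ::ₘ t) e) : t = 0 := by
  by_contra ht
  obtain ⟨x, hx⟩ := Multiset.exists_mem_of_ne_zero ht
  have h2 := hP.simple _ _ (rel_subst h h)
  rw [Multiset.cons_add, Multiset.nodup_cons, Multiset.nodup_add] at h2
  exact Multiset.disjoint_left.1 h2.2.2.2 hx hx

theorem IsNodalPoset.desc_antisymm (hP : P.IsNodalPoset) {e f : P} (h₁ : P.Desc e f)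
    (h₂ : P.Desc f e) : e = f := by
  obtain ⟨s, hs, h₁⟩ := h₁
  obtain ⟨t, ht, h₂⟩ := h₂
  obtain ⟨s, rfl⟩ := Multiset.exists_cons_of_mem hs
  obtain ⟨t, rfl⟩ := Multiset.exists_cons_of_mem ht
  have h := rel_subst h₂ h₁
  rw [Multiset.cons_add] at h
  have := hP.eq_zero h
  obtain ⟨rfl, rfl⟩ := add_eq_zero.1 this
  exact hP.antisymm _ _ h₁ h₂

theorem Hom.map_desc {P Q : PreBroad} (φ : P ⟶ Q) {f e : P} (h : P.Desc f e) :
    Q.Desc (φ.toFun f) (φ.toFun e) := by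
  obtain ⟨s, hs, h⟩ := h
  exact ⟨_, Multiset.mem_map_of_mem _ hs, φ.map_rel _ _ h⟩

theorem Hom.map_leTuple {P Q : PreBroad} (φ : P ⟶ Q) {a b : Multiset P} (h : P.LeTuple a b) :
    Q.LeTuple (a.map φ.toFun) (b.map φ.toFun) := by
  obtain ⟨s, hs, rfl, rfl⟩ := h
  refine ⟨s.map (fun p => (p.1.map φ.toFun, φ.toFun p.2)), ?_, ?_, ?_⟩
  · intro p hp
    obtain ⟨q, hq, rfl⟩ := Multiset.mem_map.1 hp
    exact φ.map_rel _ _ (hs q hq)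
  · have := (Multiset.mapAddMonoidHom φ.toFun).map_multiset_sum (s.map Prod.fst)
    simp only [Multiset.coe_mapAddMonoidHom] at this
    rw [this]
    simp [Multiset.map_map]
  · simp [Multiset.map_map]

theorem leTuple_refl (a : Multiset P) : P.LeTuple a a := by
  refine ⟨a.map (fun x => ({x}, x)), ?_, ?_, ?_⟩
  · intro p hp
    obtain ⟨q, hq, rfl⟩ := Multiset.mem_map.1 hp
    exact P.str.refl q
  · simp [Multiset.map_map]
  · simp [Multiset.map_map]

theorem exists_split {α β : Type} (f : α → β) (s : Multiset α) (a b : Multiset β)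
    (h : s.map f = a + b) : ∃ s₁ s₂, s = s₁ + s₂ ∧ s₁.map f = a ∧ s₂.map f = b := by
  induction a using Multiset.induction generalizing s with
  | empty => exact ⟨0, s, by simp, by simp, by simpa using h⟩
  | cons x a ih =>
    have hx : x ∈ s.map f := by rw [h]; simp
    obtain ⟨y, hy, rfl⟩ := Multiset.mem_map.1 hx
    obtain ⟨s, rfl⟩ := Multiset.exists_cons_of_mem hy
    rw [Multiset.map_cons, Multiset.cons_add, Multiset.cons_inj_right] at h
    obtain ⟨s₁, s₂, rfl, rfl, rfl⟩ := ih s h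
    exact ⟨y ::ₘ s₁, s₂, by simp, by simp, rfl⟩

theorem leTuple_trans {a b c : Multiset P} (h₁ : P.LeTuple a b) (h₂ : P.LeTuple b c) :
    P.LeTuple a c := by
  obtain ⟨s', hs', rfl, rfl⟩ := h₂
  induction s' using Multiset.induction generalizing a with
  | empty =>
    obtain ⟨s, hs, rfl, h⟩ := h₁
    have : s = 0 := by simpa using h
    subst this
    exact ⟨0, by simp, by simp, by simp⟩
  | cons p s' ih =>
    obtain ⟨s, hs, rfl, h⟩ := h₁
    rw [Multiset.map_cons, Multiset.sum_cons] at h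
    obtain ⟨s₁, s₂, rfl, h1, h2⟩ := exists_split _ _ _ _ h
    obtain ⟨u, hu, hu1, hu2⟩ := ih (a := (s₂.map Prod.fst).sum)
      (fun q hq => hs' q (by simp [hq])) ⟨s₂, fun q hq => hs q (by simp [hq]), rfl, h2⟩
    refine ⟨((s₁.map Prod.fst).sum, p.2) ::ₘ u, ?_, by simp [hu1], by simp [hu2]⟩
    intro q hq
    rcases Multiset.mem_cons.1 hq with rfl | hq
    · exact P.str.trans s₁ p.2 (fun q hq => hs q (by simp [hq]))
        (by rw [h1]; exact hs' p (by simp))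
    · exact hu q hq

end PreBroad

/-! ### Linear trees, tensor products and joins of broad posets -/

/-- The linear tree `[n] = {0 ≤ 1 ≤ ⋯ ≤ n}`; its root is `n`. -/
abbrev linear (n : ℕ) : PreBroad where
  carrier := Fin (n + 1)
  str :=
    { rel := fun s j => ∃ i ≤ j, s = {i}
      refl := fun e => ⟨e, le_refl e, rfl⟩
      trans := by
        rintro s e hs ⟨i, hi, h⟩
        obtain ⟨p, rfl, rfl⟩ := Multiset.map_eq_singleton.1 h
        obtain ⟨k, hk, hp⟩ := hs p (by simp)
        exact ⟨k, hk.trans hi, by simpa using hp⟩ }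

theorem linear_isTree (n : ℕ) : (linear n).IsTree where
  finite := inferInstanceAs (Finite (Fin (n + 1)))
  antisymm := by
    rintro e f ⟨i, hi, h⟩ ⟨j, hj, h'⟩
    rw [Multiset.singleton_inj] at h h'
    subst h h'
    exact le_antisymm hi hj
  simple := by
    rintro s e ⟨i, hi, rfl⟩
    exact Multiset.nodup_singleton _
  nodal := by
    intro e
    change Fin (n + 1) at e
    induction e using Fin.cases with
    | zero =>
      left
      rintro s ⟨i, hi, rfl⟩
      have : i = 0 := Fin.le_zero_iff.1 hi
      subst this
      rfl
    | succ k =>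
      right; left
      refine ⟨{k.castSucc}, by simp, ⟨k.castSucc, k.castSucc_lt_succ.le, rfl⟩, ?_, ?_⟩
      · intro h
        rw [Multiset.singleton_inj] at h
        exact k.castSucc_lt_succ.ne h
      · rintro g ⟨i, hi, rfl⟩ hne
        have hlt : i < k.succ := lt_of_le_of_ne hi (fun h => hne (by rw [h]))
        exact ⟨{({i}, k.castSucc)}, by
          intro p hp
          rw [Multiset.mem_singleton] at hp
          subst hp
          exact ⟨i, Fin.le_castSucc_iff.2 hlt, rfl⟩, by simp, by simp⟩
  root := ⟨Fin.last n, fun e => ⟨{e}, by simp, e, Fin.le_last _, rfl⟩⟩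

/-- The tree `η` with a single edge. -/
abbrev eta : PreBroad := linear 0

/-- The relations of the tensor product, generated by `s × t ≤ (a, t)` for `s ≤ a` and by
`a × s ≤ (a, t)` for `s ≤ t`. -/
inductive TensorRel (S T : PreBroad) : Multiset (S × T) → S × T → Prop
  | refl (e : S × T) : TensorRel S T {e} e
  | left (s : Multiset S) (a : S) (t : T) : S.rel s a →
      TensorRel S T (s.map fun x => (x, t)) (a, t)
  | right (a : S) (s : Multiset T) (t : T) : T.rel s t →
      TensorRel S T (s.map fun y => (a, y)) (a, t)
  | trans (s : Multiset (Multiset (S × T) × (S × T))) (e : S × T) :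
      (∀ p ∈ s, TensorRel S T p.1 p.2) → TensorRel S T (s.map Prod.snd) e →
      TensorRel S T (s.map Prod.fst).sum e

/-- The tensor product of pre-broad posets. -/
abbrev tens (S T : PreBroad) : PreBroad where
  carrier := S × T
  str := ⟨TensorRel S T, TensorRel.refl, TensorRel.trans⟩

/-- Recursion principle: to map out of a tensor product it suffices to check the generators. -/
def tensLift {S T Q : PreBroad} (f : S × T → Q)
    (hl : ∀ s a t, S.rel s a → Q.rel (s.map fun x => f (x, t)) (f (a, t)))
    (hr : ∀ a s t, T.rel s t → Q.rel (s.map fun y => f (a, y)) (f (a, t))) :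
    tens S T ⟶ Q where
  toFun := f
  map_rel := by
    intro s e h
    change TensorRel S T s e at h
    induction h with
    | refl e => simpa using Q.str.refl (f e)
    | left s a t h => simpa [Multiset.map_map, Function.comp_def] using hl s a t h
    | right a s t h => simpa [Multiset.map_map, Function.comp_def] using hr a s t h
    | trans s e hs he ih1 ih2 =>
      have := Q.str.trans (s.map fun p => (p.1.map f, f p.2)) (f e)
        (by
          intro p hp
          obtain ⟨q, hq, rfl⟩ := Multiset.mem_map.1 hp
          exact ih1 q hq)
        (by
          simp only [Multiset.map_map, Function.comp_def] at ih2 ⊢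
          exact ih2)
      have h2 := (Multiset.mapAddMonoidHom f).map_multiset_sum (s.map Prod.fst)
      simp only [Multiset.coe_mapAddMonoidHom] at h2
      change Q.rel (Multiset.map f (s.map Prod.fst).sum) (f e)
      rw [h2]
      simp only [Multiset.map_map, Function.comp_def] at this ⊢
      exact this

/-- Functoriality of the tensor product. -/
def tensMap {S S' T T' : PreBroad} (f : S ⟶ S') (g : T ⟶ T') : tens S T ⟶ tens S' T' :=
  tensLift (Q := tens S' T') (fun p => (f.toFun p.1, g.toFun p.2))
    (fun s a t h => by
      have := TensorRel.left (T := T') _ _ (g.toFun t) (f.map_rel s a h)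
      rw [Multiset.map_map] at this
      exact this)
    (fun a s t h => by
      have := TensorRel.right (S := S') (f.toFun a) _ _ (g.map_rel s t h)
      rw [Multiset.map_map] at this
      exact this)

@[simp] theorem tensMap_id (S T : PreBroad) : tensMap (𝟙 S) (𝟙 T) = 𝟙 (tens S T) := rfl

theorem tensMap_comp {S S' S'' T T' T'' : PreBroad} (f : S ⟶ S') (f' : S' ⟶ S'')
    (g : T ⟶ T') (g' : T' ⟶ T'') :
    tensMap (f ≫ f') (g ≫ g') = tensMap f g ≫ tensMap f' g' := rfl

/-- The unit isomorphism `T ≅ η ⊗ T`. -/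
def etaTens (T : PreBroad) : T ≅ tens eta T where
  hom :=
    { toFun := fun t => ((0 : Fin 1), t)
      map_rel := fun s e h => TensorRel.right (S := eta) (0 : Fin 1) s e h }
  inv := tensLift (fun p => p.2)
    (by
      rintro s a t ⟨i, hi, rfl⟩
      simpa using T.str.refl t)
    (by
      intro a s t h
      simpa using h)
  hom_inv_id := rfl
  inv_hom_id := by
    apply PreBroad.hom_ext
    rintro ⟨a, t⟩
    exact Prod.ext (Subsingleton.elim (α := Fin 1) _ _) rfl

/-- The relations of the join `F ⋆ [n]`: those of `F`, those of `[n]`, and `t ≤ i` for `i ∈ [n]`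
whenever the tuple `t` of edges of `F` satisfies `t ≤ r_F`, with `r_F` the root tuple of `F`. -/
def joinRel (F : PreBroad) (n : ℕ) :
    Multiset (F ⊕ Fin (n + 1)) → F ⊕ Fin (n + 1) → Prop
  | s, .inl e => ∃ t, s = t.map Sum.inl ∧ F.rel t e
  | s, .inr j => (∃ i ≤ j, s = {Sum.inr i}) ∨
      ∃ t r, s = t.map Sum.inl ∧ F.IsRootTuple r ∧ F.LeTuple t r

theorem joinRel_lift (F : PreBroad) (n : ℕ)
    (s : Multiset (Multiset (F ⊕ Fin (n + 1)) × (F ⊕ Fin (n + 1))))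
    (hs : ∀ p ∈ s, joinRel F n p.1 p.2) (t : Multiset F)
    (h : s.map Prod.snd = t.map Sum.inl) :
    ∃ u, (s.map Prod.fst).sum = u.map Sum.inl ∧ F.LeTuple u t := by
  induction t using Multiset.induction generalizing s with
  | empty =>
    have : s = 0 := by simpa using h
    subst this
    exact ⟨0, by simp, PreBroad.leTuple_refl 0⟩
  | cons x t ih =>
    have hx : Sum.inl x ∈ s.map Prod.snd := by rw [h]; simp
    obtain ⟨⟨g, y⟩, hy, hyx⟩ := Multiset.mem_map.1 hx
    obtain ⟨s, rfl⟩ := Multiset.exists_cons_of_mem hy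
    simp only at hyx
    subst hyx
    rw [Multiset.map_cons, Multiset.map_cons, Multiset.cons_inj_right] at h
    obtain ⟨u, hu, v, hv, rfl, rfl⟩ := ih s (fun p hp => hs p (by simp [hp])) h
    obtain ⟨w, hw, hwx⟩ := hs _ hy
    refine ⟨w + (v.map Prod.fst).sum, ?_, (w, x) ::ₘ v, ?_, by simp, by simp⟩
    · simp only at hw
      simp [hu, hw]
    · intro p hp
      rcases Multiset.mem_cons.1 hp with rfl | hp
      · exact hwx
      · exact hv p hp

/-- The join `F ⋆ [n]`. -/
abbrev join (F : PreBroad) (n : ℕ) : PreBroad where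
  carrier := F ⊕ Fin (n + 1)
  str :=
    { rel := joinRel F n
      refl := by
        rintro (e | j)
        · exact ⟨{e}, by simp, F.str.refl e⟩
        · exact Or.inl ⟨j, le_refl j, rfl⟩
      trans := by
        rintro s (e | j) hs h
        · obtain ⟨t, ht, hte⟩ := h
          obtain ⟨u, hu, v, hv, rfl, rfl⟩ := joinRel_lift F n s hs t ht
          exact ⟨_, hu, F.str.trans v e hv hte⟩
        · rcases h with ⟨i, hi, h⟩ | ⟨t, r, ht, hr, htr⟩
          · obtain ⟨p, rfl, hp⟩ := Multiset.map_eq_singleton.1 h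
            have := hs p (by simp)
            rw [hp] at this
            rcases this with ⟨k, hk, h'⟩ | ⟨t, r, ht, hr⟩
            · exact Or.inl ⟨k, hk.trans hi, by simpa using h'⟩
            · exact Or.inr ⟨t, r, by simpa using ht, hr⟩
          · obtain ⟨u, hu, hut⟩ := joinRel_lift F n s hs t ht
            exact Or.inr ⟨u, r, hu, hr, PreBroad.leTuple_trans hut htr⟩ }

/-- Wide maps: the root tuple of `F` is sent to a tuple `≤` the root tuple of `F'`. -/
def IsWide {F F' : PreBroad} (φ : F ⟶ F') : Prop :=
  ∀ r, F.IsRootTuple r → ∃ r', F'.IsRootTuple r' ∧ F'.LeTuple (r.map φ.toFun) r'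

/-- The map `φ ⋆ id`, defined for wide `φ`. -/
def joinMap {F F' : PreBroad} (φ : F ⟶ F') (hφ : IsWide φ) (n : ℕ) : join F n ⟶ join F' n where
  toFun := Sum.map φ.toFun id
  map_rel := by
    rintro s (e | j) h
    · obtain ⟨t, rfl, ht⟩ := h
      exact ⟨t.map φ.toFun, by simp [Multiset.map_map, Function.comp_def], φ.map_rel _ _ ht⟩
    · rcases h with ⟨i, hi, rfl⟩ | ⟨t, r, rfl, hr, ht⟩
      · exact Or.inl ⟨i, hi, by simp⟩
      · obtain ⟨r', hr', hrr'⟩ := hφ r hr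
        exact Or.inr ⟨t.map φ.toFun, r', by simp [Multiset.map_map, Function.comp_def], hr',
          PreBroad.leTuple_trans (φ.map_leTuple ht) hrr'⟩

theorem isWide_of_iso {F F' : PreBroad} (α : F ≅ F') : IsWide α.hom := by
  have h1 : ∀ x, α.inv.toFun (α.hom.toFun x) = x := fun x => by
    rw [← PreBroad.comp_toFun, α.hom_inv_id]; rfl
  have h2 : ∀ x, α.hom.toFun (α.inv.toFun x) = x := fun x => by
    rw [← PreBroad.comp_toFun, α.inv_hom_id]; rfl
  intro r hr
  refine ⟨r.map α.hom.toFun, ⟨hr.1.map (Function.LeftInverse.injective h1), ?_⟩,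
    PreBroad.leTuple_refl _⟩
  intro x
  rw [Multiset.mem_map]
  constructor
  · rintro ⟨y, hy, rfl⟩ e he
    have := (hr.2 y).1 hy (α.inv.toFun e) (by simpa [h1] using α.inv.map_desc he)
    rw [← this, h2]
  · intro hx
    refine ⟨α.inv.toFun x, (hr.2 _).2 ?_, h2 x⟩
    intro e he
    have := hx (α.hom.toFun e) (by simpa [h2] using α.hom.map_desc he)
    rw [← this, h1]

/-- The isomorphism `[1] ≅ η ⋆ η`. -/
def linearOneIso : linear 1 ≅ join eta 0 where
  hom :=
    { toFun := fun i => if i = (0 : Fin 2) then Sum.inl (0 : Fin 1) else Sum.inr 0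
      map_rel := by
        have hr : eta.IsRootTuple {(0 : Fin 1)} :=
          ⟨Multiset.nodup_singleton _, fun x =>
            ⟨fun _ e _ => Subsingleton.elim (α := Fin 1) _ _, fun _ => by
              rw [Multiset.mem_singleton]; exact Subsingleton.elim (α := Fin 1) _ _⟩⟩
        rintro s j ⟨i, hij, rfl⟩
        change Fin 2 at i j
        fin_cases i <;> fin_cases j
        · exact ⟨{(0 : Fin 1)}, by simp, eta.str.refl _⟩
        · exact Or.inr ⟨{(0 : Fin 1)}, {(0 : Fin 1)}, by simp, hr, PreBroad.leTuple_refl _⟩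
        · exact absurd hij (by decide)
        · exact Or.inl ⟨0, le_refl _, by simp⟩ }
  inv :=
    { toFun := Sum.elim (fun _ => (0 : Fin 2)) (fun _ => (1 : Fin 2))
      map_rel := by
        rintro s (e | j) h
        · obtain ⟨t, rfl, i, hi, rfl⟩ := h
          exact ⟨0, le_refl _, by simp⟩
        · rcases h with ⟨i, hi, rfl⟩ | ⟨t, r, rfl, hr, v, hv, rfl, rfl⟩
          · exact ⟨1, le_refl _, by simp⟩
          · have hr' : v.map Prod.snd = {(0 : Fin 1)} := by
              refine (Multiset.Nodup.ext hr.1 (Multiset.nodup_singleton _)).2 (fun x => ?_)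
              rw [hr.2]
              exact ⟨fun _ => by
                rw [Multiset.mem_singleton]; exact Subsingleton.elim (α := Fin 1) _ _,
                fun _ e _ => Subsingleton.elim (α := Fin 1) _ _⟩
            obtain ⟨p, rfl, hp⟩ := Multiset.map_eq_singleton.1 hr'
            obtain ⟨i, hi, hp1⟩ := hv p (by simp)
            exact ⟨0, Fin.zero_le _, by simp [hp1]⟩ }
  hom_inv_id := by
    apply PreBroad.hom_ext
    intro i
    change Fin 2 at i
    fin_cases i <;> rfl
  inv_hom_id := by
    apply PreBroad.hom_ext
    rintro (e | j)
    · exact congrArg Sum.inl (Subsingleton.elim (α := Fin 1) _ _)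
    · exact congrArg Sum.inr (Subsingleton.elim (α := Fin 1) _ _)

/-! ### Dendroidal sets -/

/-- The objects of a small model of the category `Ω` of trees: trees with set of edges `Fin n`.
Every tree is isomorphic to one of these. -/
structure Omega : Type where
  n : ℕ
  str : BroadStr (Fin n)
  isTree : PreBroad.IsTree ⟨Fin n, str⟩

/-- The underlying pre-broad poset. -/
def Omega.toPre (U : Omega) : PreBroad := ⟨Fin U.n, U.str⟩

instance : SmallCategory Omega where
  Hom U V := U.toPre ⟶ V.toPre
  id U := 𝟙 U.toPre
  comp f g := PreBroad.Hom.mk (fun x => g.toFun (f.toFun x)) (f ≫ g : _ ⟶ _).map_rel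

/-- The (fully faithful) inclusion of `Ω` into pre-broad posets. -/
def Omega.incl : Omega ⥤ PreBroad where
  obj := Omega.toPre
  map f := f

/-- The linear tree `[n]` as an object of `Ω`. -/
def Omega.lin (n : ℕ) : Omega := ⟨n + 1, (linear n).str, linear_isTree n⟩

/-- Dendroidal sets. -/
abbrev DSet := Omegaᵒᵖ ⥤ Type

/-- The dendroidal set `Ω[P] = Hom(-, P)` of a pre-broad poset `P`.  For a tree this is the
representable presheaf; for a forest, it is the coproduct of the representables of its trees. -/
def nerve : PreBroad ⥤ DSet :=
  yoneda ⋙ (Functor.whiskeringLeft Omegaᵒᵖ PreBroadᵒᵖ Type).obj Omega.incl.op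

/-- Representatives of the dendrices of `X ⊗ Y` of shape `U`. -/
structure TensorPre (X Y : DSet) (U : Omega) where
  S : Omega
  T : Omega
  x : X.obj (op S)
  y : Y.obj (op T)
  h : U.toPre ⟶ tens S.toPre T.toPre

/-- The coend relation `(f^* x, g^* y, h) ∼ (x, y, (f ⊗ g) ∘ h)`. -/
inductive TensorGlue (X Y : DSet) (U : Omega) : TensorPre X Y U → TensorPre X Y U → Prop
  | mk {S S' T T' : Omega} (f : S ⟶ S') (g : T ⟶ T') (x : X.obj (op S')) (y : Y.obj (op T'))
      (h : U.toPre ⟶ tens S.toPre T.toPre) :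
      TensorGlue X Y U ⟨S, T, X.map f.op x, Y.map g.op y, h⟩
        ⟨S', T', x, y, h ≫ tensMap (Omega.incl.map f) (Omega.incl.map g)⟩

/-- The tensor product of dendroidal sets: the functor commuting with colimits in each variable
and given by `Ω[S] ⊗ Ω[T] = Hom(-, S ⊗ T)` on representables, constructed as the coend
`∫^{S,T} X(S) × Y(T) × Hom(-, S ⊗ T)`. -/
def tensorObj (X Y : DSet) : DSet where
  obj U := Quot (TensorGlue X Y U.unop)
  map {U V} k := ↾(Quot.map
    (fun a => ⟨a.S, a.T, a.x, a.y, Omega.incl.map k.unop ≫ a.h⟩)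
    (by
      rintro _ _ ⟨f, g, x, y, h⟩
      exact TensorGlue.mk f g x y (Omega.incl.map k.unop ≫ h)))
  map_id U := by
    ext ⟨a⟩
    rfl
  map_comp k l := by
    ext ⟨a⟩
    rfl

/-- Functoriality of the tensor product. -/
def tensorMap {X X' Y Y' : DSet} (α : X ⟶ X') (β : Y ⟶ Y') : tensorObj X Y ⟶ tensorObj X' Y' where
  app U := ↾(Quot.map
    (fun a => ⟨a.S, a.T, α.app _ a.x, β.app _ a.y, a.h⟩)
    (by
      rintro _ _ ⟨f, g, x, y, h⟩
      have h1 := NatTrans.naturality_apply α f.op x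
      have h2 := NatTrans.naturality_apply β g.op y
      simp only [h1, h2]
      exact TensorGlue.mk f g _ _ h))
  naturality U V k := by
    ext ⟨a⟩
    rfl

@[simp] theorem tensorMap_id (X Y : DSet) : tensorMap (𝟙 X) (𝟙 Y) = 𝟙 (tensorObj X Y) := by
  ext U ⟨a⟩
  rfl

theorem tensorMap_comp {X X' X'' Y Y' Y'' : DSet} (α : X ⟶ X') (α' : X' ⟶ X'')
    (β : Y ⟶ Y') (β' : Y' ⟶ Y'') :
    tensorMap (α ≫ α') (β ≫ β') = tensorMap α β ≫ tensorMap α' β' := by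
  ext U ⟨a⟩
  rfl

/-- The canonical isomorphism `Hom(-, S ⊗ T) ≅ Ω[S] ⊗ Ω[T]`, for trees `S` and `T`. -/
def nerveTensIso (S T : Omega) :
    nerve.obj (tens S.toPre T.toPre) ≅ tensorObj (nerve.obj S.toPre) (nerve.obj T.toPre) where
  hom :=
    { app := fun U => ↾(fun h => Quot.mk _ ⟨S, T, 𝟙 S.toPre, 𝟙 T.toPre, h⟩)
      naturality := fun U V k => by ext h; rfl }
  inv :=
    { app := fun U => ↾(Quot.lift (fun a => a.h ≫ tensMap a.x a.y) (by
        rintro _ _ ⟨f, g, x, y, h⟩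
        rfl))
      naturality := fun U V k => by ext ⟨a⟩; rfl }
  hom_inv_id := by
    ext U h
    rfl
  inv_hom_id := by
    ext U ⟨a⟩
    exact (Quot.sound (TensorGlue.mk (X := nerve.obj S.toPre) (Y := nerve.obj T.toPre)
      (S := a.S) (T := a.T) (S' := S) (T' := T) a.x a.y (𝟙 S.toPre) (𝟙 T.toPre) a.h)).symm

/-- The union of the faces (injective maps from trees) of `T` satisfying `𝓕`: the dendrices of
`Ω[T]` that factor through one of them. -/
def facesUnion (T : PreBroad) (𝓕 : ∀ V : Omega, (V.toPre ⟶ T) → Prop) :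
    Subfunctor (nerve.obj T) where
  obj U := {f : U.unop.toPre ⟶ T | ∃ (V : Omega) (m : V.toPre ⟶ T) (h : U.unop.toPre ⟶ V.toPre),
    Function.Injective m.toFun ∧ 𝓕 V m ∧ h ≫ m = f}
  map := by
    rintro U V k f ⟨W, m, h, hm, hW, rfl⟩
    exact ⟨W, m, Omega.incl.map k.unop ≫ h, hm, hW, rfl⟩

/-- `m` is, up to isomorphism, the inclusion of a face of the form `R - E'` with `R` a connected
component of `T` and `E' ⊆ E`: it reflects broad relations, and the edges in its component that it
misses lie in `E`. -/
def IsComplFace {T : PreBroad} (E : Set T) (V : Omega) (m : V.toPre ⟶ T) : Prop :=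
  (∀ s e, T.rel (s.map m.toFun) (m.toFun e) → V.toPre.rel s e) ∧
  ∀ (v : V.toPre) (x r : T), T.Desc (m.toFun v) r → T.Desc x r →
    x ∉ Set.range m.toFun → x ∈ E

/-- The boundary `∂Ω[T]` of a tree: the union of the non-invertible faces. -/
def boundary (T : PreBroad) : Subfunctor (nerve.obj T) :=
  facesUnion T (fun _ m => ¬ IsIso m)

/-- The horn `Λ^E[T]`: the union of the faces other than those of the form `R - E'` with
`R` a component of `T` and `E' ⊆ E`. -/
def horn (T : PreBroad) (E : Set T) : Subfunctor (nerve.obj T) :=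
  facesUnion T (fun V m => ¬ IsComplFace E V m)

/-! ### Equivariant dendroidal sets -/

universe u

section Equivariant

variable {G : Type u} [Group G]

/-- The functor `T ↦ Ω[T]` from pre-broad posets with `G`-action to `G`-dendroidal sets. -/
abbrev nerveG : Action PreBroad G ⥤ Action DSet G := nerve.mapAction G

/-- The action of `g` on a `G`-dendroidal set. -/
def actMap (X : Action DSet G) (g : G) : X.V ⟶ X.V := X.ρ g

/-- A subpresheaf stable under the action, as a `G`-dendroidal set. -/
def subAction (X : Action DSet G) (A : Subfunctor X.V)
    (hA : ∀ (g : G) (U : Omegaᵒᵖ), ∀ x ∈ A.obj U, (actMap X g).app U x ∈ A.obj U) :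
    Action DSet G where
  V := A.toFunctor
  ρ :=
    { toFun := fun g =>
        ({ app := fun U => ↾(fun x => ⟨(actMap X g).app U x.1, hA g U x.1 x.2⟩)
           naturality := fun U V k => by
            ext x
            refine Subtype.ext ?_
            have h := NatTrans.naturality_apply (actMap X g) k (A.ι.app U x)
            exact h } : A.toFunctor ⟶ A.toFunctor)
      map_one' := by
        apply NatTrans.ext
        funext U
        ext x
        have h : actMap X 1 = 𝟙 X.V := X.ρ.map_one
        have h' : (actMap X 1).app U (A.ι.app U x) = A.ι.app U x := by rw [h]; rfl
        exact Subtype.ext h'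
      map_mul' := fun g h => by
        apply NatTrans.ext
        funext U
        ext x
        have h1 : actMap X (g * h) = actMap X h ≫ actMap X g := X.ρ.map_mul g h
        have h2 : (actMap X (g * h)).app U (A.ι.app U x) =
            (actMap X g).app U ((actMap X h).app U (A.ι.app U x)) := by rw [h1]; rfl
        exact Subtype.ext h2 }

/-- The inclusion of a stable subpresheaf. -/
def subActionIncl (X : Action DSet G) (A : Subfunctor X.V)
    (hA : ∀ (g : G) (U : Omegaᵒᵖ), ∀ x ∈ A.obj U, (actMap X g).app U x ∈ A.obj U) :
    subAction X A hA ⟶ X where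
  hom := A.ι
  comm _ := rfl

/-- The automorphism of `T` given by `g`. -/
def actIso (T : Action PreBroad G) (g : G) : T.V ≅ T.V := T.ρAut g

/-- The action on edges. -/
def act (T : Action PreBroad G) (g : G) (x : T.V) : T.V := (actIso T g).hom.toFun x

theorem act_inv_act (T : Action PreBroad G) (g : G) (x : T.V) : act T g⁻¹ (act T g x) = x := by
  have : (actIso T g).hom ≫ (actIso T g).inv = 𝟙 _ := (actIso T g).hom_inv_id
  exact congrArg (fun f : T.V ⟶ T.V => f.toFun x) this

theorem act_one (T : Action PreBroad G) (x : T.V) : act T 1 x = x :=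
  congrArg (fun f : T.V ⟶ T.V => f.toFun x) T.ρ.map_one

theorem act_mul (T : Action PreBroad G) (g h : G) (x : T.V) :
    act T (g * h) x = act T g (act T h x) :=
  congrArg (fun f : T.V ⟶ T.V => f.toFun x) (T.ρ.map_mul g h)

theorem facesUnion_stable (T : Action PreBroad G) (𝓕 : ∀ V : Omega, (V.toPre ⟶ T.V) → Prop)
    (h𝓕 : ∀ (g : G) V m, 𝓕 V m → 𝓕 V (m ≫ (actIso T g).hom)) (g : G) (U : Omegaᵒᵖ)
    (x : (nerveG.obj T).V.obj U) (hx : x ∈ (facesUnion T.V 𝓕).obj U) :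
    (actMap (nerveG.obj T) g).app U x ∈
      (facesUnion T.V 𝓕).obj U := by
  obtain ⟨V, m, h, hm, hV, rfl⟩ := hx
  refine ⟨V, m ≫ (actIso T g).hom, h, ?_, h𝓕 g V m hV, rfl⟩
  intro a b hab
  exact hm (Function.LeftInverse.injective (act_inv_act T g) hab)

/-- The boundary inclusion `∂Ω[S] ⟶ Ω[S]` of a tree with `G`-action. -/
def boundaryG (S : Action PreBroad G) : Action DSet G :=
  subAction (nerveG.obj S) (boundary S.V) (facesUnion_stable S _ (by
    intro g V m hm hiso
    exact hm (IsIso.of_isIso_comp_right m (actIso S g).hom)))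

def boundaryIncl (S : Action PreBroad G) : boundaryG S ⟶ nerveG.obj S :=
  subActionIncl _ _ _

theorem horn_stable (T : Action PreBroad G) (E : Set T.V) (hE : ∀ (g : G), ∀ x ∈ E, act T g x ∈ E)
    (g : G) (U : Omegaᵒᵖ) (x : (nerveG.obj T).V.obj U) (hx : x ∈ (horn T.V E).obj U) :
    (actMap (nerveG.obj T) g).app U x ∈
      (horn T.V E).obj U := by
  refine facesUnion_stable T _ ?_ g U x hx
  rintro g V m hm ⟨h1, h2⟩
  refine hm ⟨fun s e h => h1 s e ?_, fun v x r hv hxr hx => ?_⟩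
  · have := (actIso T g).hom.map_rel _ _ h
    rw [Multiset.map_map] at this
    exact this
  · have := h2 v (act T g x) (act T g r) ((actIso T g).hom.map_desc hv)
      ((actIso T g).hom.map_desc hxr) (by
        rintro ⟨w, hw⟩
        exact hx ⟨w, Function.LeftInverse.injective (act_inv_act T g) hw⟩)
    have h3 := hE g⁻¹ _ this
    rwa [act_inv_act] at h3

/-- The horn inclusion `Λ^E[T] ⟶ Ω[T]` for a `G`-stable set `E` of edges. -/
def hornG (T : Action PreBroad G) (E : Set T.V) (hE : ∀ (g : G), ∀ x ∈ E, act T g x ∈ E) :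
    Action DSet G :=
  subAction (nerveG.obj T) (horn T.V E) (horn_stable T E hE)

def hornIncl (T : Action PreBroad G) (E : Set T.V) (hE : ∀ (g : G), ∀ x ∈ E, act T g x ∈ E) :
    hornG T E hE ⟶ nerveG.obj T :=
  subActionIncl _ _ _

/-- `G`-trees: forests with a `G`-action whose root tuple is a single `G`-orbit. -/
def IsGTree (T : Action PreBroad G) : Prop :=
  T.V.IsForest ∧ ∃ r, T.V.IsRoot r ∧ ∀ r', T.V.IsRoot r' → ∃ g, act T g r = r'

/-- The orbit of an edge. -/
def orbit (T : Action PreBroad G) (e : T.V) : Set T.V := Set.range (fun g : G => act T g e)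

theorem orbit_stable (T : Action PreBroad G) (e : T.V) (g : G) :
    ∀ x ∈ orbit T e, act T g x ∈ orbit T e := by
  rintro _ ⟨h, rfl⟩
  exact ⟨g * h, act_mul T g h e⟩

variable (G) in
/-- The generating `G`-inner horn inclusions `Λ^{Ge}[T] ⟶ Ω[T]`. -/
inductive GInnerHorn : MorphismProperty (Action DSet G)
  | mk (T : Action PreBroad G) (hT : IsGTree T) (e : T.V) (he : T.V.IsInner e) :
      GInnerHorn (hornIncl T (orbit T e) (orbit_stable T e))

variable (G) in
/-- `G`-inner anodyne extensions: the smallest class of maps containing the generating `G`-inner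
horn inclusions and closed under pushouts, transfinite compositions and retracts. -/
def GInnerAnodyne : MorphismProperty (Action DSet G) := fun _ _ f =>
  ∀ W : MorphismProperty (Action DSet G), GInnerHorn G ≤ W → W.IsStableUnderCobaseChange →
    MorphismProperty.IsStableUnderTransfiniteComposition.{0} W → W.IsStableUnderRetracts → W f

/-- The tensor product of `G`-dendroidal sets, with the diagonal action. -/
def tensorG (X Y : Action DSet G) : Action DSet G where
  V := tensorObj X.V Y.V
  ρ :=
    { toFun := fun g => tensorMap (X.ρ g) (Y.ρ g)
      map_one' := by
        rw [map_one, map_one]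
        exact tensorMap_id X.V Y.V
      map_mul' := fun g h => by
        rw [map_mul, map_mul]
        exact tensorMap_comp (X.ρ h) (X.ρ g) (Y.ρ h) (Y.ρ g) }

def tensorGMap {X X' Y Y' : Action DSet G} (α : X ⟶ X') (β : Y ⟶ Y') :
    tensorG X Y ⟶ tensorG X' Y' where
  hom := tensorMap α.hom β.hom
  comm g := by
    change tensorMap _ _ ≫ _ = _ ≫ tensorMap _ _
    rw [← tensorMap_comp, ← tensorMap_comp, α.comm, β.comm]

theorem tensorGMap_comp {X X' X'' Y Y' Y'' : Action DSet G} (α : X ⟶ X') (α' : X' ⟶ X'')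
    (β : Y ⟶ Y') (β' : Y' ⟶ Y'') :
    tensorGMap (α ≫ α') (β ≫ β') = tensorGMap α β ≫ tensorGMap α' β' :=
  Action.hom_ext _ _ (tensorMap_comp _ _ _ _)

/-- The source `A ⊗ Y ⨿_{A ⊗ C} X ⊗ C` of the pushout-product of `i : A ⟶ X` and `j : C ⟶ Y`. -/
noncomputable def pushoutProductSource {A X C Y : Action DSet G} (i : A ⟶ X) (j : C ⟶ Y) :
    Action DSet G :=
  pushout (tensorGMap (𝟙 A) j) (tensorGMap i (𝟙 C))

/-- The pushout-product map `A ⊗ Y ⨿_{A ⊗ C} X ⊗ C ⟶ X ⊗ Y`. -/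
noncomputable def pushoutProduct {A X C Y : Action DSet G} (i : A ⟶ X) (j : C ⟶ Y) :
    pushoutProductSource i j ⟶ tensorG X Y :=
  pushout.desc (tensorGMap i (𝟙 Y)) (tensorGMap (𝟙 X) j) (by
    rw [← tensorGMap_comp, ← tensorGMap_comp]
    simp)

variable (G) in
/-- The linear tree `[n]` with trivial action. -/
abbrev linG (n : ℕ) : Action PreBroad G := Action.trivial G (linear n)

/-- The map `η ⟶ [1]` with image the root `1` of `[1]`. -/
def vertexOne : eta ⟶ linear 1 where
  toFun _ := (1 : Fin 2)
  map_rel := by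
    rintro s e ⟨i, hi, rfl⟩
    exact ⟨1, le_refl _, by simp⟩

variable (G) in
/-- The inclusion `{1} ⟶ Ω[1]`, with trivial actions. -/
def vertexOneG : nerveG.obj (linG G 0) ⟶ nerveG.obj (linG G 1) :=
  nerveG.map ⟨vertexOne, fun _ => rfl⟩

variable (G) in
/-- The canonical isomorphism `Ω[1] ≅ η ⊗ Ω[1]`. -/
def etaTensG : nerveG.obj (linG G 1) ≅
    tensorG (nerveG.obj (linG G 0)) (nerveG.obj (linG G 1)) :=
  Action.mkIso (nerve.mapIso (etaTens (linear 1)) ≪≫ nerveTensIso (Omega.lin 0) (Omega.lin 1))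
    (fun g => by
      have h1 : (nerveG.obj (linG G 1)).ρ g = 𝟙 (nerve.obj (linear 1)) := nerve.map_id _
      have h2 : (tensorG (nerveG.obj (linG G 0)) (nerveG.obj (linG G 1))).ρ g =
          𝟙 (tensorObj (nerve.obj (linear 0)) (nerve.obj (linear 1))) := by
        have h3 : (nerveG.obj (linG G 0)).ρ g = 𝟙 (nerve.obj (linear 0)) := nerve.map_id _
        change tensorMap ((nerveG.obj (linG G 0)).ρ g) ((nerveG.obj (linG G 1)).ρ g) = _
        rw [h1, h3]
        exact tensorMap_id _ _
      rw [h1, h2]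
      exact (Category.id_comp _).trans (Category.comp_id _).symm)

/-- The join `S ⋆ [n]` with the action of `G` induced from `S`. -/
def joinG (S : Action PreBroad G) (n : ℕ) : Action PreBroad G where
  V := join S.V n
  ρ :=
    { toFun := fun g => joinMap (actIso S g).hom (isWide_of_iso _) n
      map_one' := by
        apply PreBroad.hom_ext
        rintro (e | j)
        · exact congrArg Sum.inl (act_one S e)
        · rfl
      map_mul' := fun g h => by
        apply PreBroad.hom_ext
        rintro (e | j)
        · exact congrArg Sum.inl (act_mul S g h e)
        · rfl }

/-- The set of edges of `S ⋆ η` consisting of the edge `η`. -/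
def etaEdge (S : Action PreBroad G) : Set (joinG S 0).V := {Sum.inr (0 : Fin 1)}

theorem etaEdge_stable (S : Action PreBroad G) (g : G) :
    ∀ x ∈ etaEdge S, act (joinG S 0) g x ∈ etaEdge S := by
  rintro _ rfl
  rfl

/-- The inclusion `Λ^η[S ⋆ η] ⟶ Ω[S ⋆ η]` of the outer horn: the union of the faces other than
`S ⋆ η` and `(S ⋆ η) - η`. -/
def outerHornIncl (S : Action PreBroad G) :
    hornG (joinG S 0) (etaEdge S) (etaEdge_stable S) ⟶ nerveG.obj (joinG S 0) :=
  hornIncl _ _ _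

/-- The root edge of a tree. -/
noncomputable def rootEdge {T : PreBroad} (hT : T.IsTree) : T := hT.root.choose

theorem desc_rootEdge {T : PreBroad} (hT : T.IsTree) (e : T) : T.Desc e (rootEdge hT) :=
  hT.root.choose_spec e

/-- The root as a map `r : η ⟶ T`. -/
noncomputable def rootMap {T : PreBroad} (hT : T.IsTree) : eta ⟶ T where
  toFun _ := rootEdge hT
  map_rel := by
    rintro s e ⟨i, hi, rfl⟩
    simpa using T.str.refl _

theorem rootMap_isWide {T : PreBroad} (hT : T.IsTree) : IsWide (rootMap hT) := by
  intro r hr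
  have hr' : r = {(0 : Fin 1)} := by
    refine (Multiset.Nodup.ext hr.1 (Multiset.nodup_singleton _)).2 (fun x => ?_)
    rw [hr.2]
    exact ⟨fun _ => by
      rw [Multiset.mem_singleton]; exact Subsingleton.elim (α := Fin 1) _ _,
      fun _ e _ => Subsingleton.elim (α := Fin 1) _ _⟩
  subst hr'
  refine ⟨{rootEdge hT}, ⟨Multiset.nodup_singleton _, fun x => ?_⟩, ?_⟩
  · rw [Multiset.mem_singleton]
    constructor
    · rintro rfl e he
      exact hT.toIsNodalPoset.desc_antisymm (desc_rootEdge hT e) he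
    · intro hx
      exact (hx _ (desc_rootEdge hT x)).symm
  · simpa [rootMap] using PreBroad.leTuple_refl (P := T) {rootEdge hT}

theorem act_rootEdge (S : Action PreBroad G) (hS : S.V.IsTree) (g : G) :
    act S g (rootEdge hS) = rootEdge hS := by
  refine hS.toIsNodalPoset.desc_antisymm (desc_rootEdge hS _) ?_
  have := (actIso S g).hom.map_desc (desc_rootEdge hS (act S g⁻¹ (rootEdge hS)))
  change S.V.Desc (act S g (act S g⁻¹ (rootEdge hS))) (act S g (rootEdge hS)) at this
  rwa [← act_mul, mul_inv_cancel, act_one] at this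

/-- The equivariant map `r : η ⟶ S`. -/
noncomputable def rootG (S : Action PreBroad G) (hS : S.V.IsTree) : linG G 0 ⟶ S where
  hom := rootMap hS
  comm g := by
    apply PreBroad.hom_ext
    intro x
    exact (act_rootEdge S hS g).symm

variable (G) in
/-- The isomorphism `[1] ≅ η ⋆ η`, equivariantly. -/
def linearOneG : linG G 1 ≅ joinG (linG G 0) 0 :=
  Action.mkIso linearOneIso (fun g => by
    apply PreBroad.hom_ext
    intro x
    change linearOneIso.hom.toFun x = Sum.map id id (linearOneIso.hom.toFun x)
    rw [Sum.map_id_id]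
    rfl)

/-- The equivariant map `r ⋆ id : η ⋆ η ⟶ S ⋆ η`. -/
noncomputable def rootJoinG (S : Action PreBroad G) (hS : S.V.IsTree) :
    joinG (linG G 0) 0 ⟶ joinG S 0 where
  hom := joinMap (rootMap hS) (rootMap_isWide hS) 0
  comm g := by
    apply PreBroad.hom_ext
    rintro (e | j)
    · exact congrArg Sum.inl (act_rootEdge S hS g).symm
    · rfl

end Equivariant

end Dendro

open Dendro

namespace Dendro

namespace PreBroad

/-! ### Generalities on broad posets -/

section Separated

variable {P Q : PreBroad}

/-! Dendrices of Ω[S] ⊗ Ω[1] are the same as maps from trees to the pre-broad poset S ⊗ [1]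
(`tensCompG` is invertible). By `tens_rel_iff`, a relation there is a relation of S together with
levels in {0, 1}, the inputs having levels at most that of the output. Subobjects are thus G-stable
families of maps into S ⊗ [1] (`GSieve`), and the proof is about which subtrees a map meets.

For a set D of edges of S closed under descendants, let W_D be `cellEdges D`: the edges (a,0) with a
in D, the edges (a,1) with a not in D, and also the edges (a,1) with a maximal in D. The last ones
form E_D, i.e. `hornEdges D`. The rest of W_D, its core, contains exactly one edge over each edge of
S. A map whose projection to S is not in ∂Ω[S] lands in some W_D
(`exists_isLower_of_not_mem_boundary`). A face of W_D not of the form W_D - E' with E' in E_D either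
projects into ∂Ω[S] or misses some (a,0) with a maximal in D, and then lies in W_{D - a}
(`mem_boundary_or_of_face`). A face W_D - E' does neither (`not_mem_boundary_of_isFull`,
`subset_of_cell_diff_subset`). So, adding the W_D by increasing size of D, each is glued along
exactly Λ^{E_D}[W_D].

If the root r of S is not in D, then (r,1) is the root of W_D and E_D consists of inner edges; B is
A with all these W_D attached. The only remaining D is the set of all edges. Its W_D is the image of
S ⋆ η, and E_D is the single edge (r,1), the root η: this is the outer horn of (b).

Equivariantly, one attaches an orbit of translates of W_D at a time, as a G-tree (`translates`). The
stabilizer of W_D need not be transitive on E_D, so Λ^{E_D} need not be a generating horn.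
`GSieve.IsCell.anodyne` chooses one orbit O in E_D, first attaches the smaller trees W_D - P with P
in E_D - O, each along the horn for O, and argues by induction on the number of horn edges. -/

/-- Simple pre-broad posets whose unary relations are antisymmetric. -/
structure IsSeparated (P : PreBroad) : Prop where
  antisymm : ∀ e f : P, P.rel {e} f → P.rel {f} e → e = f
  simple : ∀ s (e : P), P.rel s e → s.Nodup

theorem IsNodalPoset.isSeparated (hP : P.IsNodalPoset) : P.IsSeparated :=
  ⟨hP.antisymm, hP.simple⟩

theorem IsSeparated.eq_zero (hP : P.IsSeparated) {e : P} {t : Multiset P}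
    (h : P.rel (e ::ₘ t) e) : t = 0 := by
  by_contra ht
  obtain ⟨x, hx⟩ := Multiset.exists_mem_of_ne_zero ht
  have h2 := hP.simple _ _ (rel_subst h h)
  rw [Multiset.cons_add, Multiset.nodup_cons, Multiset.nodup_add] at h2
  exact Multiset.disjoint_left.1 h2.2.2.2 hx hx

theorem IsSeparated.desc_antisymm (hP : P.IsSeparated) {e f : P} (h₁ : P.Desc e f)
    (h₂ : P.Desc f e) : e = f := by
  obtain ⟨s, hs, h₁⟩ := h₁
  obtain ⟨t, ht, h₂⟩ := h₂
  obtain ⟨s, rfl⟩ := Multiset.exists_cons_of_mem hs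
  obtain ⟨t, rfl⟩ := Multiset.exists_cons_of_mem ht
  have h := rel_subst h₂ h₁
  rw [Multiset.cons_add] at h
  have := hP.eq_zero h
  obtain ⟨rfl, rfl⟩ := add_eq_zero.1 this
  exact hP.antisymm _ _ h₁ h₂

theorem desc_of_rel {s : Multiset P} {e x : P} (h : P.rel s e) (hx : x ∈ s) : P.Desc x e :=
  ⟨s, hx, h⟩

theorem desc_of_rel_singleton {e x : P} (h : P.rel {x} e) : P.Desc x e :=
  desc_of_rel h (Multiset.mem_singleton_self x)

theorem Desc.exists_rel_cons {e x : P} (h : P.Desc x e) : ∃ t, P.rel (x ::ₘ t) e := by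
  obtain ⟨s, hs, h⟩ := h
  obtain ⟨t, rfl⟩ := Multiset.exists_cons_of_mem hs
  exact ⟨t, h⟩

theorem Desc.trans {a b c : P} (h₁ : P.Desc a b) (h₂ : P.Desc b c) : P.Desc a c := by
  obtain ⟨s, hs, h₁⟩ := h₁
  obtain ⟨t, h₂⟩ := h₂.exists_rel_cons
  exact ⟨_, Multiset.mem_add.2 (Or.inl hs), rel_subst h₂ h₁⟩

theorem rel_of_leTuple {a b : Multiset P} {e : P} (h : P.LeTuple a b) (hb : P.rel b e) :
    P.rel a e := by
  obtain ⟨s, hs, rfl, rfl⟩ := h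
  exact P.str.trans s e hs hb

theorem leTuple_singleton {a : Multiset P} {e : P} : P.LeTuple a {e} ↔ P.rel a e :=
  ⟨fun h => rel_of_leTuple h (P.str.refl e), fun h => ⟨{(a, e)}, by simpa using h, by simp, by simp⟩⟩

theorem LeTuple.add {a b a' b' : Multiset P} (h : P.LeTuple a b) (h' : P.LeTuple a' b') :
    P.LeTuple (a + a') (b + b') := by
  obtain ⟨s, hs, rfl, rfl⟩ := h
  obtain ⟨s', hs', rfl, rfl⟩ := h'
  refine ⟨s + s', ?_, by simp, by simp⟩
  intro p hp
  exact (Multiset.mem_add.1 hp).elim (hs p) (hs' p)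

theorem leTuple_map {α : Type} (f g : α → P) (s : Multiset α)
    (h : ∀ x ∈ s, P.rel {f x} (g x)) : P.LeTuple (s.map f) (s.map g) := by
  refine ⟨s.map fun x => ({f x}, g x), ?_, ?_, ?_⟩
  · intro p hp
    obtain ⟨x, hx, rfl⟩ := Multiset.mem_map.1 hp
    exact h x hx
  · rw [Multiset.map_map]
    simpa [Multiset.map_map, Function.comp_def] using Multiset.sum_map_singleton (s.map f)
  · simp [Multiset.map_map]

/-- Isolates the block of the tuple that contains `a`. In a nodal poset this is how one passes from
a relation below `e` to a relation below an input of the vertex at `e`. -/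
theorem LeTuple.exists_cons {a : P} {z w : Multiset P} (h : P.LeTuple (a ::ₘ z) w) :
    ∃ y w' z₁ z₂, w = y ::ₘ w' ∧ z = z₁ + z₂ ∧ P.rel (a ::ₘ z₁) y ∧ P.LeTuple z₂ w' := by
  obtain ⟨s, hs, hsz, rfl⟩ := h
  have ha : a ∈ (s.map Prod.fst).sum := by rw [hsz]; simp
  obtain ⟨c, hc, hac⟩ := Multiset.mem_join.1 ha
  obtain ⟨p, hp, rfl⟩ := Multiset.mem_map.1 hc
  obtain ⟨s, rfl⟩ := Multiset.exists_cons_of_mem hp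
  obtain ⟨z₁, hz₁⟩ := Multiset.exists_cons_of_mem hac
  refine ⟨p.2, s.map Prod.snd, z₁, (s.map Prod.fst).sum, by simp, ?_, ?_,
    s, fun q hq => hs q (by simp [hq]), rfl, rfl⟩
  · rw [Multiset.map_cons, Multiset.sum_cons, hz₁, Multiset.cons_add, Multiset.cons_inj_right] at hsz
    exact hsz.symm
  · rw [← hz₁]
    exact hs p hp

theorem LeTuple.exists_desc {a w : Multiset P} {x : P} (h : P.LeTuple a w) (hx : x ∈ a) :
    ∃ y ∈ w, P.Desc x y := by
  obtain ⟨z, rfl⟩ := Multiset.exists_cons_of_mem hx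
  obtain ⟨y, w', z₁, z₂, rfl, rfl, h, -⟩ := h.exists_cons
  exact ⟨y, by simp, desc_of_rel h (by simp)⟩

theorem IsSeparated.desc_induction (hP : P.IsSeparated) [Finite P] {C : P → Prop}
    (h : ∀ e, (∀ x, P.Desc x e → x ≠ e → C x) → C e) (e : P) : C e := by
  let R : P → P → Prop := fun x y => P.Desc x y ∧ x ≠ y
  have : IsTrans P R := ⟨fun a b c hab hbc => ⟨hab.1.trans hbc.1, by
    rintro rfl
    exact hab.2 (hP.desc_antisymm hab.1 hbc.1)⟩⟩
  have : Std.Irrefl R := ⟨fun a ha => ha.2 rfl⟩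
  have wf : WellFounded R := Finite.wellFounded_of_trans_of_irrefl R
  exact wf.induction e fun e ih => h e fun x hx hne => ih x ⟨hx, hne⟩

theorem IsNodalPoset.leaf_or_maxBelow (hP : P.IsNodalPoset) (e : P) :
    P.IsLeaf e ∨ ∃ w, P.IsMaxBelow w e := by
  rcases hP.nodal e with h | ⟨w, -, h⟩ | h
  · exact Or.inl h
  · exact Or.inr ⟨w, h⟩
  · exact Or.inr ⟨0, h⟩

theorem nodal_of_leaf_or_maxBelow {e : P} (h : P.IsLeaf e ∨ ∃ w, P.IsMaxBelow w e) :
    P.IsLeaf e ∨ P.IsNode e ∨ P.IsStump e := by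
  rcases h with h | ⟨w, h⟩
  · exact Or.inl h
  · by_cases hw : w = 0
    · subst hw
      exact Or.inr (Or.inr h)
    · exact Or.inr (Or.inl ⟨w, hw, h⟩)

theorem IsSeparated.ne_of_mem_maxBelow (hP : P.IsSeparated) {w : Multiset P} {e y : P}
    (hw : P.IsMaxBelow w e) (hy : y ∈ w) : y ≠ e := by
  rintro rfl
  obtain ⟨t, rfl⟩ := Multiset.exists_cons_of_mem hy
  have := hP.eq_zero hw.1
  subst this
  exact hw.2.1 rfl

theorem IsMaxBelow.exists_desc {w : Multiset P} {e x : P} (hw : P.IsMaxBelow w e)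
    (hx : P.Desc x e) (hne : x ≠ e) : ∃ y ∈ w, P.Desc x y := by
  obtain ⟨s, hs, h⟩ := hx
  refine (hw.2.2 s h ?_).exists_desc hs
  rintro rfl
  exact hne (Multiset.mem_singleton.1 hs)

/-- Two incomparable descendants of an edge of a nodal poset occur together in a tuple. -/
theorem IsNodalPoset.exists_rel_of_incomparable (hP : P.IsNodalPoset) {u v : P}
    (huv : ¬ P.Desc u v) (hvu : ¬ P.Desc v u) (a : P) (hu : P.Desc u a) (hv : P.Desc v a) :
    ∃ z, P.rel (u ::ₘ v ::ₘ z) a := by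
  have := hP.finite
  induction a using hP.isSeparated.desc_induction with
  | h a ih =>
    have hua : u ≠ a := by rintro rfl; exact hvu hv
    have hva : v ≠ a := by rintro rfl; exact huv hu
    rcases hP.leaf_or_maxBelow a with hl | ⟨w, hw⟩
    · obtain ⟨s, hs, h⟩ := hu
      rw [hl s h] at hs
      exact absurd (Multiset.mem_singleton.1 hs) hua
    · obtain ⟨x, hx, hux⟩ := hw.exists_desc hu hua
      obtain ⟨y, hy, hvy⟩ := hw.exists_desc hv hva
      obtain ⟨w, rfl⟩ := Multiset.exists_cons_of_mem hx
      -- Follow `u` and `v` down from `a`. While they lie below the same input of a vertex, descend;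
      -- at the vertex where they part, expand the two inputs separately.
      by_cases hxy : x = y
      · subst hxy
        obtain ⟨z, hz⟩ := ih x (desc_of_rel hw.1 hx) (hP.isSeparated.ne_of_mem_maxBelow hw hx)
          hux hvy
        exact ⟨z + w, by simpa using rel_subst hw.1 hz⟩
      · obtain ⟨w, rfl⟩ := Multiset.exists_cons_of_mem
          ((Multiset.mem_cons.1 hy).resolve_left (Ne.symm hxy))
        obtain ⟨t, ht⟩ := hux.exists_rel_cons
        obtain ⟨t', ht'⟩ := hvy.exists_rel_cons
        have h1 := rel_subst hw.1 ht
        rw [Multiset.add_cons] at h1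
        have h2 := rel_subst h1 ht'
        refine ⟨t' + (t + w), ?_⟩
        convert h2 using 1
        simp only [Multiset.cons_add, Multiset.add_cons]

/-- Expanding both `b` and `c` down to `a` would make `a` occur twice in one tuple, against
simplicity. -/
theorem IsSeparated.false_of_rel_cons_cons (hP : P.IsSeparated) {a b c e : P} {z : Multiset P}
    (h : P.rel (b ::ₘ c ::ₘ z) e) (hb : P.Desc a b) (hc : P.Desc a c) : False := by
  obtain ⟨t, ht⟩ := hb.exists_rel_cons
  obtain ⟨t', ht'⟩ := hc.exists_rel_cons
  have h1 := rel_subst h ht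
  rw [Multiset.add_cons] at h1
  have h2 := hP.simple _ _ (rel_subst h1 ht')
  simp at h2

/-- The edges above a given edge of a tree form a chain. -/
theorem IsTree.desc_or_desc (hP : P.IsTree) {a b c : P} (hb : P.Desc a b) (hc : P.Desc a c) :
    P.Desc b c ∨ P.Desc c b := by
  by_contra! h
  obtain ⟨r, hr⟩ := hP.root
  obtain ⟨z, hz⟩ := hP.exists_rel_of_incomparable h.1 h.2 r (hr b) (hr c)
  exact hP.isSeparated.false_of_rel_cons_cons hz hb hc

end Separated

/-! ### Retracts of trees -/

/-- Since `i ∘ d` lowers edges by unary relations only, vertices of `U` push forward along `d` to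
vertices of `V`. This covers isomorphisms as well as images of degeneracies. -/
theorem IsTree.of_retract {U V : PreBroad} (hU : U.IsTree) (i : V ⟶ U) (d : U ⟶ V)
    (hid : ∀ v, d.toFun (i.toFun v) = v) (hdi : ∀ u, U.rel {i.toFun (d.toFun u)} u) :
    V.IsTree := by
  have hinj : Function.Injective i.toFun := Function.LeftInverse.injective hid
  have hmap : ∀ s : Multiset V, (s.map i.toFun).map d.toFun = s := fun s => by
    simp [Multiset.map_map, hid]
  have := hU.finite
  refine ⟨⟨Finite.of_injective _ hinj, ?_, ?_, ?_⟩, ?_⟩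
  · intro e f h1 h2
    exact hinj (hU.antisymm _ _ (by simpa using i.map_rel _ _ h1) (by simpa using i.map_rel _ _ h2))
  · intro s e h
    exact (hU.simple _ _ (i.map_rel _ _ h)).of_map _
  · intro v
    apply nodal_of_leaf_or_maxBelow
    rcases hU.leaf_or_maxBelow (i.toFun v) with hl | ⟨w, hw⟩
    · left
      intro s hs
      rw [← hmap s, hl _ (i.map_rel _ _ hs)]
      simp [hid]
    · right
      refine ⟨w.map d.toFun, ?_, ?_, ?_⟩
      · simpa [hid] using d.map_rel _ _ hw.1
      · intro h
        -- If the vertex collapsed under `d`, it would be a unary relation `y ≤ i v` with `i v = i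
        -- (d y) ≤ y`, so `y = i v`.
        obtain ⟨y, rfl, hy⟩ := Multiset.map_eq_singleton.1 h
        refine hw.2.1 ?_
        rw [hU.antisymm y (i.toFun v) hw.1 (by simpa [hy] using hdi y)]
      · intro g hg hne
        have h := hw.2.2 _ (i.map_rel _ _ hg) (by
          intro h
          apply hne
          rw [← hmap g, h]
          simp [hid])
        simpa only [hmap] using d.map_leTuple h
  · obtain ⟨r, hr⟩ := hU.root
    refine ⟨d.toFun r, fun e => ?_⟩
    simpa only [hid] using d.map_desc (hr (i.toFun e))

theorem iso_inv_hom {U V : PreBroad} (φ : U ≅ V) (v : V) : φ.hom.toFun (φ.inv.toFun v) = v := by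
  rw [← comp_toFun, φ.inv_hom_id]; rfl

theorem iso_hom_inv {U V : PreBroad} (φ : U ≅ V) (u : U) : φ.inv.toFun (φ.hom.toFun u) = u := by
  rw [← comp_toFun, φ.hom_inv_id]; rfl

theorem IsTree.of_iso {U V : PreBroad} (hU : U.IsTree) (φ : U ≅ V) : V.IsTree :=
  hU.of_retract φ.inv φ.hom (iso_inv_hom φ) fun u => by
    rw [iso_hom_inv]; exact U.str.refl u

/-! ### Full subposets, and models of trees in Ω -/

/-- The full broad subposet on a set of edges. -/
def restrict (P : PreBroad) (W : Set P) : PreBroad where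
  carrier := W
  str :=
    { rel := fun s e => P.rel (s.map Subtype.val) e.1
      refl := fun e => by simpa using P.str.refl e.1
      trans := fun s e hs h => by
        have := P.str.trans (s.map fun p => (p.1.map Subtype.val, p.2.1)) e.1
          (by
            intro p hp
            obtain ⟨q, hq, rfl⟩ := Multiset.mem_map.1 hp
            exact hs q hq)
          (by simpa [Multiset.map_map, Function.comp_def] using h)
        have h2 := (Multiset.mapAddMonoidHom (Subtype.val : W → P)).map_multiset_sum
          (s.map Prod.fst)
        simp only [Multiset.coe_mapAddMonoidHom] at h2
        rw [h2]
        simpa [Multiset.map_map, Function.comp_def] using this }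

/-- The inclusion of a full broad subposet. -/
def restrictIncl (P : PreBroad) (W : Set P) : P.restrict W ⟶ P :=
  Hom.mk Subtype.val fun _ _ h => h

/-- A map with values in `W` as a map to the full broad subposet on `W`. -/
def restrictLift {U P : PreBroad} (f : U ⟶ P) (W : Set P) (h : ∀ u, f.toFun u ∈ W) :
    U ⟶ P.restrict W :=
  Hom.mk (fun u => ⟨f.toFun u, h u⟩) fun s e hs => by
    change P.rel ((s.map _).map _) _
    rw [Multiset.map_map]
    exact f.map_rel _ _ hs

/-- Every tree is isomorphic to an object of `Ω`. -/
theorem IsTree.exists_omega {T : PreBroad} (hT : T.IsTree) : ∃ V : Omega, Nonempty (V.toPre ≅ T) := by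
  have := hT.finite
  obtain ⟨n, ⟨e⟩⟩ := Finite.exists_equiv_fin T
  have hm : ∀ s : Multiset (Fin n), (s.map e.symm).map e = s := fun s => by
    simp [Multiset.map_map]
  have hm' : ∀ s : Multiset T, (s.map e).map e.symm = s := fun s => by
    simp [Multiset.map_map]
  let str : BroadStr (Fin n) :=
    { rel := fun s x => T.rel (s.map e.symm) (e.symm x)
      refl := fun x => by simpa using T.str.refl _
      trans := fun s x hs h => by
        have := T.str.trans (s.map fun p => (p.1.map e.symm, e.symm p.2)) (e.symm x)
          (by
            intro p hp
            obtain ⟨q, hq, rfl⟩ := Multiset.mem_map.1 hp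
            exact hs q hq)
          (by simpa [Multiset.map_map, Function.comp_def] using h)
        have h2 := (Multiset.mapAddMonoidHom e.symm).map_multiset_sum (s.map Prod.fst)
        simp only [Multiset.coe_mapAddMonoidHom] at h2
        rw [h2]
        simpa [Multiset.map_map, Function.comp_def] using this }
  let φ : (⟨Fin n, str⟩ : PreBroad) ≅ T :=
    { hom := Hom.mk e.symm fun s x h => h
      inv := Hom.mk e fun s x h => by
        change T.rel ((s.map e).map e.symm) (e.symm (e x))
        rwa [hm', e.symm_apply_apply]
      hom_inv_id := hom_ext fun x => e.apply_symm_apply x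
      inv_hom_id := hom_ext fun x => e.symm_apply_apply x }
  exact ⟨⟨n, str, hT.of_iso φ.symm⟩, ⟨φ⟩⟩

/-! ### Fibres and images of maps out of trees -/

section Image

variable {U Q : PreBroad}

/-- The remaining inputs `z` map to a tuple with `q u, q z ≤ q u`, and `IsSeparated.eq_zero` makes
that tuple empty. -/
theorem IsSeparated.rel_singleton_of_desc (hQ : Q.IsSeparated) (q : U ⟶ Q) {u v : U}
    (h : U.Desc u v) (huv : q.toFun u = q.toFun v) : U.rel {u} v := by
  obtain ⟨z, hz⟩ := h.exists_rel_cons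
  have h2 := q.map_rel _ _ hz
  rw [Multiset.map_cons, huv] at h2
  have := Multiset.map_eq_zero.1 (hQ.eq_zero h2)
  subst this
  exact hz

/-- The fibres of a map out of a tree are chains of unary relations. -/
theorem IsTree.rel_or_rel_of_map_eq (hU : U.IsTree) (hQ : Q.IsSeparated) (q : U ⟶ Q) {u v : U}
    (huv : q.toFun u = q.toFun v) : U.rel {u} v ∨ U.rel {v} u := by
  by_cases h1 : U.Desc u v
  · exact Or.inl (hQ.rel_singleton_of_desc q h1 huv)
  by_cases h2 : U.Desc v u
  · exact Or.inr (hQ.rel_singleton_of_desc q h2 huv.symm)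
  obtain ⟨r, hr⟩ := hU.root
  obtain ⟨z, hz⟩ := hU.exists_rel_of_incomparable h1 h2 r (hr u) (hr v)
  have := hQ.simple _ _ (q.map_rel _ _ hz)
  simp [huv] at this

/-- Fibres are finite chains by `IsTree.rel_or_rel_of_map_eq`, so they have a least edge; it is
found by descending. -/
theorem IsTree.exists_bot (hU : U.IsTree) (hQ : Q.IsSeparated) (q : U ⟶ Q) (u : U) :
    ∃ b, q.toFun b = q.toFun u ∧ ∀ v, q.toFun v = q.toFun u → U.rel {b} v := by
  have := hU.finite
  induction u using hU.isSeparated.desc_induction with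
  | h u ih =>
    by_cases h : ∀ v, q.toFun v = q.toFun u → U.rel {u} v
    · exact ⟨u, rfl, h⟩
    · push Not at h
      obtain ⟨v, hv, hvu⟩ := h
      have h1 := (hU.rel_or_rel_of_map_eq hQ q hv).resolve_right hvu
      obtain ⟨b, hb, hb'⟩ := ih v (desc_of_rel_singleton h1) (by
        rintro rfl
        exact hvu (U.str.refl v))
      exact ⟨b, hb.trans hv, fun w hw => hb' w (hw.trans hv.symm)⟩

/-- Between `e` and the bottom `b` of its fibre the tree is linear: the vertex at `e` has an input
`y` above `b`, squeezed into the same fibre, and then no other input. A relation below `e` therefore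
stops inside the fibre or factors through `b`. -/
theorem IsTree.rel_bot_or (hU : U.IsTree) (hQ : Q.IsSeparated) (q : U ⟶ Q) {b : U} (e : U)
    (hb : q.toFun b = q.toFun e) (hb' : ∀ v, q.toFun v = q.toFun e → U.rel {b} v)
    {s : Multiset U} (hs : U.rel s e) : U.rel s b ∨ ∃ c, s = {c} ∧ q.toFun c = q.toFun e := by
  have := hU.finite
  induction e using hU.isSeparated.desc_induction with
  | h e ih =>
    by_cases hse : s = {e}
    · exact Or.inr ⟨e, hse, rfl⟩
    by_cases hbe : b = e
    · exact Or.inl (hbe ▸ hs)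
    rcases hU.leaf_or_maxBelow e with hl | ⟨w, hw⟩
    · exact absurd (hl s hs) hse
    · obtain ⟨y, w, z₁, z₂, rfl, hz, hy, -⟩ := LeTuple.exists_cons (z := 0)
        (hw.2.2 _ (hb' e rfl) (fun h => hbe (Multiset.singleton_inj.1 h)))
      obtain ⟨rfl, rfl⟩ := add_eq_zero.1 hz.symm
      have hye : q.toFun y = q.toFun e := by
        refine hQ.desc_antisymm (q.map_desc (desc_of_rel hw.1 (by simp))) ?_
        rw [← hb]
        exact q.map_desc (desc_of_rel hy (by simp))
      have h2 := q.map_rel _ _ hw.1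
      rw [Multiset.map_cons, hye] at h2
      have := Multiset.map_eq_zero.1 (hQ.eq_zero h2)
      subst this
      rcases ih y (desc_of_rel hw.1 (by simp))
        (hU.isSeparated.ne_of_mem_maxBelow hw (by simp)) (hb.trans hye.symm)
        (fun v hv => hb' v (hv.trans hye)) (leTuple_singleton.1 (hw.2.2 s hs hse)) with h | ⟨c, h, hc⟩
      · exact Or.inl h
      · exact Or.inr ⟨c, h, hc.trans hye⟩

/-- Every map out of a tree factors as a degeneracy `d`, with a section `σ` picking the bottom edge
of each fibre, followed by an injective map. -/
theorem IsTree.exists_image (hU : U.IsTree) (hQ : Q.IsSeparated) (q : U ⟶ Q) :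
    ∃ (V : Omega) (d : U ⟶ V.toPre) (m : V.toPre ⟶ Q) (σ : V.toPre ⟶ U), d ≫ m = q ∧
      Function.Injective m.toFun ∧ (∀ v, d.toFun (σ.toFun v) = v) ∧
      ∀ u, U.rel {σ.toFun (d.toFun u)} u := by
  -- The section sends an edge to the bottom of its fibre; the bottom (rather than the top) is what
  -- makes the retraction lower edges, as `IsTree.of_retract` demands.
  choose β hβ hβ' using hU.exists_bot hQ q
  have hββ : ∀ u v, q.toFun u = q.toFun v → β u = β v := fun u v h =>
    hU.antisymm _ _ (hβ' u _ ((hβ v).trans h.symm)) (hβ' v _ ((hβ u).trans h))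
  have hmono : ∀ s e, U.rel s e → U.rel (s.map β) (β e) := by
    intro s e h
    rcases hU.rel_bot_or hQ q e (hβ e) (hβ' e) h with h | ⟨c, rfl, hc⟩
    · refine rel_of_leTuple ?_ h
      conv => arg 3; rw [← Multiset.map_id s]
      exact leTuple_map _ _ _ fun x _ => hβ' x x rfl
    · rw [Multiset.map_singleton, hββ c e hc]
      exact U.str.refl _
  let β' : U ⟶ U := Hom.mk β hmono
  let d : U ⟶ U.restrict (Set.range β) := restrictLift β' _ fun u => ⟨u, rfl⟩
  let i := U.restrictIncl (Set.range β)
  have hid : ∀ v, d.toFun (i.toFun v) = v := by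
    rintro ⟨_, u, rfl⟩
    exact Subtype.ext (hββ _ _ (hβ u))
  obtain ⟨V, ⟨φ⟩⟩ := (hU.of_retract i d hid fun u => hβ' u u rfl).exists_omega
  refine ⟨V, d ≫ φ.inv, φ.hom ≫ i ≫ q, φ.hom ≫ i, ?_, ?_, ?_, ?_⟩
  · apply hom_ext
    intro u
    simp only [comp_toFun, iso_inv_hom]
    exact hβ u
  · intro v v' h
    apply Function.LeftInverse.injective (iso_hom_inv φ)
    rw [← hid (φ.hom.toFun v), ← hid (φ.hom.toFun v')]
    exact Subtype.ext (hββ _ _ h)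
  · intro v
    simp only [comp_toFun, hid, iso_hom_inv]
  · intro u
    simp only [comp_toFun, iso_inv_hom]
    exact hβ' u u rfl

/-- Descend from `e` towards `a`. The edges above `a` form a chain, so either `b` is met on the way,
where it can replace `a` because the vertices between them are unary, or `e` itself lies below `b`.
-/
theorem IsTree.rel_cons_or_desc (hU : U.IsTree) (hQ : Q.IsSeparated) (q : U ⟶ Q) {a b : U} (e : U)
    (hab : U.rel {a} b) (hq : q.toFun a = q.toFun b) {z : Multiset U}
    (h : U.rel (a ::ₘ z) e) : U.rel (b ::ₘ z) e ∨ U.Desc e b := by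
  have := hU.finite
  have hab' := desc_of_rel_singleton hab
  induction e using hU.isSeparated.desc_induction generalizing z with
  | h e ih =>
    by_cases hae : a ::ₘ z = {e}
    · obtain rfl : a = e := Multiset.mem_singleton.1 (hae ▸ Multiset.mem_cons_self a z)
      exact Or.inr hab'
    rcases hU.leaf_or_maxBelow e with hl | ⟨w, hw⟩
    · exact absurd (hl _ h) hae
    · obtain ⟨y, w, z₁, z₂, rfl, rfl, hy, hz₂⟩ := (hw.2.2 _ h hae).exists_cons
      have key : U.rel (b ::ₘ z₁) y → U.rel (b ::ₘ (z₁ + z₂)) e := fun h' => by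
        rw [← Multiset.cons_add]
        have h3 := (leTuple_singleton.2 h').add hz₂
        rw [Multiset.singleton_add] at h3
        exact rel_of_leTuple h3 hw.1
      have hye := desc_of_rel hw.1 (Multiset.mem_cons_self y w)
      have hay := desc_of_rel hy (Multiset.mem_cons_self a z₁)
      rcases ih y hye (hU.isSeparated.ne_of_mem_maxBelow hw (by simp)) hy with h' | hyb
      · exact Or.inl (key h')
      rcases hU.desc_or_desc hab' (hay.trans hye) with hbe | heb
      · by_cases hne : b = e
        · exact Or.inr (hne ▸ desc_refl b)
        obtain ⟨y', hy', hby'⟩ := hw.exists_desc hbe hne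
        by_cases hyy : y' = y
        · subst hyy
          obtain rfl := hU.isSeparated.desc_antisymm hyb hby'
          have h2 := q.map_rel _ _ hy
          rw [Multiset.map_cons, hq] at h2
          have := Multiset.map_eq_zero.1 (hQ.eq_zero h2)
          subst this
          exact Or.inl (key (U.str.refl _))
        · obtain ⟨w, rfl⟩ := Multiset.exists_cons_of_mem ((Multiset.mem_cons.1 hy').resolve_left hyy)
          exact (hU.isSeparated.false_of_rel_cons_cons hw.1 hay (hab'.trans hby')).elim
      · exact Or.inr heb

/-- A relation in a tree may be transported along the fibres of a map, as long as levels permit. -/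
theorem IsTree.rel_of_map_eq (hU : U.IsTree) (hQ : Q.IsSeparated) (q : U ⟶ Q) {L : Type}
    [PartialOrder L] (χ : U → L) (hχ : ∀ a b, U.rel {a} b → χ a ≤ χ b)
    (hinj : ∀ a b, q.toFun a = q.toFun b → χ a = χ b → a = b) {s s' : Multiset U} {e e' : U}
    (h : U.rel s' e') (hs : s'.map q.toFun = s.map q.toFun) (he : q.toFun e' = q.toFun e)
    (hle : ∀ x ∈ s, χ x ≤ χ e) : U.rel s e := by
  -- One edge of the tuple is moved within its fibre. Moving it up can only fail when `e` lies in
  -- the segment from `a` to `b`; then the level bound forces `b = e` and the relation is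
  -- reflexivity.
  have key : ∀ (a b : U) (z : Multiset U), U.rel (a ::ₘ z) e → q.toFun a = q.toFun b →
      χ b ≤ χ e → U.rel (b ::ₘ z) e := by
    intro a b z h hab hb
    rcases hU.rel_or_rel_of_map_eq hQ q hab with h1 | h1
    · rcases hU.rel_cons_or_desc hQ q e h1 hab h with h2 | h2
      · exact h2
      · have hqe : q.toFun e = q.toFun b := by
          refine hQ.desc_antisymm (q.map_desc h2) ?_
          rw [← hab]
          exact q.map_desc (desc_of_rel h (by simp))
        have h3 := q.map_rel _ _ h
        rw [Multiset.map_cons, hab, ← hqe] at h3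
        have := Multiset.map_eq_zero.1 (hQ.eq_zero h3)
        subst this
        have h4 := hχ _ _ (hQ.rel_singleton_of_desc q h2 hqe)
        rw [hinj b e hqe.symm (le_antisymm hb h4)]
        exact U.str.refl e
    · simpa using rel_subst h h1
  have key2 : ∀ t t' : Multiset U, Multiset.Rel (fun a b => q.toFun a = q.toFun b) t' t →
      (∀ x ∈ t, χ x ≤ χ e) → ∀ z, U.rel (t' + z) e → U.rel (t + z) e := by
    intro t t' ht
    induction ht with
    | zero => exact fun _ z hz => hz
    | @cons a b t' t hab ht ih =>
      intro hle z hz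
      rw [Multiset.cons_add] at hz ⊢
      have h2 := key a b _ hz hab (hle b (by simp))
      rw [← Multiset.add_cons] at h2 ⊢
      exact ih (fun x hx => hle x (by simp [hx])) _ h2
  have hrel : ∀ t : Multiset U, t.map q.toFun = s.map q.toFun → U.rel t e → U.rel s e := by
    intro t ht hte
    have hr : Multiset.Rel (fun a b => q.toFun a = q.toFun b) t s := by
      have := Multiset.rel_eq.2 ht
      rwa [Multiset.rel_map] at this
    simpa using key2 s t hr hle 0 (by simpa using hte)
  rcases hU.rel_or_rel_of_map_eq hQ q he with h1 | h1
  · exact hrel s' hs (by simpa using rel_subst (t := 0) h1 h)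
  -- Here `e ≤ e'`, the wrong direction for transitivity, so the relation is pushed down to the
  -- bottom of the fibre first. If it cannot be, its source is one edge of the fibre of `e`, and
  -- reflexivity at `e` serves instead.
  · obtain ⟨b, hb, hb'⟩ := hU.exists_bot hQ q e
    rcases hU.rel_bot_or hQ q e' (hb.trans he.symm) (fun v hv => hb' v (hv.trans he)) h with
      h2 | ⟨c, rfl, hc⟩
    · exact hrel s' hs (by simpa using rel_subst (t := 0) (hb' e rfl) h2)
    · exact hrel {e} (by rw [← hs]; simp [hc, he]) (U.str.refl e)

end Image

end PreBroad

end Dendro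

namespace Dendro

universe u

variable {G : Type u} [Group G]

/-! ### Pushouts of `G`-dendroidal sets -/

/-- Forgetting the action and evaluating at each tree reduces the claim to sets. There, along an
injection, a commutative square is a pushout as soon as it is a pullback, jointly surjective, and
injective off the image of `l`. -/
theorem isPushout_of_elements {X Y Z W : Action DSet G} {t : X ⟶ Y} {l : X ⟶ Z} {r : Y ⟶ W}
    {b : Z ⟶ W} (w : t ≫ r = l ≫ b) (hl : ∀ U, Function.Injective (l.hom.app U))
    (hr : ∀ U, Function.Injective (r.hom.app U))
    (hrb : ∀ U y z, r.hom.app U y = b.hom.app U z → z ∈ Set.range (l.hom.app U))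
    (hb : ∀ U z z', z ∉ Set.range (l.hom.app U) → z' ∉ Set.range (l.hom.app U) →
      b.hom.app U z = b.hom.app U z' → z = z')
    (hs : ∀ U x, x ∈ Set.range (r.hom.app U) ∨ x ∈ Set.range (b.hom.app U)) :
    IsPushout t l r b := by
  have w' : t.hom ≫ r.hom = l.hom ≫ b.hom := congrArg Action.Hom.hom w
  have key : IsPushout t.hom l.hom r.hom b.hom := by
    refine ⟨⟨w'⟩, ⟨evaluationJointlyReflectsColimits _ fun U => ?_⟩⟩
    refine (isColimitMapCoconePushoutCoconeEquiv _ _).symm (IsPushout.isColimit ?_)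
    have wU : t.hom.app U ≫ r.hom.app U = l.hom.app U ≫ b.hom.app U :=
      congrArg (fun f => NatTrans.app f U) w'
    have : Mono (((evaluation Omegaᵒᵖ Type).obj U).map r.hom) := (mono_iff_injective _).2 (hr U)
    refine Types.isPushout_of_isPullback_of_mono' ?_ ?_ ?_
    · rw [Types.isPullback_iff]
      refine ⟨wU, fun x y h => hl U h.2, fun y z h => ?_⟩
      obtain ⟨x, rfl⟩ := hrb U y z h
      exact ⟨x, hr U ((ConcreteCategory.congr_hom wU x).trans h.symm), rfl⟩
    · exact Set.eq_univ_of_forall fun x => hs U x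
    · exact fun z z' hz hz' h => hb U z z' hz hz' h
  exact IsPushout.of_map (Action.forget DSet G) w key

/-! ### Stable families of dendrices -/

/-- A family of dendrices of `Ω[Q]` closed under restriction and under the action of `G`. -/
structure GSieve (Q : Action PreBroad G) where
  mem : ∀ {U : Omega}, (U.toPre ⟶ Q.V) → Prop
  precomp : ∀ {U V : Omega} (k : U.toPre ⟶ V.toPre) (f : V.toPre ⟶ Q.V), mem f → mem (k ≫ f)
  act_mem : ∀ (g : G) {U : Omega} (f : U.toPre ⟶ Q.V), mem f → mem (f ≫ (actIso Q g).hom)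

namespace GSieve

variable {Q : Action PreBroad G}

/-- The subpresheaf of `Ω[Q]` given by a stable family. -/
def toSubfunctor (A : GSieve Q) : Subfunctor (nerve.obj Q.V) where
  obj U := {f : U.unop.toPre ⟶ Q.V | A.mem f}
  map {_ _} k f hf := A.precomp (Omega.incl.map k.unop) f hf

/-- The `G`-dendroidal set given by a stable family. -/
def toAction (A : GSieve Q) : Action DSet G :=
  subAction (nerveG.obj Q) A.toSubfunctor fun g _ f hf => A.act_mem g f hf

/-- The inclusion into `Ω[Q]`. -/
def incl (A : GSieve Q) : A.toAction ⟶ nerveG.obj Q := subActionIncl _ _ _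

theorem incl_injective (A : GSieve Q) (U : Omegaᵒᵖ) : Function.Injective (A.incl.hom.app U) :=
  Subtype.val_injective

/-- A map to `Ω[Q]` with values in a stable family. -/
def lift (A : GSieve Q) {X : Action DSet G} (α : X ⟶ nerveG.obj Q)
    (h : ∀ U x, α.hom.app U x ∈ A.toSubfunctor.obj U) : X ⟶ A.toAction where
  hom :=
    { app := fun U => ↾(fun x => ⟨α.hom.app U x, h U x⟩)
      naturality := fun U V k => by
        ext x
        refine Subtype.ext ?_
        have h := NatTrans.naturality_apply α.hom k x
        exact h }
  comm g := by
    apply NatTrans.ext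
    funext U
    ext x
    have := congrArg (fun f => NatTrans.app f U) (α.comm g)
    have h2 := ConcreteCategory.congr_hom this x
    exact Subtype.ext h2

theorem hom_ext (A : GSieve Q) {X : Action DSet G} {α β : X ⟶ A.toAction}
    (h : α ≫ A.incl = β ≫ A.incl) : α = β := by
  apply Action.hom_ext
  apply NatTrans.ext
  funext U
  ext x
  have h1 := congrArg Action.Hom.hom h
  have h2 := congrArg (fun f => NatTrans.app f U) h1
  have h3 := ConcreteCategory.congr_hom h2 x
  exact Subtype.ext h3

instance : LE (GSieve Q) := ⟨fun A B => ∀ {U : Omega} (f : U.toPre ⟶ Q.V), A.mem f → B.mem f⟩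

/-- The inclusion between two stable families. -/
def ofLE {A B : GSieve Q} (h : A ≤ B) : A.toAction ⟶ B.toAction :=
  B.lift A.incl fun _ x => h _ x.2

theorem ofLE_incl {A B : GSieve Q} (h : A ≤ B) : ofLE h ≫ B.incl = A.incl := rfl

/-- Attaching a forest along a horn. -/
theorem isPushout_attach {A B : GSieve Q} (hAB : A ≤ B) {T : Action PreBroad G} (c : T ⟶ Q)
    (E : Set T.V) (hE : ∀ (g : G), ∀ x ∈ E, act T g x ∈ E)
    (h₁ : ∀ U : Omega, ∀ f : U.toPre ⟶ T.V, f ∈ (horn T.V E).obj (op U) ↔ A.mem (f ≫ c.hom))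
    (h₂ : ∀ U : Omega, ∀ f f' : U.toPre ⟶ T.V, f ∉ (horn T.V E).obj (op U) →
      f ≫ c.hom = f' ≫ c.hom → f = f')
    (h₃ : ∀ U : Omega, ∀ f : U.toPre ⟶ Q.V, B.mem f ↔
      A.mem f ∨ ∃ f' : U.toPre ⟶ T.V, f' ≫ c.hom = f) :
    IsPushout (A.lift (hornIncl T E hE ≫ nerveG.map c) fun U x => (h₁ U.unop x.1).1 x.2)
      (hornIncl T E hE) (ofLE hAB)
      (B.lift (nerveG.map c) fun U x => (h₃ U.unop _).2 (Or.inr ⟨x, rfl⟩)) := by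
  refine isPushout_of_elements rfl (fun U => Subtype.val_injective) ?_ ?_ ?_ ?_
  · intro U x y h
    exact Subtype.ext (congrArg (fun z => (z : B.toSubfunctor.obj U).1) h)
  · intro U y z h
    have h' : y.1 = z ≫ c.hom := congrArg (fun z => (z : B.toSubfunctor.obj U).1) h
    exact ⟨⟨z, (h₁ U.unop z).2 (h' ▸ y.2)⟩, rfl⟩
  · intro U z z' hz _ h
    have h' : z ≫ c.hom = z' ≫ c.hom := congrArg (fun z => (z : B.toSubfunctor.obj U).1) h
    exact h₂ U.unop z z' (fun hz' => hz ⟨⟨z, hz'⟩, rfl⟩) h'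
  · intro U x
    rcases (h₃ U.unop x.1).1 x.2 with h | ⟨f, hf⟩
    · exact Or.inl ⟨⟨x.1, h⟩, rfl⟩
    · exact Or.inr ⟨f, Subtype.ext hf⟩

end GSieve

/-! ### Closure properties of `G`-inner anodyne extensions -/

theorem gInnerAnodyne_of_isPushout {X Y Z W : Action DSet G} {t : X ⟶ Y} {l : X ⟶ Z} {r : Y ⟶ W}
    {b : Z ⟶ W} (h : IsPushout t l r b) (hl : GInnerHorn G l) : GInnerAnodyne G r :=
  fun W hW _ _ _ => W.of_isPushout h (hW _ hl)

theorem GInnerAnodyne.comp {X Y Z : Action DSet G} {f : X ⟶ Y} {g : Y ⟶ Z}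
    (hf : GInnerAnodyne G f) (hg : GInnerAnodyne G g) : GInnerAnodyne G (f ≫ g) :=
  fun W h₁ h₂ h₃ h₄ => W.comp_mem _ _ (hf W h₁ h₂ h₃ h₄) (hg W h₁ h₂ h₃ h₄)

theorem gInnerAnodyne_of_isIso {X Y : Action DSet G} (f : X ⟶ Y) [IsIso f] : GInnerAnodyne G f :=
  fun W _ _ _ _ => W.of_isIso f

namespace GSieve

variable {Q : Action PreBroad G}

/-- The inclusion `A ⟶ B` is a `G`-inner anodyne extension. -/
def Anodyne (A B : GSieve Q) : Prop := ∃ h : A ≤ B, GInnerAnodyne G (ofLE h)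

theorem Anodyne.trans {A B C : GSieve Q} (h₁ : A.Anodyne B) (h₂ : B.Anodyne C) : A.Anodyne C := by
  obtain ⟨h₁, h₁'⟩ := h₁
  obtain ⟨h₂, h₂'⟩ := h₂
  exact ⟨fun f hf => h₂ f (h₁ f hf), h₁'.comp h₂'⟩

theorem anodyne_of_iff {A B : GSieve Q}
    (h : ∀ {U : Omega} (f : U.toPre ⟶ Q.V), A.mem f ↔ B.mem f) : A.Anodyne B := by
  have h₁ : A ≤ B := fun f => (h f).1
  have h₂ : B ≤ A := fun f => (h f).2
  refine ⟨h₁, ?_⟩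
  have : IsIso (ofLE h₁) := ⟨ofLE h₂, rfl, rfl⟩
  exact gInnerAnodyne_of_isIso _

end GSieve

end Dendro

namespace Dendro

open scoped Pointwise

open PreBroad

universe u

variable {G : Type u} [Group G]

theorem Omega.toPre_isTree (U : Omega) : U.toPre.IsTree := U.isTree

theorem exists_map_eq {α β : Type} (f : α → β) (s : Multiset β) (h : ∀ x ∈ s, x ∈ Set.range f) :
    ∃ t : Multiset α, t.map f = s := by
  induction s using Multiset.induction with
  | empty => exact ⟨0, rfl⟩
  | cons x s ih =>
    obtain ⟨t, rfl⟩ := ih fun y hy => h y (Multiset.mem_cons_of_mem hy)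
    obtain ⟨a, rfl⟩ := h x (Multiset.mem_cons_self _ _)
    exact ⟨a ::ₘ t, Multiset.map_cons _ _ _⟩

/-! ### The action on edges -/

section ActionOnEdges

instance (Q : Action PreBroad G) : MulAction G Q.V where
  smul g x := act Q g x
  one_smul := act_one Q
  mul_smul g h x := act_mul Q g h x

variable {Q : Action PreBroad G}

theorem actIso_toFun (g : G) (x : Q.V) : (actIso Q g).hom.toFun x = g • x := rfl

theorem rel_smul (g : G) {s : Multiset Q.V} {e : Q.V} (h : Q.V.rel s e) :
    Q.V.rel (s.map (g • ·)) (g • e) :=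
  (actIso Q g).hom.map_rel _ _ h

theorem isTree_restrict_smul {W : Set Q.V} (hW : (Q.V.restrict W).IsTree) (g : G) :
    (Q.V.restrict (g • W)).IsTree := by
  refine hW.of_retract
    (restrictLift (Q.V.restrictIncl (g • W) ≫ (actIso Q g⁻¹).hom) W fun x =>
      Set.mem_smul_set_iff_inv_smul_mem.1 x.2)
    (restrictLift (Q.V.restrictIncl W ≫ (actIso Q g).hom) (g • W) fun x =>
      Set.smul_mem_smul_set x.2) ?_ ?_
  · exact fun v => Subtype.ext (smul_inv_smul g v.1)
  · intro u
    rw [show ∀ v, (restrictLift (Q.V.restrictIncl (g • W) ≫ (actIso Q g⁻¹).hom) W fun x =>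
      Set.mem_smul_set_iff_inv_smul_mem.1 x.2).toFun ((restrictLift (Q.V.restrictIncl W ≫
        (actIso Q g).hom) (g • W) fun x => Set.smul_mem_smul_set x.2).toFun v) = v from
      fun v => Subtype.ext (inv_smul_smul g v.1)]
    exact (Q.V.restrict W).str.refl u

end ActionOnEdges

/-! ### The forest of translates of a tree -/

section Translates

variable (Q : Action PreBroad G) (W : Set Q.V)

/-- The disjoint union of the full broad subposets of `Q` on the translates of `W`. -/
abbrev translatesPre : PreBroad where
  carrier := {p : Set Q.V × Q.V // p.1 ∈ MulAction.orbit G W ∧ p.2 ∈ p.1}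
  str :=
    { rel := fun s e => Q.V.rel (s.map fun x => x.1.2) e.1.2 ∧ ∀ x ∈ s, x.1.1 = e.1.1
      refl := fun e => ⟨by simpa using Q.V.str.refl e.1.2, by simp⟩
      trans := by
        intro s e hs h
        refine ⟨?_, ?_⟩
        · have := Q.V.str.trans (s.map fun p => (p.1.map fun x => x.1.2, p.2.1.2)) e.1.2
            (by
              intro p hp
              obtain ⟨q, hq, rfl⟩ := Multiset.mem_map.1 hp
              exact (hs q hq).1)
            (by simpa [Multiset.map_map, Function.comp_def] using h.1)
          have h2 := (Multiset.mapAddMonoidHom (fun x : {p : Set Q.V × Q.V //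
            p.1 ∈ MulAction.orbit G W ∧ p.2 ∈ p.1} => x.1.2)).map_multiset_sum (s.map Prod.fst)
          simp only [Multiset.coe_mapAddMonoidHom] at h2
          rw [h2]
          simpa [Multiset.map_map, Function.comp_def] using this
        · intro x hx
          obtain ⟨c, hc, hxc⟩ := Multiset.mem_join.1 hx
          obtain ⟨p, hp, rfl⟩ := Multiset.mem_map.1 hc
          exact ((hs p hp).2 x hxc).trans (h.2 _ (Multiset.mem_map_of_mem _ hp)) }

/-- The forest of translates of `W`, with its action of `G`. -/
def translates : Action PreBroad G where
  V := translatesPre Q W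
  ρ :=
    { toFun := fun g =>
        (Hom.mk (fun x => ⟨(g • x.1.1, g • x.1.2), by
            obtain ⟨h, hh⟩ := x.2.1
            exact ⟨g * h, (mul_smul g h W).trans (congrArg (g • ·) hh)⟩,
            Set.smul_mem_smul_set x.2.2⟩)
          (by
            intro s e h
            refine ⟨?_, ?_⟩
            · have := rel_smul g h.1
              rw [Multiset.map_map] at this ⊢
              exact this
            · intro x hx
              obtain ⟨y, hy, rfl⟩ := Multiset.mem_map.1 hx
              exact congrArg (g • ·) (h.2 y hy)) : translatesPre Q W ⟶ translatesPre Q W)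
      map_one' := PreBroad.hom_ext fun x =>
        Subtype.ext (Prod.ext (one_smul G x.1.1) (one_smul G x.1.2))
      map_mul' := fun g h => PreBroad.hom_ext fun x =>
        Subtype.ext (Prod.ext (mul_smul g h x.1.1) (mul_smul g h x.1.2)) }

/-- The map from the forest of translates to `Q`. -/
def translatesHom : translates Q W ⟶ Q where
  hom := Hom.mk (fun x => x.1.2) fun _ _ h => h.1
  comm _ := rfl

variable {Q W}

theorem translates_rel_iff {s : Multiset (translates Q W).V} {e : (translates Q W).V} :
    (translates Q W).V.rel s e ↔ Q.V.rel (s.map (translatesHom Q W).hom.toFun)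
      ((translatesHom Q W).hom.toFun e) ∧ ∀ x ∈ s, x.1.1 = e.1.1 := Iff.rfl

theorem translates_smul_fst (g : G) (x : (translates Q W).V) : (g • x).1.1 = g • x.1.1 := rfl

theorem translates_desc_fst {x e : (translates Q W).V} (h : (translates Q W).V.Desc x e) :
    x.1.1 = e.1.1 := by
  obtain ⟨s, hs, h⟩ := h
  exact h.2 x hs

/-- The inclusion of a component in the forest of translates. -/
def translatesComponent {W' : Set Q.V} (hW' : W' ∈ MulAction.orbit G W) :
    Q.V.restrict W' ⟶ (translates Q W).V :=
  Hom.mk (fun x => ⟨(W', x.1), hW', x.2⟩) fun s e h => by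
    refine translates_rel_iff.2 ⟨?_, fun x hx => ?_⟩
    · exact (congrArg (Q.V.rel · e.1) (Multiset.map_map _ _ s)).mpr h
    · obtain ⟨y, -, rfl⟩ := Multiset.mem_map.1 hx
      rfl

/-- A relation of the forest stays within one component, so leaves and vertices can be computed
there. -/
theorem exists_rel_component {W' : Set Q.V} (hW' : W' ∈ MulAction.orbit G W)
    {e : Q.V.restrict W'} {s : Multiset (translates Q W).V}
    (h : (translates Q W).V.rel s ((translatesComponent hW').toFun e)) :
    ∃ t, t.map (translatesComponent hW').toFun = s ∧ (Q.V.restrict W').rel t e := by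
  obtain ⟨t, rfl⟩ := exists_map_eq (translatesComponent hW').toFun s fun x hx =>
    ⟨⟨x.1.2, (show x.1.1 = W' from h.2 x hx) ▸ x.2.2⟩, Subtype.ext (Prod.ext (h.2 x hx).symm rfl)⟩
  refine ⟨t, rfl, ?_⟩
  have h1 := (translates_rel_iff.1 h).1
  rw [Multiset.map_map] at h1
  exact h1

theorem exists_component (e : (translates Q W).V) :
    ∃ (W' : Set Q.V) (hW' : W' ∈ MulAction.orbit G W) (e' : Q.V.restrict W'),
      (translatesComponent hW').toFun e' = e :=
  ⟨e.1.1, e.2.1, ⟨e.1.2, e.2.2⟩, rfl⟩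

theorem component_injective {W' : Set Q.V} (hW' : W' ∈ MulAction.orbit G W) :
    Function.Injective (translatesComponent hW').toFun := fun _ _ h =>
  Subtype.ext (congrArg (fun z : (translates Q W).V => z.1.2) h)

theorem isTree_of_mem_orbit (hW : (Q.V.restrict W).IsTree) {W' : Set Q.V}
    (hW' : W' ∈ MulAction.orbit G W) : (Q.V.restrict W').IsTree := by
  obtain ⟨g, rfl⟩ := hW'
  exact isTree_restrict_smul hW g

theorem isRoot_component (hW : (Q.V.restrict W).IsTree) {W' : Set Q.V}
    (hW' : W' ∈ MulAction.orbit G W) {r : Q.V.restrict W'} (hr : ∀ e, (Q.V.restrict W').Desc e r) :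
    (translates Q W).V.IsRoot ((translatesComponent hW').toFun r) := by
  have hT := isTree_of_mem_orbit hW hW'
  intro e he
  obtain ⟨e, rfl⟩ : ∃ e', (translatesComponent hW').toFun e' = e := by
    have := translates_desc_fst he
    exact ⟨⟨e.1.2, (show W' = e.1.1 from this) ▸ e.2.2⟩, Subtype.ext (Prod.ext this rfl)⟩
  obtain ⟨s, hs, h⟩ := he
  obtain ⟨t, rfl, ht⟩ := exists_rel_component hW' h
  obtain ⟨r', hr', h'⟩ := Multiset.mem_map.1 hs
  obtain rfl := component_injective hW' h'
  rw [hT.isSeparated.desc_antisymm (hr e) ⟨t, hr', ht⟩]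

theorem translates_isForest [Finite Q.V] (hQ : Q.V.IsSeparated) (hW : (Q.V.restrict W).IsTree) :
    (translates Q W).V.IsForest := by
  have hsep : (translates Q W).V.IsSeparated := by
    refine ⟨fun e f h1 h2 => ?_, fun s e h => ?_⟩
    · exact Subtype.ext (Prod.ext (h1.2 e (Multiset.mem_singleton_self e))
        (hQ.antisymm _ _ (translates_rel_iff.1 h1).1 (translates_rel_iff.1 h2).1))
    · exact (hQ.simple _ _ h.1).of_map _
  refine ⟨⟨inferInstanceAs (Finite {p : Set Q.V × Q.V // _}), hsep.antisymm, hsep.simple, ?_⟩, ?_⟩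
  · intro e
    obtain ⟨W', hW', e, rfl⟩ := exists_component e
    apply nodal_of_leaf_or_maxBelow
    rcases (isTree_of_mem_orbit hW hW').leaf_or_maxBelow e with hl | ⟨w, h1, h2, h3⟩
    · left
      intro s hs
      obtain ⟨t, rfl, ht⟩ := exists_rel_component hW' hs
      rw [hl t ht, Multiset.map_singleton]
    · right
      refine ⟨w.map (translatesComponent hW').toFun, (translatesComponent hW').map_rel _ _ h1,
        ?_, ?_⟩
      · intro h
        rw [← Multiset.map_singleton] at h
        exact h2 (Multiset.map_injective (component_injective hW') h)
      · intro g hg hne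
        obtain ⟨t, rfl, ht⟩ := exists_rel_component hW' hg
        exact (translatesComponent hW').map_leTuple (h3 t ht (by
          rintro rfl
          exact hne (Multiset.map_singleton _ _)))
  · intro e
    obtain ⟨W', hW', e, rfl⟩ := exists_component e
    obtain ⟨r, hr⟩ := (isTree_of_mem_orbit hW hW').root
    have hd := (translatesComponent hW').map_desc (hr e)
    refine ⟨_, ⟨isRoot_component hW hW' hr, hd⟩, ?_⟩
    rintro r' ⟨hr', her'⟩
    have h := (translates_desc_fst her').symm.trans (translates_desc_fst hd)
    obtain ⟨r', rfl⟩ : ∃ x, (translatesComponent hW').toFun x = r' :=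
      ⟨⟨r'.1.2, (show r'.1.1 = W' from h) ▸ r'.2.2⟩, Subtype.ext (Prod.ext h.symm rfl)⟩
    exact (hr' _ ((translatesComponent hW').map_desc (hr r'))).symm

/-- There is one component for each distinct translate of `W`, and `G` permutes them transitively;
hence so are their roots. -/
theorem translates_isGTree [Finite Q.V] (hQ : Q.V.IsSeparated) (hW : (Q.V.restrict W).IsTree) :
    IsGTree (translates Q W) := by
  have hF := translates_isForest hQ hW
  refine ⟨hF, ?_⟩
  obtain ⟨r, hr⟩ := hW.root
  have hW₀ : W ∈ MulAction.orbit G W := MulAction.mem_orbit_self W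
  refine ⟨(translatesComponent hW₀).toFun r, isRoot_component hW hW₀ hr, fun r' hr' => ?_⟩
  obtain ⟨g, hg⟩ := r'.2.1
  refine ⟨g, hr' _ ?_⟩
  have h0 : (g⁻¹ • r').1.1 = W := by
    rw [translates_smul_fst, ← hg]
    exact inv_smul_smul g W
  have h1 : ∃ x, (translatesComponent hW₀).toFun x = g⁻¹ • r' :=
    ⟨⟨(g⁻¹ • r').1.2, Set.mem_of_mem_of_subset (g⁻¹ • r').2.2 h0.subset⟩,
      Subtype.ext (Prod.ext h0.symm rfl)⟩
  obtain ⟨x, hx⟩ := h1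
  have h2 := (actIso (translates Q W) g).hom.map_desc
    ((translatesComponent hW₀).map_desc (hr x))
  rw [hx, actIso_toFun, smul_inv_smul] at h2
  exact h2

/-- A map from a tree to the forest of translates lands in one translate. -/
theorem exists_translate {U : PreBroad} (hU : U.IsTree) (f : U ⟶ (translates Q W).V) :
    ∃ g : G, ∀ u, (f.toFun u).1.1 = g • W := by
  obtain ⟨r, hr⟩ := hU.root
  obtain ⟨g, hg⟩ := (f.toFun r).2.1
  exact ⟨g, fun u => (translates_desc_fst (f.map_desc (hr u))).trans hg.symm⟩

end Translates

/-! ### Attaching orbits of trees -/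

/-- A map reflecting broad relations. -/
def Reflects {V Q : PreBroad} (m : V ⟶ Q) : Prop :=
  ∀ (s : Multiset V) (e : V), Q.rel (s.map m.toFun) (m.toFun e) → V.rel s e

/-- A map such that all broad relations between edges of its image lift. -/
def IsFull {U Q : PreBroad} (f : U ⟶ Q) : Prop :=
  ∀ (s : Multiset U) (u : U), Q.rel (s.map f.toFun) (f.toFun u) →
    ∃ t v, U.rel t v ∧ t.map f.toFun = s.map f.toFun ∧ f.toFun v = f.toFun u

namespace GSieve

variable {Q : Action PreBroad G}

/-- The family obtained from `A` by adding the dendrices with image in a translate of a member of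
`𝓦`. -/
def attach (A : GSieve Q) (𝓦 : Set (Set Q.V)) : GSieve Q where
  mem {U} f := A.mem f ∨ ∃ W ∈ 𝓦, ∃ g : G, ∀ u, f.toFun u ∈ g • W
  precomp {U V} k f h := by
    rcases h with h | ⟨W, hW, g, h⟩
    · exact Or.inl (A.precomp k f h)
    · exact Or.inr ⟨W, hW, g, fun u => h (k.toFun u)⟩
  act_mem g {U} f h := by
    rcases h with h | ⟨W, hW, g', h⟩
    · exact Or.inl (A.act_mem g f h)
    · refine Or.inr ⟨W, hW, g * g', fun u => ?_⟩
      rw [mul_smul]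
      exact Set.smul_mem_smul_set (h u)

/-- The conditions under which the orbit of the tree `W` may be attached to `A` along the horn
`Λ^E[W]`. -/
structure IsCell (A : GSieve Q) (W E : Set Q.V) : Prop where
  subset : E ⊆ W
  smul_eq : ∀ g : G, g • W = W → g • E = E
  isTree : ∀ P ⊆ E, (Q.V.restrict (W \ P)).IsTree
  exists_rel : ∀ e ∈ E, ∃ t, (∀ x ∈ t, x ∈ W \ E) ∧ Q.V.rel t e
  exists_not_desc : ∀ e ∈ E, ∃ x ∈ W \ E, ¬ Q.V.Desc x e
  mem_of_face : ∀ (V : Omega) (m : V.toPre ⟶ Q.V), Function.Injective m.toFun →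
    (∀ v, m.toFun v ∈ W) → (¬ W \ E ⊆ Set.range m.toFun ∨ ¬ Reflects m) → A.mem m
  not_mem : ∀ (U : Omega) (f : U.toPre ⟶ Q.V), (∀ u, f.toFun u ∈ W) →
    W \ E ⊆ Set.range f.toFun → IsFull f → ¬ A.mem f
  translate : ∀ g : G, W \ E ⊆ g • W → g • W = W

variable {A : GSieve Q} {W E : Set Q.V}

theorem mem_smul_iff (A : GSieve Q) (g : G) {U : Omega} (f : U.toPre ⟶ Q.V) :
    A.mem (f ≫ (actIso Q g).hom) ↔ A.mem f := by
  refine ⟨fun h => ?_, A.act_mem g f⟩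
  have h2 := A.act_mem g⁻¹ _ h
  have : (f ≫ (actIso Q g).hom) ≫ (actIso Q g⁻¹).hom = f :=
    PreBroad.hom_ext fun u => inv_smul_smul g (f.toFun u)
  rwa [this] at h2

/-! ### Attaching one orbit along a generating horn -/

namespace IsCell

variable (h : A.IsCell W E) {e : Q.V} (he : e ∈ E) (hO : ∀ x ∈ E, ∃ g : G, g • W = W ∧ g • e = x)

include h in
theorem tree : (Q.V.restrict W).IsTree := by
  simpa using h.isTree ∅ (Set.empty_subset E)

/-- The edge `e` of the tree `W`, as an edge of the forest of translates. -/
def edge : (translates Q W).V := ⟨(W, e), MulAction.mem_orbit_self W, h.subset he⟩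

-- On the component `g • W`, the `G`-orbit of `e` is exactly `g • E`. This uses that `E` is a single
-- orbit of the stabilizer of `W`, and it identifies the generating horn with the horn of `E`.
include hO in
theorem mem_orbit_edge {x : (translates Q W).V} {g : G} (hx : x.1.1 = g • W) :
    x ∈ orbit (translates Q W) (h.edge he) ↔ g⁻¹ • x.1.2 ∈ E := by
  constructor
  · rintro ⟨g', rfl⟩
    have hg : (g⁻¹ * g') • W = W := by
      rw [mul_smul]
      change g' • W = g • W at hx
      rw [hx, inv_smul_smul]
    change g⁻¹ • g' • e ∈ E
    rw [← mul_smul, ← h.smul_eq _ hg]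
    exact Set.smul_mem_smul_set he
  · intro hx'
    obtain ⟨g', hg', hge⟩ := hO _ hx'
    refine ⟨g * g', Subtype.ext (Prod.ext ?_ ?_)⟩
    · change (g * g') • W = x.1.1
      rw [mul_smul, hg', hx]
    · change (g * g') • e = x.1.2
      rw [mul_smul, hge, smul_inv_smul]

/-- `exists_rel` prevents `e` from being a leaf and `exists_not_desc` prevents it from being the
root of its component. -/
theorem isInner_edge : (translates Q W).V.IsInner (h.edge he) := by
  refine ⟨fun hl => ?_, fun hr => ?_⟩
  · obtain ⟨t, ht, hte⟩ := h.exists_rel e he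
    obtain ⟨t', ht'⟩ := exists_map_eq
      (fun x : (Q.V.restrict W) => x.1) t (fun x hx => ⟨⟨x, (ht x hx).1⟩, rfl⟩)
    have h1 : (Q.V.restrict W).rel t' ⟨e, h.subset he⟩ := by
      change Q.V.rel (t'.map fun x => x.1) e
      rwa [ht']
    have h2 := hl _ ((translatesComponent (MulAction.mem_orbit_self W)).map_rel _ _ h1)
    obtain ⟨y, rfl, hy⟩ := Multiset.map_eq_singleton.1 h2
    have hy' : y.1 = e := congrArg (fun z : (translates Q W).V => z.1.2) hy
    exact (ht y.1 (by rw [← ht']; simp)).2 (hy'.symm ▸ he)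
  · obtain ⟨r, hr'⟩ := h.tree.root
    have h1 := hr _ ((translatesComponent (MulAction.mem_orbit_self W)).map_desc
      (hr' ⟨e, h.subset he⟩))
    have h2 : r.1 = e := congrArg (fun z : (translates Q W).V => z.1.2) h1
    obtain ⟨x, hx, hxe⟩ := h.exists_not_desc e he
    refine hxe ?_
    rw [← h2]
    exact (Q.V.restrictIncl W).map_desc (hr' ⟨x, hx.1⟩)

-- Translate the face back into `W`. If it covered `W \ E` and reflected relations, it would be one
-- of the faces that the horn omits; otherwise `mem_of_face` applies.
include hO in
theorem mem_of_mem_horn {U : Omega} {f : U.toPre ⟶ (translates Q W).V}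
    (hf : f ∈ (horn (translates Q W).V (orbit (translates Q W) (h.edge he))).obj (op U)) :
    A.mem (f ≫ (translatesHom Q W).hom) := by
  obtain ⟨V, m, k, hm, hV, rfl⟩ := hf
  obtain ⟨g, hg⟩ := exists_translate V.toPre_isTree m
  refine A.precomp k (m ≫ (translatesHom Q W).hom) ?_
  rw [← A.mem_smul_iff g⁻¹]
  have hmW : ∀ v, g⁻¹ • (m.toFun v).1.2 ∈ W := fun v =>
    Set.mem_smul_set_iff_inv_smul_mem.1 (hg v ▸ (m.toFun v).2.2)
  have hext : ∀ x y : (translates Q W).V, x.1.1 = g • W → y.1.1 = g • W → x.1.2 = y.1.2 → x = y :=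
    fun x y hx hy hxy => Subtype.ext (Prod.ext (hx.trans hy.symm) hxy)
  refine h.mem_of_face V _ ?_ hmW ?_
  · intro v v' hv
    exact hm (hext _ _ (hg v) (hg v') (MulAction.injective g⁻¹ hv))
  · by_contra! hcon
    refine hV ⟨fun s e hs => hcon.2 s e ?_, fun v x r hv hx hxm => ?_⟩
    · have := rel_smul g⁻¹ (translates_rel_iff.1 hs).1
      rw [Multiset.map_map, Multiset.map_map] at this
      exact this
    · have hx1 : x.1.1 = g • W :=
        (translates_desc_fst hx).trans ((translates_desc_fst hv).symm.trans (hg v))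
      rw [h.mem_orbit_edge he hO hx1]
      by_contra hxE
      obtain ⟨v', hv'⟩ := hcon.1 ⟨Set.mem_smul_set_iff_inv_smul_mem.1 (hx1 ▸ x.2.2), hxE⟩
      exact hxm ⟨v', hext _ _ (hg v') hx1 (MulAction.injective g⁻¹ hv')⟩

-- Such a dendrex is a degeneracy of its image, which must be one of the omitted faces, namely `W -
-- E'` up to translation. Fullness, unlike `Reflects`, survives composition with a degeneracy that
-- has a section.
include hO in
theorem full_of_not_mem_horn (hT : (translates Q W).V.IsSeparated) {U : Omega}
    {f : U.toPre ⟶ (translates Q W).V}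
    (hf : f ∉ (horn (translates Q W).V (orbit (translates Q W) (h.edge he))).obj (op U))
    {g : G} (hg : ∀ u, (f.toFun u).1.1 = g • W) :
    W \ E ⊆ Set.range (f ≫ (translatesHom Q W).hom ≫ (actIso Q g⁻¹).hom).toFun ∧
      IsFull (f ≫ (translatesHom Q W).hom ≫ (actIso Q g⁻¹).hom) := by
  obtain ⟨V, d, m, σ, hdm, hm, hσ, -⟩ := U.toPre_isTree.exists_image hT f
  have hdm' : ∀ u, m.toFun (d.toFun u) = f.toFun u := fun u => by rw [← hdm]; rfl
  have hfσ : ∀ v, f.toFun (σ.toFun v) = m.toFun v := fun v => by rw [← hdm', hσ]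
  have hV : IsComplFace (orbit (translates Q W) (h.edge he)) V m := by
    by_contra hV
    exact hf ⟨V, m, d, hm, hV, hdm⟩
  obtain ⟨r, hr⟩ := U.toPre_isTree.root
  constructor
  · intro x hx
    let y : (translates Q W).V := ⟨(g • W, g • x), ⟨g, rfl⟩, Set.smul_mem_smul_set hx.1⟩
    have hy : y ∉ orbit (translates Q W) (h.edge he) := by
      rw [h.mem_orbit_edge he hO (x := y) rfl]
      change g⁻¹ • g • x ∉ E
      rw [inv_smul_smul]
      exact hx.2
    have hgW : g • W ∈ MulAction.orbit G W := ⟨g, rfl⟩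
    obtain ⟨ρ, hρ⟩ := (isTree_of_mem_orbit h.tree hgW).root
    have hdesc : ∀ z : (translates Q W).V, z.1.1 = g • W →
        (translates Q W).V.Desc z ((translatesComponent hgW).toFun ρ) := by
      intro z hz
      have := (translatesComponent hgW).map_desc (hρ ⟨z.1.2, hz ▸ z.2.2⟩)
      rwa [show (translatesComponent hgW).toFun ⟨z.1.2, hz ▸ z.2.2⟩ = z from
        Subtype.ext (Prod.ext hz.symm rfl)] at this
    by_contra hxr
    refine hy (hV.2 (d.toFun r) y _ (hdesc _ (by rw [hdm']; exact hg r)) (hdesc y rfl) ?_)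
    rintro ⟨v, hv⟩
    refine hxr ⟨σ.toFun v, ?_⟩
    change g⁻¹ • (f.toFun (σ.toFun v)).1.2 = x
    rw [hfσ, hv]
    exact inv_smul_smul g x
  · intro s u hs
    have h1 := rel_smul g hs
    rw [Multiset.map_map] at h1
    have h2 : (translates Q W).V.rel (s.map f.toFun) (f.toFun u) := by
      refine translates_rel_iff.2 ⟨?_, fun x hx => ?_⟩
      · rw [Multiset.map_map]
        convert h1 using 1
        · refine Multiset.map_congr rfl fun x _ => ?_
          exact (smul_inv_smul g (f.toFun x).1.2).symm
        · exact (smul_inv_smul g (f.toFun u).1.2).symm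
      · obtain ⟨y, -, rfl⟩ := Multiset.mem_map.1 hx
        rw [hg, hg]
    have h3 := σ.map_rel _ _ (hV.1 (s.map d.toFun) (d.toFun u) (by
      rw [Multiset.map_map]
      simpa only [Function.comp_def, hdm'] using h2))
    refine ⟨_, _, h3, ?_, ?_⟩
    · simp only [Multiset.map_map, Function.comp_def, comp_toFun, hfσ, hdm']
    · simp only [comp_toFun, hfσ, hdm']

-- The forest of translates of `W` is glued on in one pushout of a generating horn. `mem_of_face`
-- and `not_mem` identify the preimage of `A` with the horn, and `translate` gives injectivity off
-- it.
include h he hO in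
theorem anodyne_of_orbit [Finite Q.V] (hQ : Q.V.IsSeparated) : A.Anodyne (A.attach {W}) := by
  have hT := translates_isGTree hQ h.tree
  have hsep := hT.1.isSeparated
  have hAB : A ≤ A.attach {W} := fun f hf => Or.inl hf
  have hW : ∀ {U : Omega} (f : U.toPre ⟶ (translates Q W).V) (g : G),
      (∀ u, (f.toFun u).1.1 = g • W) → ∀ u, g⁻¹ • (f.toFun u).1.2 ∈ W := fun f g hg u =>
    Set.mem_smul_set_iff_inv_smul_mem.1 (hg u ▸ (f.toFun u).2.2)
  refine ⟨hAB, gInnerAnodyne_of_isPushout (isPushout_attach hAB (translatesHom Q W)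
    (orbit (translates Q W) (h.edge he)) (orbit_stable _ _) ?_ ?_ ?_)
    (GInnerHorn.mk _ hT _ (h.isInner_edge he))⟩
  · intro U f
    refine ⟨h.mem_of_mem_horn he hO, fun hf => ?_⟩
    by_contra hcon
    obtain ⟨g, hg⟩ := exists_translate U.toPre_isTree f
    obtain ⟨h1, h2⟩ := h.full_of_not_mem_horn he hO hsep hcon hg
    exact h.not_mem U _ (hW f g hg) h1 h2 (A.act_mem g⁻¹ _ hf)
  · intro U f f' hf hff
    obtain ⟨g, hg⟩ := exists_translate U.toPre_isTree f
    obtain ⟨g', hg'⟩ := exists_translate U.toPre_isTree f'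
    have h3 : ∀ u, (f.toFun u).1.2 = (f'.toFun u).1.2 := fun u =>
      congrArg (fun k : U.toPre ⟶ Q.V => k.toFun u) hff
    -- Both lifts cover the same edges of `Q`, among them a translate of `W \ E`, so they live over
    -- the same translate of `W`.
    have h4 : (g⁻¹ * g') • W = W := by
      refine h.translate _ fun x hx => ?_
      obtain ⟨u, rfl⟩ := (h.full_of_not_mem_horn he hO hsep hf hg).1 hx
      rw [mul_smul]
      change g⁻¹ • (f.toFun u).1.2 ∈ _
      refine Set.smul_mem_smul_set ?_
      rw [h3, ← hg' u]
      exact (f'.toFun u).2.2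
    have h5 : g' • W = g • W := by
      rw [← smul_inv_smul g (g' • W), ← mul_smul g⁻¹, h4]
    exact PreBroad.hom_ext fun u =>
      Subtype.ext (Prod.ext ((hg u).trans (h5.symm.trans (hg' u).symm)) (h3 u))
  · intro U f
    refine or_congr Iff.rfl ⟨?_, ?_⟩
    · rintro ⟨_, rfl, g, hg⟩
      exact ⟨restrictLift f (g • _) hg ≫ translatesComponent ⟨g, rfl⟩, rfl⟩
    · rintro ⟨f', rfl⟩
      obtain ⟨g, hg⟩ := exists_translate U.toPre_isTree f'
      exact ⟨W, rfl, g, fun u => hg u ▸ (f'.toFun u).2.2⟩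

end IsCell

/-- Induction over subfamilies closed under lower rank: remove the whole orbit of a member of
maximal rank, then put that orbit back last. Members of equal rank may come in any order, which is
why `step` allows an arbitrary such `𝓑`. -/
theorem anodyne_attach_of_filtration [Finite Q.V] (rank : Set Q.V → ℕ)
    (hrank : ∀ (g : G) (W : Set Q.V), rank (g • W) = rank W) (𝓦 : Set (Set Q.V))
    (step : ∀ W ∈ 𝓦, ∀ 𝓑 ⊆ 𝓦, (∀ W' ∈ 𝓦, rank W' < rank W → W' ∈ 𝓑) →
      (∀ W' ∈ 𝓑, rank W' ≤ rank W ∧ ∀ g : G, W' ≠ g • W) →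
      (A.attach 𝓑).Anodyne ((A.attach 𝓑).attach {W})) : A.Anodyne (A.attach 𝓦) := by
  suffices H : ∀ n, ∀ 𝓕 ⊆ 𝓦, 𝓕.ncard = n →
      (∀ W ∈ 𝓕, ∀ W' ∈ 𝓦, rank W' < rank W → W' ∈ 𝓕) → A.Anodyne (A.attach 𝓕) from
    H _ 𝓦 subset_rfl rfl fun _ _ W' hW' _ => hW'
  intro n
  induction n using Nat.strong_induction_on with
  | _ n ih =>
    intro 𝓕 h𝓕 hn hlow
    rcases 𝓕.eq_empty_or_nonempty with rfl | hne
    · exact anodyne_of_iff fun f => by simp [attach]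
    · obtain ⟨W, hW, hmax⟩ := Set.exists_max_image 𝓕 rank (Set.toFinite _) hne
      let 𝓑 : Set (Set Q.V) := {W' ∈ 𝓕 | ∀ g : G, W' ≠ g • W}
      have h𝓑 : 𝓑 ⊂ 𝓕 := by
        refine ⟨Set.sep_subset _ _, fun hcon => ?_⟩
        exact (hcon hW).2 1 (one_smul G W).symm
      have h1 : A.Anodyne (A.attach 𝓑) := by
        refine ih _ (hn ▸ Set.ncard_lt_ncard h𝓑 (Set.toFinite _)) 𝓑 (h𝓑.1.trans h𝓕) rfl ?_
        intro W₁ hW₁ W₂ hW₂ hlt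
        refine ⟨hlow W₁ hW₁.1 W₂ hW₂ hlt, ?_⟩
        rintro g rfl
        rw [hrank] at hlt
        exact (hmax W₁ hW₁.1).not_gt hlt
      have h2 := step W (h𝓕 hW) 𝓑 (h𝓑.1.trans h𝓕) (fun W' hW' hlt => by
          refine ⟨hlow W hW W' hW' hlt, ?_⟩
          rintro g rfl
          rw [hrank] at hlt
          exact lt_irrefl _ hlt) fun W' hW' => ⟨hmax W' hW'.1, hW'.2⟩
      refine (h1.trans h2).trans (anodyne_of_iff fun f => ?_)
      constructor
      · rintro ((hf | ⟨W', hW', hf⟩) | ⟨_, rfl, hf⟩)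
        · exact Or.inl hf
        · exact Or.inr ⟨W', hW'.1, hf⟩
        · exact Or.inr ⟨_, hW, hf⟩
      · rintro (hf | ⟨W', hW', g, hf⟩)
        · exact Or.inl (Or.inl hf)
        · by_cases hg : ∃ g : G, W' = g • W
          · obtain ⟨g', rfl⟩ := hg
            exact Or.inr ⟨W, rfl, g * g', by simpa only [mul_smul] using hf⟩
          · push Not at hg
            exact Or.inl (Or.inr ⟨W', ⟨hW', hg⟩, g, hf⟩)

/-- If `E` is not one orbit of the stabilizer of `W`, take an orbit `O` in it and attach the trees
`W \ P`, with `P ⊆ E \ O`, in increasing size. The last one, `P = ∅`, is `W`. -/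
theorem IsCell.anodyne [Finite Q.V] (hQ : Q.V.IsSeparated) (h : A.IsCell W E) (hE : E.Nonempty) :
    A.Anodyne (A.attach {W}) := by
  induction hn : E.ncard using Nat.strong_induction_on generalizing A W E with
  | _ n ih =>
    obtain ⟨e, he⟩ := hE
    let O : Set Q.V := {x | ∃ g : G, g • W = W ∧ g • e = x}
    have hOE : O ⊆ E := by
      rintro _ ⟨g, hg, rfl⟩
      rw [← h.smul_eq g hg]
      exact Set.smul_mem_smul_set he
    have hgO : ∀ g : G, g • W = W → g • O = O := by
      have : ∀ g : G, g • W = W → g • O ⊆ O := by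
        rintro g hg _ ⟨_, ⟨g', hg', rfl⟩, rfl⟩
        exact ⟨g * g', by rw [mul_smul, hg', hg], mul_smul g g' e⟩
      intro g hg
      refine (this g hg).antisymm ?_
      rw [Set.subset_smul_set_iff]
      exact this g⁻¹ (by rw [inv_smul_eq_iff, hg])
    by_cases hEO : E ⊆ O
    · exact h.anodyne_of_orbit he (fun x hx => hEO hx) hQ
    have hlt : O.ncard < n := hn ▸ Set.ncard_lt_ncard ⟨hOE, hEO⟩ (Set.toFinite _)
    have hfil : A.Anodyne (A.attach {W' | ∃ P ⊆ E \ O, W' = W \ P}) := by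
      refine anodyne_attach_of_filtration Set.ncard Set.ncard_smul_set _ ?_
      rintro _ ⟨P, hP, rfl⟩ 𝓑 h𝓑 hlow hhigh
      have hPE : P ⊆ E := hP.trans Set.sdiff_subset
      have hWE : W \ E ⊆ W \ P := Set.sdiff_subset_sdiff_right hPE
      have hWE' : W \ E ⊆ (W \ P) \ O := fun x hx => ⟨hWE hx, fun hxO => hx.2 (hOE hxO)⟩
      -- A translate of `W \ P'` covering all of `W \ P` except `O` is a translate under the
      -- stabilizer of `W`, and it can omit no edge of `E \ O` outside `P`.
      have hstab : ∀ (g : G) (P' : Set Q.V), P' ⊆ E \ O → W \ E ⊆ g • (W \ P') →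
          (W \ P) \ O ⊆ g • (W \ P') → g • W = W ∧ g • P' ⊆ P := by
        intro g P' hP' h1 h2
        have hgW : g • W = W := h.translate g (h1.trans (Set.smul_set_mono Set.sdiff_subset))
        refine ⟨hgW, ?_⟩
        rintro _ ⟨x, hx, rfl⟩
        have hxE : g • x ∈ E := by
          rw [← h.smul_eq g hgW]
          exact Set.smul_mem_smul_set (hP' hx).1
        have hxO : g • x ∉ O := by
          rw [← hgO g hgW, Set.smul_mem_smul_set_iff]
          exact (hP' hx).2
        by_contra hxP
        have h3 := h2 ⟨⟨h.subset hxE, hxP⟩, hxO⟩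
        rw [Set.smul_mem_smul_set_iff] at h3
        exact h3.2 hx
      -- Under the stabilizer of `W \ P` the set `O` may split again, so the base case need not
      -- apply; the induction works because `O` is a proper subset of `E`.
      refine ih _ hlt (W := W \ P) (E := O) ?_ ⟨e, 1, one_smul G W, one_smul G e⟩ rfl
      refine ⟨fun x hx => ⟨h.subset (hOE hx), fun hxP => (hP hxP).2 hx⟩, ?_, ?_, ?_, ?_, ?_, ?_, ?_⟩
      · intro g hg
        refine hgO g (h.translate g ?_)
        calc W \ E ⊆ W \ P := hWE
          _ = g • (W \ P) := hg.symm
          _ ⊆ g • W := Set.smul_set_mono Set.sdiff_subset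
      · intro P' hP'
        rw [Set.sdiff_sdiff]
        exact h.isTree _ (Set.union_subset hPE (hP'.trans hOE))
      · intro x hx
        obtain ⟨t, ht, htx⟩ := h.exists_rel x (hOE hx)
        exact ⟨t, fun y hy => hWE' (ht y hy), htx⟩
      · intro x hx
        obtain ⟨y, hy, hyx⟩ := h.exists_not_desc x (hOE hx)
        exact ⟨y, hWE' hy, hyx⟩
      · intro V m hm hmW hcon
        by_cases hr : Reflects m
        · obtain ⟨x, ⟨⟨hxW, hxP⟩, hxO⟩, hxm⟩ := Set.not_subset.1 (hcon.resolve_right (not_not.2 hr))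
          by_cases hxE : x ∈ E
          -- A face that misses `x` in `E \ O` lies in the tree with one more edge removed, which
          -- has been attached already.
          · refine Or.inr ⟨W \ insert x P, hlow _ ⟨_, ?_, rfl⟩ ?_, 1, fun v => ?_⟩
            · exact Set.insert_subset ⟨hxE, hxO⟩ hP
            · refine Set.ncard_lt_ncard ⟨Set.sdiff_subset_sdiff_right (Set.subset_insert x P),
                fun hcon => ?_⟩ (Set.toFinite _)
              exact (hcon ⟨hxW, hxP⟩).2 (Set.mem_insert x P)
            · rw [one_smul]
              refine ⟨(hmW v).1, ?_⟩
              rintro (hv | hv)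
              · exact hxm ⟨v, hv⟩
              · exact (hmW v).2 hv
          · exact Or.inl (h.mem_of_face V m hm (fun v => (hmW v).1)
              (Or.inl fun hsub => hxm (hsub ⟨hxW, hxE⟩)))
        · exact Or.inl (h.mem_of_face V m hm (fun v => (hmW v).1) (Or.inr hr))
      · rintro U f hfW hsub hfull (hfA | ⟨W', hW', g, hf⟩)
        · exact h.not_mem U f (fun u => (hfW u).1) (hWE'.trans hsub) hfull hfA
        · obtain ⟨P', hP', rfl⟩ := h𝓑 hW'
          obtain ⟨hle, hne⟩ := hhigh _ hW'
          have hr : (W \ P) \ O ⊆ g • (W \ P') := by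
            intro x hx
            obtain ⟨u, rfl⟩ := hsub hx
            exact hf u
          obtain ⟨hgW, hgP⟩ := hstab g P' hP' (hWE'.trans hr) hr
          -- The translate contains `W \ P` and is no larger, so the two coincide; but translates of
          -- `W \ P` are excluded from `𝓑`.
          have h1 : W \ P ⊆ g • (W \ P') := by
            rw [Set.smul_set_sdiff, hgW]
            exact Set.sdiff_subset_sdiff_right hgP
          have h2 := Set.eq_of_subset_of_ncard_le h1 (by rwa [Set.ncard_smul_set])
            (Set.toFinite _)
          exact hne g⁻¹ (by rw [h2, inv_smul_smul])
      · intro g hg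
        obtain ⟨hgW, hgP⟩ := hstab g P hP (hWE'.trans hg) hg
        have := Set.eq_of_subset_of_ncard_le hgP (by rw [Set.ncard_smul_set]) (Set.toFinite _)
        rw [Set.smul_set_sdiff, hgW, this]
    refine hfil.trans (anodyne_of_iff fun f => or_congr Iff.rfl ⟨?_, ?_⟩)
    · rintro ⟨_, ⟨P, -, rfl⟩, g, hf⟩
      exact ⟨W, rfl, g, fun u => Set.smul_set_mono Set.sdiff_subset (hf u)⟩
    · rintro ⟨_, rfl, g, hf⟩
      exact ⟨_, ⟨∅, Set.empty_subset _, Set.sdiff_empty.symm⟩, g, hf⟩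

end GSieve

/-! ### Tensor products with linear trees -/

section TensorLinear

variable {P U : PreBroad} {n : ℕ}

/-- The projection `P ⊗ [n] ⟶ P`. -/
def tensFst (P : PreBroad) (n : ℕ) : tens P (linear n) ⟶ P :=
  tensLift (fun p => p.1) (fun s a t h => by simpa using h) (by
    rintro a s t ⟨i, hi, rfl⟩
    simpa using P.str.refl a)

theorem TensorRel.level_le {s : Multiset (P × linear n)} {e : P × linear n}
    (h : TensorRel P (linear n) s e) :
    ∀ x ∈ s, @LE.le (Fin (n + 1)) _ x.2 e.2 := by
  induction h with
  | refl e =>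
    intro x hx
    rw [Multiset.mem_singleton.1 hx]
  | left s a t h =>
    intro x hx
    obtain ⟨y, -, rfl⟩ := Multiset.mem_map.1 hx
    exact le_rfl
  | right a s t h =>
    obtain ⟨i, hi, rfl⟩ := h
    intro x hx
    obtain ⟨y, hy, rfl⟩ := Multiset.mem_map.1 hx
    obtain rfl := Multiset.mem_singleton.1 hy
    exact hi
  | trans s e hs he ih1 ih2 =>
    intro x hx
    obtain ⟨c, hc, hxc⟩ := Multiset.mem_join.1 hx
    obtain ⟨p, hp, rfl⟩ := Multiset.mem_map.1 hc
    exact (ih1 p hp x hxc).trans (ih2 _ (Multiset.mem_map_of_mem _ hp))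

/-- For the converse, first apply the relation of `P` at the level of the output, then lower each
input separately to its own level. -/
theorem tens_rel_iff {s : Multiset (P × Fin (n + 1))} {e : P × Fin (n + 1)} :
    (tens P (linear n)).rel s e ↔ P.rel (s.map Prod.fst) e.1 ∧ ∀ x ∈ s, x.2 ≤ e.2 := by
  constructor
  · intro h
    exact ⟨(tensFst P n).map_rel s e h, TensorRel.level_le h⟩
  · rintro ⟨h1, h2⟩
    obtain ⟨a, t⟩ := e
    have h3 : (tens P (linear n)).rel (s.map fun x => (x.1, t)) (a, t) := by
      have := TensorRel.left (T := linear n) _ _ t h1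
      rwa [Multiset.map_map] at this
    refine rel_of_leTuple ?_ h3
    have h4 := leTuple_map (P := tens P (linear n)) (fun x : P × Fin (n + 1) => x)
      (fun x => (x.1, t)) s fun x hx => by
        have := TensorRel.right (T := linear n) x.1 {x.2} t ⟨x.2, h2 x hx, rfl⟩
        rwa [Multiset.map_singleton] at this
    rwa [Multiset.map_id'] at h4

theorem tens_desc {x e : tens P (linear n)} (h : (tens P (linear n)).Desc x e) :
    P.Desc x.1 e.1 ∧ x.2 ≤ e.2 := by
  refine ⟨(tensFst P n).map_desc h, ?_⟩
  obtain ⟨s, hs, h⟩ := h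
  exact (tens_rel_iff.1 h).2 x hs

/-- The tensor product is in general not nodal: an edge over `1` can have both a unary vertex and a
vertex from `P` directly below it. Separatedness is what survives, and it suffices for image
factorizations. -/
theorem isSeparated_tens (hP : P.IsSeparated) : (tens P (linear n)).IsSeparated := by
  refine ⟨fun e f h1 h2 => ?_, fun s e h => ?_⟩
  · obtain ⟨h1, h1'⟩ := tens_rel_iff.1 h1
    obtain ⟨h2, h2'⟩ := tens_rel_iff.1 h2
    exact Prod.ext (hP.antisymm _ _ (by simpa using h1) (by simpa using h2))
      (le_antisymm (h1' _ (Multiset.mem_singleton_self _)) (h2' _ (Multiset.mem_singleton_self _)))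
  · exact (hP.simple _ _ (tens_rel_iff.1 h).1).of_map _

/-- The map to `P ⊗ [n]` with given components. -/
def tensPair (φ : U ⟶ P) (χ : U → Fin (n + 1)) (hχ : ∀ a b, U.Desc a b → χ a ≤ χ b) :
    U ⟶ tens P (linear n) :=
  Hom.mk (fun u => (φ.toFun u, χ u)) fun s e h => by
    refine tens_rel_iff.2 ⟨?_, fun x hx => ?_⟩
    · have := φ.map_rel _ _ h
      rwa [Multiset.map_map]
    · obtain ⟨y, hy, rfl⟩ := Multiset.mem_map.1 hx
      exact hχ y e (desc_of_rel h hy)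

theorem level_le (f : U ⟶ tens P (linear n)) {a b : U} (h : U.Desc a b) :
    (f.toFun a).2 ≤ (f.toFun b).2 :=
  (tens_desc (f.map_desc h)).2

end TensorLinear

/-! ### Full and reflecting maps -/

section Full

variable {U V P Q : PreBroad}

theorem Reflects.exists_lift {c : P ⟶ Q} (hc : Reflects c) (f : U ⟶ Q)
    (h : ∀ u, f.toFun u ∈ Set.range c.toFun) : ∃ f' : U ⟶ P, f' ≫ c = f := by
  choose f' hf' using h
  refine ⟨Hom.mk f' fun s e hs => hc _ _ ?_, PreBroad.hom_ext hf'⟩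
  rw [Multiset.map_map, hf']
  simpa only [Function.comp_def, hf'] using f.map_rel _ _ hs

theorem isFull_of_section {f : U ⟶ Q} {d : U ⟶ V} {m : V ⟶ Q} (σ : V ⟶ U) (hdm : d ≫ m = f)
    (hσ : ∀ v, d.toFun (σ.toFun v) = v) (hm : Reflects m) : IsFull f := by
  subst hdm
  intro s u hs
  refine ⟨_, _, σ.map_rel _ _ (hm (s.map d.toFun) (d.toFun u) ?_), ?_, ?_⟩
  · rwa [Multiset.map_map]
  · simp [Multiset.map_map, hσ]
  · simp [hσ]

theorem IsFull.comp {f : U ⟶ P} (hf : IsFull f) {c : P ⟶ Q} (hc : Reflects c) :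
    IsFull (f ≫ c) := by
  intro s u hs
  obtain ⟨t, v, h, h1, h2⟩ := hf s u (hc _ _ (by rwa [Multiset.map_map]))
  refine ⟨t, v, h, ?_, congrArg c.toFun h2⟩
  have := congrArg (Multiset.map c.toFun) h1
  rwa [Multiset.map_map, Multiset.map_map] at this

theorem isIso_of_reflects {f : U ⟶ P} (hf : Function.Bijective f.toFun) (h : Reflects f) :
    IsIso f := by
  obtain ⟨g, hg⟩ := h.exists_lift (𝟙 P) fun p => hf.2 p
  have hg' : ∀ p, f.toFun (g.toFun p) = p := fun p =>
    congrArg (fun k : P ⟶ P => k.toFun p) hg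
  exact ⟨g, PreBroad.hom_ext fun u => hf.1 (hg' (f.toFun u)), hg⟩

theorem leTuple_map_split {α : Type} (f : α → P) (t : Multiset α) (w : Multiset P)
    (h : P.LeTuple (t.map f) w) : ∃ s : Multiset (Multiset α × P),
      (s.map Prod.fst).sum = t ∧ s.map Prod.snd = w ∧ ∀ p ∈ s, P.rel (p.1.map f) p.2 := by
  obtain ⟨s, hs, hst, rfl⟩ := h
  induction s using Multiset.induction generalizing t with
  | empty => exact ⟨0, (Multiset.map_eq_zero.1 hst.symm).symm, rfl, by simp⟩
  | cons p s ih =>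
    rw [Multiset.map_cons, Multiset.sum_cons] at hst
    obtain ⟨t₁, t₂, rfl, h1, h2⟩ := exists_split f t _ _ hst.symm
    obtain ⟨s', h3, h4, h5⟩ := ih t₂ (fun q hq => hs q (by simp [hq])) h2.symm
    refine ⟨(t₁, p.2) ::ₘ s', by simp [h3], by simp [h4], ?_⟩
    intro q hq
    rcases Multiset.mem_cons.1 hq with rfl | hq
    · rw [h1]
      exact hs p (by simp)
    · exact h5 q hq

end Full

/-! ### Broad subposets of `P ⊗ [1]` attached to lower sets -/

section LowerSets

variable {P : PreBroad}

/-- Sets of edges closed under descendants. -/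
def IsLower (D : Set P) : Prop := ∀ a b, P.Desc a b → b ∈ D → a ∈ D

/-- The edges of the subtree of `P ⊗ [1]` whose part over `0` is the lower set `D`, and in which
exactly the maximal edges of `D` occur over both `0` and `1`. -/
def cellEdges (D : Set P) : Set (tens P (linear 1)) :=
  {p | (p.2 = 0 ∧ p.1 ∈ D) ∨ (p.2 = 1 ∧ ∀ b ∈ D, P.Desc p.1 b → b = p.1)}

/-- The edges over `1` above the maximal edges of `D`. -/
def hornEdges (D : Set P) : Set (tens P (linear 1)) :=
  {p | p.2 = 1 ∧ p.1 ∈ D ∧ ∀ b ∈ D, P.Desc p.1 b → b = p.1}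

theorem fin_two_cases (i : Fin 2) : i = 0 ∨ i = 1 := by
  fin_cases i <;> simp

variable {D : Set P}

/-- The core contains each edge of `P` once, at level `0` or `1` according to membership in `D`. -/
theorem mem_cell_diff_horn (hD : IsLower D) {p : tens P (linear 1)} :
    p ∈ cellEdges D \ hornEdges D ↔ (p.2 = 0 ∧ p.1 ∈ D) ∨ (p.2 = 1 ∧ p.1 ∉ D) := by
  constructor
  · rintro ⟨h | h, h'⟩
    · exact Or.inl h
    · exact Or.inr ⟨h.1, fun hp => h' ⟨h.1, hp, h.2⟩⟩
  · rintro (h | h)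
    · refine ⟨Or.inl h, fun h' => ?_⟩
      rw [h'.1] at h
      exact one_ne_zero h.1
    · exact ⟨Or.inr ⟨h.1, fun b hb hpb => absurd (hD _ _ hpb hb) h.2⟩, fun h' => h.2 h'.2.1⟩

/-- An edge of the cell is a horn edge when both of its levels occur. This refers to the cell alone,
so the stabilizer of the cell preserves the horn edges. -/
theorem mem_horn_iff {p : tens P (linear 1)} :
    p ∈ hornEdges D ↔ p ∈ cellEdges D ∧ p.2 = 1 ∧ (p.1, (0 : Fin 2)) ∈ cellEdges D := by
  constructor
  · rintro ⟨h1, h2, h3⟩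
    exact ⟨Or.inr ⟨h1, h3⟩, h1, Or.inl ⟨rfl, h2⟩⟩
  · rintro ⟨h1 | h1, h2, h3 | h3⟩
    · rw [h2] at h1
      exact absurd h1.1 one_ne_zero
    · exact absurd h3.1 zero_ne_one
    · exact ⟨h2, h3.2, h1.2⟩
    · exact absurd h3.1 zero_ne_one

theorem mem_of_mem_cell_zero {a : P} (h : ((a, (0 : Fin 2)) : tens P (linear 1)) ∈ cellEdges D) :
    a ∈ D := by
  rcases h with h | h
  · exact h.2
  · exact absurd h.1 zero_ne_one

theorem eq_of_mem_cell_one {a : P} (h : ((a, (1 : Fin 2)) : tens P (linear 1)) ∈ cellEdges D)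
    {b : P} (hb : b ∈ D) (hab : P.Desc a b) : b = a := by
  rcases h with h | h
  · exact absurd h.1 one_ne_zero
  · exact h.2 b hb hab

open Classical in
/-- The top lift of an edge of `P` to the subtree obtained from `cellEdges D` by removing `E`. -/
noncomputable def topLift (D : Set P) (E : Set (tens P (linear 1))) (x : P) : tens P (linear 1) :=
  if ((x, (1 : Fin 2)) : tens P (linear 1)) ∈ cellEdges D \ E then (x, 1) else (x, 0)

theorem topLift_fst (E : Set (tens P (linear 1))) (x : P) : (topLift D E x).1 = x := by
  unfold topLift
  split_ifs <;> rfl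

theorem topLift_mem (hD : IsLower D) {E : Set (tens P (linear 1))} (hE : E ⊆ hornEdges D) (x : P) :
    topLift D E x ∈ cellEdges D \ E := by
  unfold topLift
  split_ifs with h
  · exact h
  · have hx : x ∈ D := by
      by_contra hx
      have := (mem_cell_diff_horn hD (p := (x, (1 : Fin 2)))).2 (Or.inr ⟨rfl, hx⟩)
      exact h ⟨this.1, fun hxE => this.2 (hE hxE)⟩
    have := (mem_cell_diff_horn hD (p := (x, (0 : Fin 2)))).2 (Or.inl ⟨rfl, hx⟩)
    exact ⟨this.1, fun hxE => this.2 (hE hxE)⟩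

/-- The tree is `P` with a unary vertex inserted at each horn edge that is kept. A vertex of `P`
lifts by taking the highest available edge over each input. -/
theorem isTree_restrict_cell (hP : P.IsTree) (hD : IsLower D) {r : P} (hr : ∀ e, P.Desc e r)
    (hrD : r ∉ D) {E : Set (tens P (linear 1))} (hE : E ⊆ hornEdges D) :
    ((tens P (linear 1)).restrict (cellEdges D \ E)).IsTree := by
  have hsep : (tens P (linear 1)).IsSeparated := isSeparated_tens hP.isSeparated
  have := hP.finite
  let R := (tens P (linear 1)).restrict (cellEdges D \ E)
  let τ : P → R := fun x => ⟨topLift D E x, topLift_mem hD hE x⟩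
  have hτ : ∀ x, (τ x).1.1 = x := topLift_fst E
  have hrel : ∀ (s : Multiset R) (e : R),
      R.rel s e ↔ P.rel (s.map fun x => x.1.1) e.1.1 ∧ ∀ x ∈ s, x.1.2 ≤ e.1.2 := by
    intro s e
    refine tens_rel_iff.trans (and_congr (iff_of_eq (congrArg (P.rel · e.1.1)
      (Multiset.map_map _ _ _))) ⟨fun h x hx => h _ (Multiset.mem_map_of_mem _ hx), fun h x hx => ?_⟩)
    obtain ⟨y, hy, rfl⟩ := Multiset.mem_map.1 hx
    exact h y hy
  -- Lifts by `τ` are maximal: an edge over `1` below some `y` in `D` forces `y` to be its own first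
  -- coordinate, by the definition of the cell.
  have hlev : ∀ (x : R) (y : P), P.Desc x.1.1 y → x.1.2 ≤ (τ y).1.2 := by
    intro x y hxy
    change x.1.2 ≤ (topLift D E y).2
    unfold topLift
    split_ifs with h
    · exact Fin.le_last _
    · rcases fin_two_cases x.1.2 with hx | hx
      · exact hx.le
      · exfalso
        have hyD : y ∈ D := by
          by_contra hy
          have := (mem_cell_diff_horn hD (p := (y, (1 : Fin 2)))).2 (Or.inr ⟨rfl, hy⟩)
          exact h ⟨this.1, fun hxE => this.2 (hE hxE)⟩
        have hx' : x.1 = (x.1.1, (1 : Fin 2)) := Prod.ext rfl hx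
        have hm := x.2
        rw [hx'] at hm
        have := eq_of_mem_cell_one hm.1 hyD hxy
        exact h (this ▸ hm)
  refine ⟨⟨inferInstanceAs (Finite {p : P × Fin 2 // p ∈ cellEdges D \ E}), ?_, ?_, ?_⟩, ?_⟩
  · intro e f h1 h2
    exact Subtype.ext (hsep.antisymm e.1 f.1 h1 h2)
  · intro s e h
    exact (hsep.simple _ _ h).of_map _
  · rintro e
    apply nodal_of_leaf_or_maxBelow
    -- Horn edges that are kept are the only edges failing this. At all others the vertex is lifted
    -- from `P`; at a kept horn edge it is the unary vertex down to level `0`.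
    by_cases hcase : e.1.2 = 0 ∨ e.1.1 ∉ D
    · have hsing : ∀ s : Multiset R, R.rel s e → s.map (fun x => x.1.1) = {e.1.1} → s = {e} := by
        intro s hs h
        obtain ⟨x, rfl, hx⟩ := Multiset.map_eq_singleton.1 h
        refine congrArg _ (Subtype.ext (Prod.ext hx ?_))
        have hle := ((hrel _ _).1 hs).2 x (Multiset.mem_singleton_self x)
        rcases hcase with h0 | h1
        · rw [h0] at hle ⊢
          exact Fin.le_zero_iff.1 hle
        · rcases x.2.1 with h2 | h2
          · exact absurd (hx ▸ h2.2) h1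
          · rcases e.2.1 with h3 | h3
            · exact absurd h3.2 h1
            · rw [h2.1, h3.1]
      rcases hP.leaf_or_maxBelow e.1.1 with hl | ⟨w, h1, h2, h3⟩
      · exact Or.inl fun s hs => hsing s hs (hl _ ((hrel _ _).1 hs).1)
      · refine Or.inr ⟨w.map τ, ?_, ?_, ?_⟩
        · rw [hrel, Multiset.map_map]
          refine ⟨by simpa [Function.comp_def, hτ] using h1, fun x hx => ?_⟩
          obtain ⟨y, hy, rfl⟩ := Multiset.mem_map.1 hx
          rcases hcase with h0 | h0
          · rcases fin_two_cases (τ y).1.2 with h4 | h4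
            · rw [h4]; exact Fin.zero_le _
            · exfalso
              have hm := (τ y).2.1
              have hy' : (τ y).1 = (y, (1 : Fin 2)) := Prod.ext (hτ y) h4
              rw [hy'] at hm
              have heD : e.1.1 ∈ D := by
                rcases e.2.1 with h5 | h5
                · exact h5.2
                · exact absurd (h0.symm.trans h5.1) zero_ne_one
              have := eq_of_mem_cell_one hm heD (desc_of_rel h1 hy)
              exact hP.isSeparated.ne_of_mem_maxBelow ⟨h1, h2, h3⟩ hy this.symm
          · rcases e.2.1 with h5 | h5
            · exact absurd h5.2 h0
            · rw [h5.1]; exact Fin.le_last _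
        · intro h
          apply h2
          have := congrArg (Multiset.map fun x : R => x.1.1) h
          rw [Multiset.map_map] at this
          simpa [Function.comp_def, hτ] using this
        · intro g hg hne
          obtain ⟨s, rfl, rfl, hs⟩ := leTuple_map_split (fun x : R => x.1.1) g w
            (h3 _ ((hrel _ _).1 hg).1 fun h => hne (hsing g hg h))
          refine ⟨s.map fun p => (p.1, τ p.2), ?_, ?_, ?_⟩
          · intro p hp
            obtain ⟨q, hq, rfl⟩ := Multiset.mem_map.1 hp
            refine (hrel _ _).2 ⟨by simpa only [hτ] using hs q hq, fun x hx => hlev x _ ?_⟩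
            exact desc_of_rel (hs q hq) (Multiset.mem_map_of_mem _ hx)
          · rw [Multiset.map_map]
            rfl
          · rw [Multiset.map_map, Multiset.map_map]
            rfl
    · push Not at hcase
      have he1 : e.1.2 = 1 := (fin_two_cases e.1.2).resolve_left hcase.1
      have he : e.1 = (e.1.1, (1 : Fin 2)) := Prod.ext rfl he1
      have h0 := (mem_cell_diff_horn hD (p := (e.1.1, (0 : Fin 2)))).2 (Or.inl ⟨rfl, hcase.2⟩)
      let e₀ : R := ⟨(e.1.1, (0 : Fin 2)), h0.1, fun h => h0.2 (hE h)⟩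
      refine Or.inr ⟨{e₀}, ?_, ?_, ?_⟩
      · rw [hrel]
        exact ⟨P.str.refl e.1.1, fun x hx => by
          rw [Multiset.mem_singleton.1 hx]
          exact Fin.zero_le _⟩
      · intro h
        have := congrArg (fun x : R => x.1.2) (Multiset.singleton_inj.1 h)
        exact zero_ne_one (this.trans he1)
      · intro g hg hne
        rw [leTuple_singleton, hrel]
        refine ⟨((hrel _ _).1 hg).1, fun x hx => ?_⟩
        rcases x.2.1 with h1 | h1
        · exact h1.1.le
        · exfalso
          have h2 := h1.2 _ hcase.2 (desc_of_rel ((hrel _ _).1 hg).1 (Multiset.mem_map_of_mem _ hx))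
          have hxe : x = e := Subtype.ext (Prod.ext h2.symm (h1.1.trans he1.symm))
          subst hxe
          obtain ⟨t, rfl⟩ := Multiset.exists_cons_of_mem hx
          have h3 := ((hrel _ _).1 hg).1
          rw [Multiset.map_cons] at h3
          have := Multiset.map_eq_zero.1 (hP.isSeparated.eq_zero h3)
          subst this
          exact hne rfl
  · have hr1 := (mem_cell_diff_horn hD (p := (r, (1 : Fin 2)))).2 (Or.inr ⟨rfl, hrD⟩)
    refine ⟨⟨(r, 1), hr1.1, fun h => hr1.2 (hE h)⟩, fun e => ?_⟩
    obtain ⟨t, ht⟩ := (hr e.1.1).exists_rel_cons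
    refine ⟨e ::ₘ t.map τ, Multiset.mem_cons_self _ _, (hrel _ _).2 ⟨?_, fun x _ => Fin.le_last _⟩⟩
    rw [Multiset.map_cons, Multiset.map_map]
    simpa [Function.comp_def, hτ] using ht

/-! ### Dendrices of P ⊗ [1], sorted by cells -/

/-- The injective part of the image factorization must be invertible, so the bottom edges of the
fibres give a section over all of `P`. -/
theorem exists_section_of_not_mem_boundary (hP : P.IsTree) {U : Omega} {φ : U.toPre ⟶ P}
    (hφ : φ ∉ (boundary P).obj (op U)) :
    ∃ σ : P ⟶ U.toPre, (∀ a, φ.toFun (σ.toFun a) = a) ∧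
      ∀ u, U.toPre.rel {σ.toFun (φ.toFun u)} u := by
  obtain ⟨V, d, m, σ, rfl, hm, hσ, hσ'⟩ := U.toPre_isTree.exists_image hP.isSeparated φ
  have : IsIso m := by
    by_contra h
    exact hφ ⟨V, m, d, hm, h, rfl⟩
  have h1 : ∀ a, m.toFun ((inv m).toFun a) = a := fun a => iso_inv_hom (asIso m) a
  have h2 : ∀ v, (inv m).toFun (m.toFun v) = v := fun v => iso_hom_inv (asIso m) v
  refine ⟨inv m ≫ σ, fun a => ?_, fun u => ?_⟩
  · simp only [comp_toFun, hσ, h1]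
  · simp only [comp_toFun, h2]
    exact hσ' u

theorem mem_boundary_or_of_face (hP : P.IsTree) (hD : IsLower D) {V : Omega}
    (m : V.toPre ⟶ tens P (linear 1)) (hm : Function.Injective m.toFun)
    (hmD : ∀ v, m.toFun v ∈ cellEdges D)
    (h : ¬ cellEdges D \ hornEdges D ⊆ Set.range m.toFun ∨ ¬ Reflects m) :
    (m ≫ tensFst P 1) ∈ (boundary P).obj (op V) ∨
      ∃ D' ⊂ D, IsLower D' ∧ ∀ v, m.toFun v ∈ cellEdges D' := by
  refine or_iff_not_imp_left.2 fun hφ => ?_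
  obtain ⟨σ, hσ, -⟩ := exists_section_of_not_mem_boundary hP hφ
  have hσ' : ∀ a, (m.toFun (σ.toFun a)).1 = a := hσ
  rcases h with h | h
  · obtain ⟨⟨a, i⟩, hp, hpm⟩ := Set.not_subset.1 h
    have hma : m.toFun (σ.toFun a) ≠ (a, i) := fun h => hpm ⟨_, h⟩
    have hmem := hmD (σ.toFun a)
    rcases (mem_cell_diff_horn hD).1 hp with ⟨rfl, ha⟩ | ⟨rfl, ha⟩
    · have h1 : m.toFun (σ.toFun a) = (a, (1 : Fin 2)) :=
        Prod.ext (hσ' a) ((fin_two_cases _).resolve_left fun h => hma (Prod.ext (hσ' a) h))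
      rw [h1] at hmem
      refine ⟨D \ {a}, ⟨Set.sdiff_subset, fun h => (h ha).2 rfl⟩, ?_, ?_⟩
      · rintro c b hcb ⟨hb, hba⟩
        refine ⟨hD c b hcb hb, ?_⟩
        rintro rfl
        exact hba (eq_of_mem_cell_one hmem hb hcb)
      · intro v
        rcases hmD v with hv | hv
        · refine Or.inl ⟨hv.1, hv.2, fun hva => hpm ⟨v, Prod.ext hva hv.1⟩⟩
        · exact Or.inr ⟨hv.1, fun b hb => hv.2 b hb.1⟩
    · exfalso
      have h1 : m.toFun (σ.toFun a) = (a, (0 : Fin 2)) :=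
        Prod.ext (hσ' a) ((fin_two_cases _).resolve_right fun h => hma (Prod.ext (hσ' a) h))
      rw [h1] at hmem
      exact ha (mem_of_mem_cell_zero hmem)
  · exfalso
    refine h fun s e hs => ?_
    obtain ⟨h1, h2⟩ := tens_rel_iff.1 hs
    rw [Multiset.map_map] at h1
    -- Reflection is automatic here: project the relation to `P`, lift it by the section, then slide
    -- it along the fibres to the required levels.
    refine V.toPre_isTree.rel_of_map_eq hP.isSeparated (m ≫ tensFst P 1)
      (fun v => (m.toFun v).2) (fun a b hab => level_le m (desc_of_rel_singleton hab))
      (fun a b h3 h4 => hm (Prod.ext h3 h4)) (σ.map_rel _ _ h1) ?_ (hσ _)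
      fun x hx => h2 _ (Multiset.mem_map_of_mem _ hx)
    rw [Multiset.map_map, Multiset.map_map]
    exact Multiset.map_congr rfl fun x _ => hσ _

/-- The core maps onto `P` and sees all its relations, so any face through which the projection
factors is surjective and reflects relations, hence is invertible. -/
theorem not_mem_boundary_of_isFull (hD : IsLower D) {U : Omega} {f : U.toPre ⟶ tens P (linear 1)}
    (hf : cellEdges D \ hornEdges D ⊆ Set.range f.toFun) (hfull : IsFull f) :
    (f ≫ tensFst P 1) ∉ (boundary P).obj (op U) := by
  classical
  rintro ⟨V, n, h, hn, hiso, hnf⟩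
  refine hiso ?_
  let ρ : P → tens P (linear 1) := fun a => if a ∈ D then (a, 0) else (a, 1)
  have hρ : ∀ a, (ρ a).1 = a := fun a => by
    simp only [ρ]
    split_ifs <;> rfl
  have hρf : ∀ a, ρ a ∈ Set.range f.toFun := fun a => by
    refine hf ((mem_cell_diff_horn hD).2 ?_)
    by_cases ha : a ∈ D
    · simp [ρ, ha]
    · simp [ρ, ha]
  have hnh : ∀ u, n.toFun (h.toFun u) = (f.toFun u).1 := fun u =>
    congrArg (fun k : U.toPre ⟶ P => k.toFun u) hnf
  refine isIso_of_reflects ⟨hn, fun a => ?_⟩ fun s e hs => ?_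
  · obtain ⟨u, hu⟩ := hρf a
    exact ⟨h.toFun u, by rw [hnh, hu, hρ]⟩
  · obtain ⟨t, ht⟩ := exists_map_eq f.toFun ((s.map n.toFun).map ρ) fun x hx => by
      obtain ⟨y, -, rfl⟩ := Multiset.mem_map.1 hx
      exact hρf y
    obtain ⟨u, hu⟩ := hρf (n.toFun e)
    obtain ⟨t', u', h1, h2, h3⟩ := hfull t u (by
      rw [ht, hu]
      refine tens_rel_iff.2 ⟨?_, fun x hx => ?_⟩
      · rw [Multiset.map_map, hρ]
        simpa only [Function.comp_def, hρ, Multiset.map_id'] using hs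
      · obtain ⟨y, hy, rfl⟩ := Multiset.mem_map.1 hx
        by_cases he : n.toFun e ∈ D
        · simp [ρ, he, hD _ _ (desc_of_rel hs hy) he]
        · simp only [ρ, he, if_false]
          exact Fin.le_last _)
    have h4 := h.map_rel _ _ h1
    have h5 : h.toFun u' = e := hn (by rw [hnh, h3, hu, hρ])
    have h6 : t'.map h.toFun = s := by
      refine Multiset.map_injective hn ?_
      have := congrArg (Multiset.map Prod.fst) (h2.trans ht)
      simp only [Multiset.map_map, Function.comp_def, hρ] at this
      rw [Multiset.map_map]
      simpa only [Function.comp_def, hnh] using this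
    rwa [h5, h6] at h4

/-- A map to `P ⊗ [1]` that is surjective enough over `P` has image in one of the subtrees attached
to lower sets. -/
theorem exists_isLower_of_not_mem_boundary (hP : P.IsTree) {U : Omega}
    {f : U.toPre ⟶ tens P (linear 1)} (hf : (f ≫ tensFst P 1) ∉ (boundary P).obj (op U)) :
    ∃ D : Set P, IsLower D ∧ ∀ u, f.toFun u ∈ cellEdges D := by
  obtain ⟨σ, hσ, hσ'⟩ := exists_section_of_not_mem_boundary hP hf
  have hσ₁ : ∀ a, (f.toFun (σ.toFun a)).1 = a := hσ
  have hlow : ∀ u, (f.toFun u).2 = 0 → (f.toFun (σ.toFun (f.toFun u).1)).2 = 0 := fun u hu => by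
    have := level_le f (desc_of_rel_singleton (hσ' u))
    rw [hu] at this
    exact Fin.le_zero_iff.1 this
  -- `D` consists of the edges of `P` whose bottom lift along `f` is at level `0`.
  refine ⟨{a | (f.toFun (σ.toFun a)).2 = 0}, fun a b hab hb => ?_, fun u => ?_⟩
  · have := level_le f (σ.map_desc hab)
    rw [show (f.toFun (σ.toFun b)).2 = 0 from hb] at this
    exact Fin.le_zero_iff.1 this
  · rcases fin_two_cases (f.toFun u).2 with hu | hu
    · exact Or.inl ⟨hu, hlow u hu⟩
    · refine Or.inr ⟨hu, fun b hb hub => ?_⟩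
      have h1 := σ.map_desc hub
      -- Both `u` and `σ b` lie above the bottom edge of the fibre of `u`, so they are comparable.
      -- Levels rule out that `u` is below `σ b`, and the other case gives `b = (f u).1`.
      rcases U.toPre_isTree.desc_or_desc (desc_of_rel_singleton (hσ' u)) h1 with h2 | h2
      · have := level_le f h2
        rw [hu, show (f.toFun (σ.toFun b)).2 = 0 from hb] at this
        exact absurd (Fin.le_zero_iff.1 this) one_ne_zero
      · have h3 := (tens_desc (f.map_desc h2)).1
        rw [hσ₁] at h3
        exact hP.isSeparated.desc_antisymm h3 hub

end LowerSets

/-! ### The filtration of `S ⊗ [1]` -/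

section Filtration

/-- The tensor product `S ⊗ [n]` with the action of `G` induced from `S`. -/
def tensLinG (S : Action PreBroad G) (n : ℕ) : Action PreBroad G where
  V := tens S.V (linear n)
  ρ :=
    { toFun := fun g => tensMap (S.ρ g) (𝟙 (linear n))
      map_one' := by
        rw [map_one]
        exact tensMap_id S.V (linear n)
      map_mul' := fun g h => by
        rw [map_mul]
        exact tensMap_comp (S.ρ h) (S.ρ g) (𝟙 _) (𝟙 _) }

variable {S : Action PreBroad G}

theorem tensLinG_smul {n : ℕ} (g : G) (p : (tensLinG S n).V) :
    g • p = ((g • p.1, p.2) : S.V × Fin (n + 1)) := rfl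

theorem desc_smul_iff {Q : Action PreBroad G} (g : G) {a b : Q.V} :
    Q.V.Desc (g • a) (g • b) ↔ Q.V.Desc a b := by
  refine ⟨fun h => ?_, (actIso Q g).hom.map_desc⟩
  have := (actIso Q g⁻¹).hom.map_desc h
  rwa [actIso_toFun, actIso_toFun, inv_smul_smul, inv_smul_smul] at this

theorem desc_inv_smul_iff {Q : Action PreBroad G} (g : G) {a b : Q.V} :
    Q.V.Desc (g⁻¹ • a) b ↔ Q.V.Desc a (g • b) := by
  rw [← desc_smul_iff g, smul_inv_smul]

/-- The set `cellEdges D` in `S ⊗ [1]` with its action of `G`. -/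
def cellG (D : Set S.V) : Set (tensLinG S 1).V := cellEdges D

/-- The set `hornEdges D` in `S ⊗ [1]` with its action of `G`. -/
def hornEdgesG (D : Set S.V) : Set (tensLinG S 1).V := hornEdges D

theorem smul_cellG (g : G) (D : Set S.V) : g • cellG D = cellG (g • D) := by
  ext p
  rw [Set.mem_smul_set_iff_inv_smul_mem, tensLinG_smul]
  change (p.2 = 0 ∧ g⁻¹ • p.1 ∈ D ∨ p.2 = 1 ∧ ∀ b ∈ D, S.V.Desc (g⁻¹ • p.1) b → b = g⁻¹ • p.1) ↔
    (p.2 = 0 ∧ p.1 ∈ g • D ∨ p.2 = 1 ∧ ∀ b ∈ g • D, S.V.Desc p.1 b → b = p.1)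
  refine or_congr (and_congr Iff.rfl Set.mem_smul_set_iff_inv_smul_mem.symm)
    (and_congr Iff.rfl ⟨?_, ?_⟩)
  · rintro h _ ⟨b, hb, rfl⟩ hpb
    have := h b hb ((desc_inv_smul_iff g).2 hpb)
    exact eq_inv_smul_iff.1 this
  · intro h b hb hpb
    exact eq_inv_smul_iff.2 (h _ (Set.smul_mem_smul_set hb) ((desc_inv_smul_iff g).1 hpb))

theorem IsLower.smul {D : Set S.V} (hD : IsLower D) (g : G) : IsLower (g • D) := by
  intro a b hab hb
  rw [Set.mem_smul_set_iff_inv_smul_mem] at hb ⊢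
  exact hD _ _ ((desc_smul_iff g⁻¹).2 hab) hb

theorem smul_hornEdgesG (g : G) {D : Set S.V} (h : g • cellG D = cellG D) :
    g • hornEdgesG D = hornEdgesG D := by
  have key : ∀ p : (tensLinG S 1).V, g⁻¹ • p ∈ cellG D ↔ p ∈ cellG D := fun p => by
    rw [← Set.mem_smul_set_iff_inv_smul_mem, h]
  ext p
  rw [Set.mem_smul_set_iff_inv_smul_mem]
  refine mem_horn_iff.trans (Iff.trans ?_ mem_horn_iff.symm)
  exact and_congr (key p) (and_congr Iff.rfl (key (p.1, (0 : Fin 2))))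

/-- Level `0` of the core is `D` itself. With a count of elements this distinguishes translates of
cells from one another. -/
theorem subset_of_cell_diff_subset {D D' : Set S.V} (hD : IsLower D)
    (h : (cellEdges D \ hornEdges D : Set (tens S.V (linear 1))) ⊆ cellEdges D') : D ⊆ D' :=
  fun _ ha => mem_of_mem_cell_zero (h ((mem_cell_diff_horn hD).2 (Or.inl ⟨rfl, ha⟩)))

theorem act_mem_boundary (g : G) {U : Omega} {φ : U.toPre ⟶ S.V}
    (h : φ ∈ (boundary S.V).obj (op U)) :
    φ ≫ (actIso S g).hom ∈ (boundary S.V).obj (op U) :=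
  facesUnion_stable S _ (by
    intro g V m hm hiso
    exact hm (IsIso.of_isIso_comp_right m (actIso S g).hom)) g (op U) φ h

variable (S) in
/-- The family of dendrices of `S ⊗ [1]` in `∂Ω[S] ⊗ Ω[1] ∪ Ω[S] ⊗ {1}`. -/
def cylinderBoundary : GSieve (tensLinG S 1) where
  mem {U} f := ((f ≫ tensFst S.V 1 : U.toPre ⟶ S.V) ∈ (boundary S.V).obj (op U)) ∨
    ∀ u, (f.toFun u).2 = (1 : Fin 2)
  precomp {U V} k f h := by
    rcases h with h | h
    · exact Or.inl ((boundary S.V).map (Quiver.Hom.op (V := Omega) k) h)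
    · exact Or.inr fun u => h (k.toFun u)
  act_mem g {U} f h := by
    rcases h with h | h
    · exact Or.inl (act_mem_boundary g h)
    · exact Or.inr h

variable (hS : S.V.IsTree)

/-- The part of `S ⊗ [1]` not involving the edge over the root of `S` and over `0`. -/
def cylinderInner : GSieve (tensLinG S 1) :=
  (cylinderBoundary S).attach {W | ∃ D : Set S.V, IsLower D ∧ D.Nonempty ∧ rootEdge hS ∉ D ∧
    W = cellG D}

theorem smul_rootEdge (g : G) : g • rootEdge hS = rootEdge hS := act_rootEdge S hS g

theorem mem_cylinderBoundary_of_cell_empty {U : Omega} (f : U.toPre ⟶ tens S.V (linear 1))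
    (h : ∀ u, f.toFun u ∈ cellEdges (∅ : Set S.V)) :
    (cylinderBoundary S).mem f :=
  Or.inr fun u => (h u).elim (fun h => h.2.elim) fun h => h.1

/-- The empty lower set accounts for Ω[S] ⊗ {1}, and translates are absorbed because translates of
lower sets avoiding the fixed root are again such. -/
theorem mem_cylinderInner_iff {U : Omega} (f : U.toPre ⟶ tens S.V (linear 1)) :
    (cylinderInner hS).mem f ↔ (f ≫ tensFst S.V 1) ∈ (boundary S.V).obj (op U) ∨
      ∃ D : Set S.V, IsLower D ∧ rootEdge hS ∉ D ∧ ∀ u, f.toFun u ∈ cellEdges D := by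
  constructor
  · rintro ((h | h) | ⟨_, ⟨D, hD, -, hr, rfl⟩, g, h⟩)
    · exact Or.inl h
    · exact Or.inr ⟨∅, fun _ _ _ h => h.elim, fun h => h.elim,
        fun u => Or.inr ⟨h u, fun _ hb => hb.elim⟩⟩
    · refine Or.inr ⟨g • D, hD.smul g, fun hr' => hr ?_, fun u => ?_⟩
      · rw [← smul_rootEdge hS g] at hr'
        exact Set.smul_mem_smul_set_iff.1 hr'
      · have := h u
        rwa [smul_cellG] at this
  · rintro (h | ⟨D, hD, hr, h⟩)
    · exact Or.inl (Or.inl h)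
    · rcases D.eq_empty_or_nonempty with rfl | hne
      · exact Or.inl (mem_cylinderBoundary_of_cell_empty f h)
      · refine Or.inr ⟨_, ⟨D, hD, hne, hr, rfl⟩, 1, fun u => ?_⟩
        rw [one_smul G (cellG D)]
        exact h u

/-- The number of edges over `0`. -/
noncomputable def zeroRank (W : Set (tensLinG S 1).V) : ℕ :=
  {p ∈ W | p.2 = (0 : Fin 2)}.ncard

theorem zeroRank_smul (g : G) (W : Set (tensLinG S 1).V) : zeroRank (g • W) = zeroRank W := by
  have : {p ∈ g • W | p.2 = (0 : Fin 2)} = g • {p ∈ W | p.2 = (0 : Fin 2)} := by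
    ext p
    rw [Set.mem_smul_set_iff_inv_smul_mem]
    exact and_congr Set.mem_smul_set_iff_inv_smul_mem Iff.rfl
  rw [zeroRank, this, Set.ncard_smul_set]
  rfl

theorem zeroRank_cellG (D : Set S.V) : zeroRank (cellG D) = D.ncard := by
  have : {p ∈ (cellEdges D : Set (tens S.V (linear 1))) | p.2 = (0 : Fin 2)} =
      (fun a : S.V => (a, (0 : Fin 2))) '' D := by
    ext ⟨a, i⟩
    constructor
    · rintro ⟨h, rfl⟩
      exact ⟨a, mem_of_mem_cell_zero h, rfl⟩
    · rintro ⟨b, hb, h⟩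
      obtain ⟨rfl, rfl⟩ := Prod.ext_iff.1 h
      exact ⟨Or.inl ⟨rfl, hb⟩, rfl⟩
  change {p ∈ (cellEdges D : Set (tens S.V (linear 1))) | p.2 = (0 : Fin 2)}.ncard = _
  rw [this]
  exact Set.ncard_image_of_injective D fun a b h => (Prod.ext_iff.1 h).1

/-- All conditions independent of `A` hold once the root is not in `D`: the edge `(r, 1)` is then
outside `hornEdges D` and is not below any horn edge, so these edges are inner. -/
theorem isCell_cellG (A : GSieve (tensLinG S 1)) {D : Set S.V} (hD : IsLower D)
    (hr : rootEdge hS ∉ D)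
    (hface : ∀ (V : Omega) (m : V.toPre ⟶ tens S.V (linear 1)),
      ((m ≫ tensFst S.V 1) ∈ (boundary S.V).obj (op V) ∨
        ∃ D' ⊂ D, IsLower D' ∧ ∀ v, m.toFun v ∈ cellEdges D') → A.mem m)
    (hnot : ∀ (U : Omega) (f : U.toPre ⟶ tens S.V (linear 1)), (∀ u, f.toFun u ∈ cellEdges D) →
      cellEdges D \ hornEdges D ⊆ Set.range f.toFun → IsFull f → ¬ A.mem f) :
    A.IsCell (cellG D) (hornEdgesG D) where
  subset := fun p hp => (mem_horn_iff.1 hp).1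
  smul_eq := fun g h => smul_hornEdgesG g h
  isTree := fun P hP => isTree_restrict_cell hS hD (desc_rootEdge hS) hr hP
  exists_rel := by
    rintro ⟨a, i⟩ ⟨-, ha, -⟩
    refine ⟨{((a, (0 : Fin 2)) : S.V × Fin 2)}, fun x hx => ?_, tens_rel_iff.2 ⟨?_, fun x hx => ?_⟩⟩
    · rw [Multiset.mem_singleton.1 hx]
      exact (mem_cell_diff_horn hD).2 (Or.inl ⟨rfl, ha⟩)
    · exact S.V.str.refl a
    · rw [Multiset.mem_singleton.1 hx]
      exact Fin.zero_le _
  exists_not_desc := by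
    rintro ⟨a, i⟩ ⟨-, ha, -⟩
    refine ⟨(rootEdge hS, (1 : Fin 2)), (mem_cell_diff_horn hD).2 (Or.inr ⟨rfl, hr⟩), fun h => hr ?_⟩
    exact hD _ _ (tens_desc h).1 ha
  mem_of_face := fun V m hm hmD h => hface V m (mem_boundary_or_of_face hS hD m hm hmD h)
  not_mem := fun U f hfD hf hfull => hnot U f hfD hf hfull
  translate := by
    intro g h
    rw [smul_cellG] at h ⊢
    have := hS.finite
    have h1 := Set.eq_of_subset_of_ncard_le (subset_of_cell_diff_subset hD h)
      (by rw [Set.ncard_smul_set]) (Set.toFinite _)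
    rw [← h1]

/-- Cells are attached by increasing size of `D`, so every `W_{D'}` with `D' ⊂ D` is present when
`W_D` is reached. -/
theorem anodyne_cylinderInner : (cylinderBoundary S).Anodyne (cylinderInner hS) := by
  have := hS.finite
  have hfin : Finite (tensLinG S 1).V := inferInstanceAs (Finite (S.V × Fin 2))
  have hsep : (tensLinG S 1).V.IsSeparated := isSeparated_tens hS.isSeparated
  refine GSieve.anodyne_attach_of_filtration zeroRank zeroRank_smul _ ?_
  rintro _ ⟨D, hD, hne, hr, rfl⟩ 𝓑 h𝓑 hlow hhigh
  refine (isCell_cellG hS _ hD hr ?_ ?_).anodyne hsep ?_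
  · rintro V m (h | ⟨D', hD'D, hD', h⟩)
    · exact Or.inl (Or.inl h)
    · rcases D'.eq_empty_or_nonempty with rfl | hne'
      · exact Or.inl (mem_cylinderBoundary_of_cell_empty m h)
      · refine Or.inr ⟨_, hlow _ ⟨D', hD', hne', fun h => hr (hD'D.1 h), rfl⟩ ?_, 1, fun u => ?_⟩
        · rw [zeroRank_cellG, zeroRank_cellG]
          exact Set.ncard_lt_ncard hD'D (Set.toFinite _)
        · rw [one_smul G (cellG D')]
          exact h u
  · rintro U f hfD hf hfull ((h | h) | ⟨W, hW, g, h⟩)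
    · exact not_mem_boundary_of_isFull hD hf hfull h
    -- The core of a nonempty `D` has an edge over `0`, so `f` is not in Ω[S] ⊗ {1}.
    · obtain ⟨a, ha⟩ := hne
      obtain ⟨u, hu⟩ := hf ((mem_cell_diff_horn hD (p := (a, (0 : Fin 2)))).2 (Or.inl ⟨rfl, ha⟩))
      have := h u
      rw [hu] at this
      exact zero_ne_one this
    · obtain ⟨D', hD', -, -, rfl⟩ := h𝓑 hW
      obtain ⟨hle, hneq⟩ := hhigh _ hW
      rw [zeroRank_cellG, zeroRank_cellG] at hle
      rw [smul_cellG] at h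
      have h1 : D ⊆ g • D' := subset_of_cell_diff_subset hD fun p hp => by
        obtain ⟨u, rfl⟩ := hf hp
        exact h u
      have h2 := Set.eq_of_subset_of_ncard_le h1 (by rwa [Set.ncard_smul_set]) (Set.toFinite _)
      refine hneq g⁻¹ ?_
      rw [smul_cellG, h2, inv_smul_smul]
  -- A finite nonempty `D` has a maximal edge, and this supplies a horn edge.
  · obtain ⟨a, ha, hmax⟩ : ∃ a ∈ D, ∀ b ∈ D, S.V.Desc a b → b = a := by
      obtain ⟨a₀, ha₀⟩ := hne
      by_contra! hcon
      choose! f hf using hcon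
      let R : S.V → S.V → Prop := fun x y => S.V.Desc y x ∧ x ≠ y
      have : IsTrans S.V R := ⟨fun a b c hab hbc => ⟨hbc.1.trans hab.1, by
        rintro rfl
        exact hab.2 (hS.isSeparated.desc_antisymm hbc.1 hab.1)⟩⟩
      have : Std.Irrefl R := ⟨fun a ha => ha.2 rfl⟩
      obtain ⟨m, hm, hmin⟩ := (Finite.wellFounded_of_trans_of_irrefl R).has_min D ⟨a₀, ha₀⟩
      exact hmin (f m) (hf m hm).1 ⟨(hf m hm).2.1, (hf m hm).2.2⟩
    exact ⟨(a, (1 : Fin 2)), rfl, ha, hmax⟩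

end Filtration

/-! ### Tensor products of dendroidal sets with linear trees -/

section TensorNormalForm

/-- The element of `X ⊗ Ω[n]` given by a dendrex of `X` and a monotone map of its edges to `[n]`. -/
def tensMk (X : DSet) (n : ℕ) {U : Omega} (x : X.obj (op U)) (χ : U.toPre → Fin (n + 1))
    (hχ : ∀ a b, U.toPre.Desc a b → χ a ≤ χ b) :
    (tensorObj X (nerve.obj (linear n))).obj (op U) :=
  Quot.mk _ ⟨U, Omega.lin n, x, 𝟙 (linear n), tensPair (𝟙 U.toPre) χ hχ⟩

/-- A map `U ⟶ S ⊗ [n]` is its projection to `S` and its levels. The coend relation absorbs the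
projection into the dendrex of `X`. -/
theorem exists_eq_tensMk (X : DSet) (n : ℕ) {U : Omega}
    (z : (tensorObj X (nerve.obj (linear n))).obj (op U)) :
    ∃ x χ hχ, z = tensMk X n x χ hχ := by
  obtain ⟨S, T, x, y, h⟩ := z
  -- First `y` is moved into the map, making `[n]` itself the second tree.
  have h1 := Quot.sound (TensorGlue.mk (X := X) (Y := nerve.obj (linear n)) (S := S) (S' := S)
    (T := T) (T' := Omega.lin n) (𝟙 S) y x (𝟙 (linear n)) h)
  rw [op_id, X.map_id] at h1
  let h' : U.toPre ⟶ tens S.toPre (linear n) := h ≫ tensMap (𝟙 S.toPre) y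
  let φ : U ⟶ S := (h' ≫ tensFst S.toPre n : U.toPre ⟶ S.toPre)
  -- Then `x` is pulled back along the projection, making `U` itself the first tree.
  have h2 := Quot.sound (TensorGlue.mk (X := X) (Y := nerve.obj (linear n)) (S := U) (S' := S)
    (T := Omega.lin n) (T' := Omega.lin n) φ (𝟙 _) x (𝟙 (linear n))
    (tensPair (𝟙 U.toPre) (fun u => (h'.toFun u).2) fun _ _ => level_le h'))
  exact ⟨X.map φ.op x,
    fun u => (h'.toFun u).2, fun _ _ => level_le h', h1.trans h2.symm⟩

/-- The comparison map from `Ω[P] ⊗ Ω[T]` to the nerve of `P ⊗ T`. -/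
def tensComp (P T : PreBroad) : tensorObj (nerve.obj P) (nerve.obj T) ⟶ nerve.obj (tens P T) where
  app U := ↾(Quot.lift (fun a => a.h ≫ tensMap a.x a.y) (by
    rintro _ _ ⟨f, g, x, y, h⟩
    rfl))
  naturality U V k := by
    ext ⟨a⟩
    rfl

theorem tensPair_injective {P U : PreBroad} {n : ℕ} {φ φ' : U ⟶ P} {χ χ' : U → Fin (n + 1)}
    {hχ : ∀ a b, U.Desc a b → χ a ≤ χ b} {hχ' : ∀ a b, U.Desc a b → χ' a ≤ χ' b}
    (h : tensPair φ χ hχ = tensPair φ' χ' hχ') : φ = φ' ∧ χ = χ' :=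
  ⟨congrArg (fun k => k ≫ tensFst P n) h,
    funext fun u => congrArg (fun k : U ⟶ tens P (linear n) => (k.toFun u).2) h⟩

/-- By the normal form an element is a dendrex with levels, and both can be read off from its image.
In particular ∂Ω[S] ⊗ Ω[1] is a subobject of the nerve of S ⊗ [1]. -/
theorem tensComp_tensorMap_injective {X : DSet} {P : PreBroad} {n : ℕ} {α : X ⟶ nerve.obj P}
    (hα : ∀ U, Function.Injective (α.app U)) (U : Omegaᵒᵖ) :
    Function.Injective ((tensorMap α (𝟙 (nerve.obj (linear n))) ≫ tensComp P (linear n)).app U) := by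
  intro z z' h
  obtain ⟨x, χ, hχ, rfl⟩ := exists_eq_tensMk X n (U := U.unop) z
  obtain ⟨x', χ', hχ', rfl⟩ := exists_eq_tensMk X n (U := U.unop) z'
  obtain ⟨h1, rfl⟩ := tensPair_injective (φ := α.app U x) (φ' := α.app U x') (hχ := hχ)
    (hχ' := hχ') h
  obtain rfl := hα U h1
  rfl

/-- The comparison map, equivariantly. -/
def tensCompG (S : Action PreBroad G) (n : ℕ) :
    tensorG (nerveG.obj S) (nerveG.obj (linG G n)) ⟶ nerveG.obj (tensLinG S n) where
  hom := tensComp S.V (linear n)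
  comm g := by
    ext U ⟨a⟩
    rfl

instance (S : Action PreBroad G) (n : ℕ) : IsIso (tensCompG S n) := by
  have : ∀ U, IsIso ((tensCompG S n).hom.app U) := fun U => by
    refine (isIso_iff_bijective _).2 ⟨?_, fun f => ?_⟩
    · have := tensComp_tensorMap_injective (α := 𝟙 (nerve.obj S.V)) (n := n)
        (fun _ => Function.injective_id) U
      rwa [tensorMap_id, Category.id_comp] at this
    · exact ⟨tensMk (U := U.unop) (nerve.obj S.V) n (f ≫ tensFst S.V n) (fun u => (f.toFun u).2)
        fun _ _ => level_le f, rfl⟩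
  have : IsIso (tensCompG S n).hom := NatIso.isIso_of_isIso_app _
  infer_instance

end TensorNormalForm

/-! ### The source of the pushout product -/

section Source

variable (S : Action PreBroad G)

/-- The map from `∂Ω[S] ⊗ Ω[1]`. -/
def boundaryTensor : tensorG (boundaryG S) (nerveG.obj (linG G 1)) ⟶
    (cylinderBoundary S).toAction :=
  (cylinderBoundary S).lift (tensorGMap (boundaryIncl S) (𝟙 _) ≫ tensCompG S 1) fun U z => by
    obtain ⟨x, χ, hχ, rfl⟩ := exists_eq_tensMk (boundaryG S).V 1 (U := U.unop) z
    exact Or.inl x.2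

/-- The map from `Ω[S] ⊗ {1}`. -/
def tensorVertex : tensorG (nerveG.obj S) (nerveG.obj (linG G 0)) ⟶
    (cylinderBoundary S).toAction :=
  (cylinderBoundary S).lift (tensorGMap (𝟙 _) (vertexOneG G) ≫ tensCompG S 1) fun U z => by
    obtain ⟨x, χ, hχ, rfl⟩ := exists_eq_tensMk (nerve.obj S.V) 0 (U := U.unop) z
    exact Or.inr fun u => rfl

/-- Both corners embed in the nerve of S ⊗ [1]; they intersect in ∂Ω[S] ⊗ {1}, and their union is
`cylinderBoundary S`. -/
theorem isPushout_cylinderBoundary :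
    IsPushout (tensorGMap (𝟙 (boundaryG S)) (vertexOneG G))
      (tensorGMap (boundaryIncl S) (𝟙 (nerveG.obj (linG G 0))))
      (boundaryTensor S) (tensorVertex S) := by
  have hinj : ∀ U, Function.Injective ((boundaryIncl S).hom.app U) :=
    fun _ => Subtype.val_injective
  have hb : ∀ U, Function.Injective ((tensorVertex S).hom.app U) := by
    intro U z z' h
    obtain ⟨φ, χ, hχ, rfl⟩ := exists_eq_tensMk (nerve.obj S.V) 0 (U := U.unop) z
    obtain ⟨φ', χ', hχ', rfl⟩ := exists_eq_tensMk (nerve.obj S.V) 0 (U := U.unop) z'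
    obtain rfl : χ = χ' := funext fun u => Subsingleton.elim (α := Fin 1) _ _
    obtain ⟨rfl, -⟩ := tensPair_injective (n := 1) (φ := φ) (φ' := φ') (χ := fun _ => 1)
      (χ' := fun _ => 1) (hχ := fun _ _ _ => le_rfl) (hχ' := fun _ _ _ => le_rfl)
      (congrArg Subtype.val h)
    rfl
  refine isPushout_of_elements ?_ ?_ ?_ ?_ ?_ ?_
  · refine GSieve.hom_ext _ ?_
    apply Action.hom_ext
    ext U ⟨a⟩
    rfl
  · intro U z z' h
    exact tensComp_tensorMap_injective (n := 0) hinj U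
      (congrArg ((tensComp S.V (linear 0)).app U) h)
  · intro U z z' h
    exact tensComp_tensorMap_injective (n := 1) hinj U (congrArg Subtype.val h)
  · intro U y z h
    obtain ⟨x, χ, hχ, rfl⟩ := exists_eq_tensMk (boundaryG S).V 1 (U := U.unop) y
    obtain ⟨φ, χ', hχ', rfl⟩ := exists_eq_tensMk (nerve.obj S.V) 0 (U := U.unop) z
    obtain ⟨h1, -⟩ := tensPair_injective (n := 1) (φ := x.1) (φ' := φ) (χ := χ)
      (χ' := fun _ => 1) (hχ := hχ) (hχ' := fun _ _ _ => le_rfl) (congrArg Subtype.val h)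
    subst h1
    exact ⟨tensMk (U := U.unop) (boundaryG S).V 0 x χ' hχ', rfl⟩
  · exact fun U z z' _ _ h => hb U h
  · rintro U ⟨f, hf | hf⟩
    · exact Or.inl ⟨tensMk (U := U.unop) (boundaryG S).V 1 ⟨f ≫ tensFst S.V 1, hf⟩
        (fun u => (f.toFun u).2) fun _ _ => level_le f, rfl⟩
    · refine Or.inr ⟨tensMk (U := U.unop) (nerve.obj S.V) 0 (f ≫ tensFst S.V 1) (fun _ => 0)
        fun _ _ _ => le_rfl, Subtype.ext (PreBroad.hom_ext fun u => ?_)⟩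
      exact Prod.ext rfl (hf u).symm

theorem exists_iso_pushoutProductSource :
    ∃ e : pushoutProductSource (boundaryIncl S) (vertexOneG G) ≅ (cylinderBoundary S).toAction,
      e.hom ≫ (cylinderBoundary S).incl =
        pushoutProduct (boundaryIncl S) (vertexOneG G) ≫ tensCompG S 1 := by
  have h := isPushout_cylinderBoundary S
  refine ⟨h.isoPushout.symm, pushout.hom_ext ?_ ?_⟩
  · refine (reassoc_of% h.inl_isoPushout_inv) (cylinderBoundary S).incl |>.trans ?_
    exact congrArg (· ≫ tensCompG S 1) (pushout.inl_desc _ _ _).symm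
  · refine (reassoc_of% h.inr_isoPushout_inv) (cylinderBoundary S).incl |>.trans ?_
    exact congrArg (· ≫ tensCompG S 1) (pushout.inr_desc _ _ _).symm

end Source

/-! ### The last pushout -/

section LastPushout

theorem PreBroad.IsTree.eq_singleton_of_isRootTuple {P : PreBroad} (hP : P.IsTree) {r : Multiset P}
    (hr : P.IsRootTuple r) : r = {rootEdge hP} := by
  refine (Multiset.Nodup.ext hr.1 (Multiset.nodup_singleton _)).2 fun x => ?_
  rw [hr.2, Multiset.mem_singleton]
  refine ⟨fun hx => (hx _ (desc_rootEdge hP x)).symm, ?_⟩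
  rintro rfl e he
  exact hP.isSeparated.desc_antisymm (desc_rootEdge hP e) he

variable {P : PreBroad} (hP : P.IsTree)

include hP in
theorem exists_isRootTuple : ∃ r, P.IsRootTuple r :=
  ⟨{rootEdge hP}, Multiset.nodup_singleton _, fun x => by
    rw [Multiset.mem_singleton]
    refine ⟨?_, fun hx => (hx _ (desc_rootEdge hP x)).symm⟩
    rintro rfl e he
    exact hP.isSeparated.desc_antisymm (desc_rootEdge hP e) he⟩

/-- The map `P ⋆ η ⟶ P ⊗ [1]` sending the edges of `P` to edges over `0` and `η` to the root. -/
noncomputable def joinTens : join P 0 ⟶ tens P (linear 1) :=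
  Hom.mk (Sum.elim (fun e => (e, (0 : Fin 2))) fun _ => (rootEdge hP, (1 : Fin 2))) (by
    rintro s (e | j) h
    · obtain ⟨t, rfl, ht⟩ := h
      refine tens_rel_iff.2 ⟨?_, fun x hx => ?_⟩
      · rw [Multiset.map_map, Multiset.map_map]
        simpa [Function.comp_def] using ht
      · obtain ⟨y, hy, rfl⟩ := Multiset.mem_map.1 hx
        obtain ⟨z, -, rfl⟩ := Multiset.mem_map.1 hy
        exact le_rfl
    · refine tens_rel_iff.2 ⟨?_, fun x _ => Fin.le_last _⟩
      rcases h with ⟨i, -, rfl⟩ | ⟨t, r, rfl, hr, ht⟩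
      · exact P.str.refl (rootEdge hP)
      · rw [hP.eq_singleton_of_isRootTuple hr, leTuple_singleton] at ht
        rw [Multiset.map_map, Multiset.map_map]
        simpa [Function.comp_def] using ht)

theorem joinTens_inl (e : P) : (joinTens hP).toFun (Sum.inl e) = (e, (0 : Fin 2)) := rfl

theorem joinTens_injective : Function.Injective (joinTens hP).toFun := by
  rintro (a | i) (b | j) h
  · exact congrArg Sum.inl (congrArg Prod.fst h : a = b)
  · exact absurd (congrArg Prod.snd h : (0 : Fin 2) = 1) zero_ne_one
  · exact absurd (congrArg Prod.snd h : (1 : Fin 2) = 0) one_ne_zero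
  · exact congrArg Sum.inr (Subsingleton.elim (α := Fin 1) _ _)

theorem exists_map_inl {α β : Type} (s : Multiset (α ⊕ β)) (h : ∀ b, Sum.inr b ∉ s) :
    ∃ t : Multiset α, t.map Sum.inl = s :=
  exists_map_eq _ s fun x hx => by
    rcases x with a | b
    · exact ⟨a, rfl⟩
    · exact absurd hx (h b)

/-- If the tuple contains η, the output must be at level `1`, hence is η too, and then simplicity
leaves no other input. If not, the relation is one of `P`, or a tuple below its root. -/
theorem joinTens_reflects : Reflects (joinTens hP) := by
  rintro s e h
  obtain ⟨h1, h2⟩ := tens_rel_iff.1 h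
  by_cases hs : ∀ j, Sum.inr j ∉ s
  · obtain ⟨t, rfl⟩ := exists_map_inl s hs
    have h3 : P.rel t ((joinTens hP).toFun e).1 := by
      rw [Multiset.map_map, Multiset.map_map] at h1
      simpa [Function.comp_def, joinTens_inl] using h1
    rcases e with e | j
    · exact ⟨t, rfl, h3⟩
    · obtain ⟨r, hr⟩ := exists_isRootTuple hP
      refine Or.inr ⟨t, r, rfl, hr, ?_⟩
      rw [hP.eq_singleton_of_isRootTuple hr, leTuple_singleton]
      exact h3
  · push Not at hs
    obtain ⟨j, hj⟩ := hs
    obtain ⟨t, rfl⟩ := Multiset.exists_cons_of_mem hj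
    rcases e with e | k
    · have := h2 _ (Multiset.mem_map_of_mem _ hj)
      exact absurd (Fin.le_zero_iff.1 this) one_ne_zero
    · rw [Multiset.map_cons, Multiset.map_cons] at h1
      have := Multiset.map_eq_zero.1 (Multiset.map_eq_zero.1 (hP.isSeparated.eq_zero h1))
      subst this
      exact Or.inl ⟨j, (Subsingleton.elim (α := Fin 1) j k).le, rfl⟩

theorem joinTens_mem_cellEdges (x : join P 0) :
    (joinTens hP).toFun x ∈ cellEdges (Set.univ : Set P) := by
  rcases x with e | j
  · exact Or.inl ⟨rfl, Set.mem_univ e⟩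
  · exact Or.inr ⟨rfl, fun b _ h => hP.isSeparated.desc_antisymm (desc_rootEdge hP b) h⟩

theorem mem_range_joinTens {p : tens P (linear 1)} (h : p ∈ cellEdges (Set.univ : Set P)) :
    p ∈ Set.range (joinTens hP).toFun := by
  rcases h with h | h
  · exact ⟨Sum.inl p.1, Prod.ext rfl h.1.symm⟩
  · exact ⟨Sum.inr (0 : Fin 1), Prod.ext (h.2 _ trivial (desc_rootEdge hP _)) h.1.symm⟩

theorem isLower_univ : IsLower (Set.univ : Set P) := fun _ _ _ _ => trivial

theorem cell_univ_diff_horn {p : P × Fin 2} :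
    p ∈ cellEdges (Set.univ : Set P) \ hornEdges Set.univ ↔ p.2 = 0 :=
  (mem_cell_diff_horn isLower_univ).trans (by simp)

theorem zero_mem_cell_univ (a : P) :
    ((a, (0 : Fin 2)) : P × Fin 2) ∈ cellEdges (Set.univ : Set P) \ hornEdges Set.univ :=
  cell_univ_diff_horn.2 rfl

include hP in
theorem desc_joinEta (x : join P 0) : (join P 0).Desc x (Sum.inr (0 : Fin 1)) := by
  rcases x with e | j
  · obtain ⟨s, hs, h⟩ := desc_rootEdge hP e
    obtain ⟨r, hr⟩ := exists_isRootTuple hP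
    refine ⟨s.map Sum.inl, Multiset.mem_map_of_mem _ hs, Or.inr ⟨s, r, rfl, hr, ?_⟩⟩
    rwa [hP.eq_singleton_of_isRootTuple hr, leTuple_singleton]
  · obtain rfl : j = (0 : Fin 1) := Subsingleton.elim (α := Fin 1) _ _
    exact desc_refl _

variable {S : Action PreBroad G} (hS : S.V.IsTree)

/-- The map `S ⋆ η ⟶ S ⊗ [1]`, equivariantly. -/
noncomputable def joinTensG : joinG S 0 ⟶ tensLinG S 1 where
  hom := joinTens hS
  comm g := by
    apply PreBroad.hom_ext
    rintro (e | j)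
    · rfl
    · exact Prod.ext (smul_rootEdge hS g).symm rfl

/-- `mem_boundary_or_of_face` for `D` the set of all edges: a proper lower subset cannot contain the
root, so its cell belongs to `cylinderInner`. -/
theorem cylinderInner_comp_joinTens_of_mem_horn {U : Omega} {f : U.toPre ⟶ join S.V 0}
    (hf : f ∈ (horn (join S.V 0) {Sum.inr (0 : Fin 1)}).obj (op U)) :
    (cylinderInner hS).mem (f ≫ joinTens hS) := by
  obtain ⟨V, m, h, hm, hV, rfl⟩ := hf
  refine (cylinderInner hS).precomp h (m ≫ joinTens hS) ?_
  refine (mem_cylinderInner_iff hS _).2 ?_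
  have key : ¬ cellEdges Set.univ \ hornEdges Set.univ ⊆ Set.range (m ≫ joinTens hS).toFun ∨
      ¬ Reflects (m ≫ joinTens hS) := by
    by_contra! hcon
    refine hV ⟨fun s e hs => hcon.2 _ _ ?_, fun v x r _ _ hx => ?_⟩
    · have := Hom.map_rel (joinTens hS) _ _ hs
      rwa [Multiset.map_map] at this
    · rcases x with a | j
      · obtain ⟨v, hv⟩ := hcon.1 (zero_mem_cell_univ a)
        exact absurd ⟨v, joinTens_injective hS hv⟩ hx
      · exact congrArg Sum.inr (Subsingleton.elim (α := Fin 1) _ _)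
  refine (mem_boundary_or_of_face hS isLower_univ (m ≫ joinTens hS)
    ((joinTens_injective hS).comp hm) (fun v => joinTens_mem_cellEdges hS _) key).imp_right ?_
  rintro ⟨D, hD, hlow, h⟩
  exact ⟨D, hlow, fun hr => hD.2 fun a _ => hlow _ _ (desc_rootEdge hS a) hr, h⟩

/-- The image of `f` is all of S ⋆ η or omits only η, so it contains S × {0} with all relations. The
first excludes cells avoiding `(r, 0)`, both together exclude ∂Ω[S]. -/
theorem not_cylinderInner_comp_joinTens {U : Omega} {f : U.toPre ⟶ join S.V 0}
    (hf : f ∉ (horn (join S.V 0) {Sum.inr (0 : Fin 1)}).obj (op U)) :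
    ¬ (cylinderInner hS).mem (f ≫ joinTens hS) := by
  obtain ⟨V, d, m, σ, hdm, hm, hσ, -⟩ := U.toPre_isTree.exists_image
    (isSeparated_tens (n := 1) hS.isSeparated) (f ≫ joinTens hS)
  obtain ⟨m, rfl⟩ := (joinTens_reflects hS).exists_lift m fun v => by
    rw [← hσ v, ← comp_toFun, hdm]
    exact ⟨_, rfl⟩
  have hdm' : d ≫ m = f := PreBroad.hom_ext fun u => joinTens_injective hS
    (congrArg (fun k : U.toPre ⟶ tens S.V (linear 1) => k.toFun u) hdm)
  have hm' : Function.Injective m.toFun := fun a b h => hm (congrArg (joinTens hS).toFun h)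
  obtain ⟨hrefl, hsurj⟩ : IsComplFace ({Sum.inr (0 : Fin 1)} : Set (join S.V 0)) V m := by
    by_contra h
    exact hf ⟨V, m, d, hm', h, hdm'⟩
  have hrange : cellEdges (Set.univ : Set S.V) \ hornEdges Set.univ ⊆
      Set.range (f ≫ joinTens hS).toFun := by
    rintro ⟨a, i⟩ hp
    obtain rfl : i = 0 := cell_univ_diff_horn.1 hp
    obtain ⟨v, -⟩ := V.toPre_isTree.root
    obtain ⟨w, hw⟩ : Sum.inl a ∈ Set.range m.toFun := by
      by_contra h
      exact Sum.inl_ne_inr (hsurj v (Sum.inl a) _ (desc_joinEta hS _) (desc_joinEta hS _) h)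
    refine ⟨σ.toFun w, ?_⟩
    rw [← hdm, comp_toFun, hσ, comp_toFun, hw]
    rfl
  refine fun hmem => ?_
  rcases (mem_cylinderInner_iff hS _).1 hmem with h | ⟨D, -, hr, h⟩
  · exact not_mem_boundary_of_isFull isLower_univ hrange
      ((isFull_of_section σ hdm' hσ hrefl).comp (joinTens_reflects hS)) h
  · obtain ⟨u, hu⟩ := hrange (zero_mem_cell_univ (rootEdge hS))
    exact hr (mem_of_mem_cell_zero ((congrArg (· ∈ cellEdges D) hu).mp (h u)))

theorem cylinderInner_or_exists_lift {U : Omega} (f : U.toPre ⟶ tens S.V (linear 1)) :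
    (cylinderInner hS).mem f ∨ ∃ f' : U.toPre ⟶ join S.V 0, f' ≫ joinTens hS = f := by
  by_cases hf : (f ≫ tensFst S.V 1) ∈ (boundary S.V).obj (op U)
  · exact Or.inl ((mem_cylinderInner_iff hS f).2 (Or.inl hf))
  · obtain ⟨D, hD, h⟩ := exists_isLower_of_not_mem_boundary hS hf
    by_cases hr : rootEdge hS ∈ D
    · refine Or.inr ((joinTens_reflects hS).exists_lift f fun u => mem_range_joinTens hS ?_)
      -- A lower set containing the root is everything.
      rw [← Set.eq_univ_of_forall fun a => hD _ _ (desc_rootEdge hS a) hr]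
      exact h u
    · exact Or.inl ((mem_cylinderInner_iff hS f).2 (Or.inr ⟨D, hD, hr, h⟩))

theorem isPushout_cylinderInner :
    IsPushout ((cylinderInner hS).lift (outerHornIncl S ≫ nerveG.map (joinTensG hS)) fun _ x =>
        cylinderInner_comp_joinTens_of_mem_horn hS x.2)
      (outerHornIncl S) (cylinderInner hS).incl (nerveG.map (joinTensG hS)) := by
  refine isPushout_of_elements rfl (fun U => Subtype.val_injective)
    (GSieve.incl_injective _) ?_ ?_ ?_
  · rintro U y z h
    refine ⟨⟨z, ?_⟩, rfl⟩
    by_contra hz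
    have h' : y.1 = (z ≫ joinTens hS :) := h
    refine not_cylinderInner_comp_joinTens hS (U := U.unop) hz ?_
    exact (congrArg (fun k : U.unop.toPre ⟶ tens S.V (linear 1) => (cylinderInner hS).mem k) h').mp
      y.2
  · intro U z z' _ _ h
    exact PreBroad.hom_ext fun u => joinTens_injective hS
      (congrArg (fun k : U.unop.toPre ⟶ tens S.V (linear 1) => k.toFun u) h)
  · intro U f
    exact (cylinderInner_or_exists_lift hS (U := U.unop) f).imp (fun h => ⟨⟨f, h⟩, rfl⟩) id

end LastPushout

end Dendro

/-! ### The factorization -/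

theorem mainTheorem5 {G : Type*} [Group G] [Finite G] (S : Action PreBroad G) (hS : S.V.IsTree)
    (hη : IsEmpty (S.V ≅ eta)) :
    ∃ (B : Action DSet G)
      (j : pushoutProductSource (boundaryIncl S) (vertexOneG G) ⟶ B)
      (k : B ⟶ tensorG (nerveG.obj S) (nerveG.obj (linG G 1))),
      j ≫ k = pushoutProduct (boundaryIncl S) (vertexOneG G) ∧
      GInnerAnodyne G j ∧
      ∃ (t : hornG (joinG S 0) (etaEdge S) (etaEdge_stable S) ⟶ B)
        (b : nerveG.obj (joinG S 0) ⟶ tensorG (nerveG.obj S) (nerveG.obj (linG G 1))),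
        IsPushout t (outerHornIncl S) k b ∧
        nerveG.map (linearOneG G).hom ≫ nerveG.map (rootJoinG S hS) ≫ b =
          (etaTensG G).hom ≫
            tensorGMap (nerveG.map (rootG S hS)) (𝟙 (nerveG.obj (linG G 1))) := by
  obtain ⟨hle, hano⟩ := anodyne_cylinderInner hS
  obtain ⟨e, he⟩ := exists_iso_pushoutProductSource S
  -- All constructions live in the nerve of S ⊗ [1] and are carried back to Ω[S] ⊗ Ω[1] along the
  -- inverse of `tensCompG`.
  refine ⟨(cylinderInner hS).toAction, e.hom ≫ GSieve.ofLE hle,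
    (cylinderInner hS).incl ≫ inv (tensCompG S 1), ?_, (gInnerAnodyne_of_isIso e.hom).comp hano,
    (cylinderInner hS).lift _ _, nerveG.map (joinTensG hS) ≫ inv (tensCompG S 1),
    (isPushout_cylinderInner hS).of_iso (Iso.refl _) (Iso.refl _) (Iso.refl _)
      (asIso (tensCompG S 1)).symm ((Category.comp_id _).trans (Category.id_comp _).symm)
      (by simp) (by simp) (by simp), ?_⟩
  · rw [← Category.assoc, IsIso.comp_inv_eq, ← he, Category.assoc, GSieve.ofLE_incl]
  · rw [← Category.assoc, ← Category.assoc, IsIso.comp_inv_eq]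
    apply Action.hom_ext
    apply NatTrans.ext
    funext U
    ext f
    refine PreBroad.hom_ext fun u => ?_
    -- Condition (c) is checked on edges: both composites send `i` in [1] to `(r, i)`.
    change PreBroad.Hom.toFun (joinTens hS) (Sum.map (rootMap hS).toFun id
      (linearOneIso.hom.toFun (PreBroad.Hom.toFun f u))) = (rootEdge hS, PreBroad.Hom.toFun f u)
    generalize PreBroad.Hom.toFun f u = i
    change Fin 2 at i
    fin_cases i <;> rfl
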